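/- **Setting.** Let $0\le\gamma<1$ and let $\beta:[0,\pi/2]\to\mathbb R$ be measurable with $0\le\beta(\theta)\le C\cos\theta\sin\theta$ for some constant $C$ and $\beta_0:=\int_0^{\pi/2}\beta(\theta)\,d\theta>0$. Consider the cross section $B(|V|,\theta)=|V|^\gamma\beta(\theta)$ (cutoff Maxwellian gas or cutoff hard potential) and the collision operator $$Q(F,F)(\zeta)=\int_{\mathbb R^3}\int_0^{2\pi}\int_0^{\pi/2}\big(F(\zeta')F(\zeta_*')-F(\zeta)F(\zeta_*)\big)B(|\zeta_*-\zeta|,\theta)\,d\theta\,d\epsilon\,d\zeta_*,$$ where $\zeta'=\zeta+((\zeta_*-\zeta)\cdot\omega)\omega$, $\zeta_*'=\zeta_*-((\zeta_*-\zeta)\cdot\omega)\omega$, and $\omega\in S^2$ is the unit vector with polar angle $\theta$ and azimuth $\epsilon$ with respect to the axis $\zeta_*-\zeta$. Let $\mathcal M(\zeta)=\pi^{-3/2}e^{-|\zeta|^2}$ and let $L$ be the linearization of $Q$ at $\mathcal M$, with $F=\mathcal M+\mathcal M^{1/2}f$. Then $L=-\nu+K$, where $$\nu(|\zeta|)=2\pi\beta_0\int_{\mathbb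 R^3}\mathcal M(\eta)|\eta-\zeta|^\gamma\,d\eta$$ and, with $h=\mathcal M^{1/2}g$, $$K(g)(\zeta)=\mathcal M(\zeta)^{-1/2}\int_{\mathbb R^3}\int_0^{2\pi}\int_0^{\pi/2}\big(\mathcal M(\zeta')h(\zeta_*')+h(\zeta')\mathcal M(\zeta_*')-\mathcal M(\zeta)h(\zeta_*)\big)B(|\zeta_*-\zeta|,\theta)\,d\theta\,d\epsilon\,d\zeta_*;$$ $K$ acts on functions of $(x,\zeta)$ in the variable $\zeta$ only. Let $\Omega\subset\mathbb R^3$ be a nonempty bounded convex open set with $C^1$ boundary and outer unit normal $n$, and let $\Gamma_-=\{(X,\zeta):X\in\partial\Omega,\ \zeta\cdot n(X)<0\}$. For $x\in\Omega$ and $\zeta\neq0$ let $\tau_-(x,\zeta)=\inf\{s>0:x-s\zeta\notin\Omega\}$ and $p(x,\zeta)=x-\tau_-(x,\zeta)\zeta\in\partial\Omega$. A function $f$ on $\overline\Omega\times\mathbb R^3$ is called a solution of $\zeta\cdot\nabla_x f=L(f)$ if for almost every $(x,\zeta)\in\Omega\times\mathbb R^3$ $$f(x,\zeta)=f(p(x,\zeta),\zeta)\,e^{-\nu(|\zeta|)\tau_-(x,\zeta)}+\int_0^{\tau_-(x,\zeta)}e^{-\nu(|\zeta|)s}K(f)(x-s\zeta,\zeta)\,ds.$$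 Write $g\in L^*_\zeta$ if $\|g\|_{L^*_\zeta}^2=\int_{\mathbb R^3}|g|^2\nu\,d\zeta<\infty$; $f\in L^*_{x,\zeta}$ if $\int_\Omega\|f(x,\cdot)\|_{L^*_\zeta}^2\,dx<\infty$; $f\in L^\infty_xL^*_\zeta$ if $\operatorname{ess\,sup}_{x\in\Omega}\|f(x,\cdot)\|_{L^*_\zeta}<\infty$; and $f\in L^\infty_{x,\zeta}$ if $f$ is essentially bounded on $\Omega\times\mathbb R^3$. **Proposition (gaining of integrability).** Let $f\in L^*_{x,\zeta}$ be a solution of $\zeta\cdot\nabla_x f=L(f)$, and suppose there is $\phi\in L^*_\zeta$ such that $|f(X,\eta)|\le\phi(\eta)$ for all $(X,\eta)\in\Gamma_-$. Then $f\in L^\infty_xL^*_\zeta$. If, moreover, for some fixed $0<\sigma<\frac12$ there is $M>0$ such that $$|f(X,\eta)-f(Y,\omega)|\le M\big(|\eta-\omega|^2+|X-Y|^2\big)^{\sigma/2}\qquad\text{for all }(X,\eta),(Y,\omega)\in\Gamma_-,$$ then $f\in L^\infty_{x,\zeta}$. -/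

import Mathlib

open MeasureTheory Metric Set Filter Topology
open scoped ENNReal InnerProductSpace

noncomputable section

namespace LinBoltzmann

/-- Physical space and velocity space are both `ℝ³` with the Euclidean norm. -/
abbrev E : Type := EuclideanSpace ℝ (Fin 3)

/-- The unit sphere `S²`. -/
abbrev S2 : Type := Metric.sphere (0 : E) 1

/-! ### The collision model -/

/-- The cross section `B(|V|, θ) = |V| ^ γ β(θ)`, `0 ≤ θ ≤ π / 2`, is that of a cutoff Maxwellian
gas (`γ = 0`) or a cutoff hard potential (`0 < γ < 1`), and it is nontrivial. -/
structure IsCutoffCrossSection (γ : ℝ) (β : ℝ → ℝ) : Prop where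
  gamma_nonneg : 0 ≤ γ
  gamma_lt_one : γ < 1
  measurable : Measurable β
  cutoff : ∃ C : ℝ, ∀ θ ∈ Icc 0 (Real.pi / 2),
    0 ≤ β θ ∧ β θ ≤ C * (Real.cos θ * Real.sin θ)
  nontrivial : 0 < ∫ θ in (0 : ℝ)..(Real.pi / 2), β θ

/-- The standard Maxwellian `π ^ (-3/2) exp (-|ζ|²)`. -/
def maxwellian (ζ : E) : ℝ := Real.pi ^ (-(3 / 2) : ℝ) * Real.exp (-‖ζ‖ ^ 2)

/-- Post-collisional velocity `ζ' = ζ + ((ζ_* - ζ) · ω) ω`. -/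
def postVel (ζ ζs : E) (ω : S2) : E := ζ + ⟪ζs - ζ, (ω : E)⟫_ℝ • (ω : E)

/-- Post-collisional velocity `ζ_*' = ζ_* - ((ζ_* - ζ) · ω) ω`. -/
def postVelStar (ζ ζs : E) (ω : S2) : E := ζs - ⟪ζs - ζ, (ω : E)⟫_ℝ • (ω : E)

/-- The angle `θ ∈ [0, π / 2]` between the line through `V` and the line through `ω`. -/
def collAngle (V : E) (ω : S2) : ℝ := Real.arccos (|⟪V, (ω : E)⟫_ℝ| / ‖V‖)

/-- The cross section as a density with respect to the surface measure `dω` of the whole sphere.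
In spherical coordinates `(θ, ε)` for `ω` with polar axis `V` one has `dω = sin θ dθ dε`, and
`0 ≤ θ ≤ π / 2` is a half sphere, so that for every `G` which is even in `ω`
`∫_{S²} G(ω) crossSection γ β V ω dω = ∫₀^{2π} ∫₀^{π/2} G(ω(θ, ε)) |V| ^ γ β(θ) dθ dε`.
The post-collisional velocities are even in `ω`. -/
def crossSection (γ : ℝ) (β : ℝ → ℝ) (V : E) (ω : S2) : ℝ :=
  (1 / 2) * (‖V‖ ^ γ * (β (collAngle V ω) / Real.sin (collAngle V ω)))

/-- The collision frequency
`ν(ζ) = ∫ ∫ ∫ M(ζ_*) B(|ζ_* - ζ|, θ) dθ dε dζ_* = 2π β₀ ∫ M(η) |η - ζ| ^ γ dη`,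
with `β₀ = ∫₀^{π/2} β(θ) dθ`. -/
def nu (γ : ℝ) (β : ℝ → ℝ) (ζ : E) : ℝ :=
  2 * Real.pi * (∫ θ in (0 : ℝ)..(Real.pi / 2), β θ) *
    ∫ η : E, maxwellian η * ‖η - ζ‖ ^ γ

/-- The operator `K` in `L = -ν + K`. Here `L` is the linearization of
`Q(F, F) = ∫ ∫ ∫ (F' F_*' - F F_*) B dθ dε dζ_*` at the Maxwellian `M`, with `F = M + M^{1/2} g`:
`L g = M^{-1/2} ∫ ∫ ∫ (M' h_*' + h' M_*' - M h_* - h M_*) B dθ dε dζ_*` with `h = M^{1/2} g`.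
The last term is `-ν g`, the other three make up `K g`. -/
def collK (γ : ℝ) (β : ℝ → ℝ) (g : E → ℝ) (ζ : E) : ℝ :=
  let h : E → ℝ := fun η => Real.sqrt (maxwellian η) * g η
  (Real.sqrt (maxwellian ζ))⁻¹ *
    ∫ ζs : E, ∫ ω : S2,
      (maxwellian (postVel ζ ζs ω) * h (postVelStar ζ ζs ω)
        + h (postVel ζ ζs ω) * maxwellian (postVelStar ζ ζs ω)
        - maxwellian ζ * h ζs) * crossSection γ β (ζs - ζ) ω
      ∂((volume : Measure E).toSphere)

/-! ### The domain -/

/-- `ρ` is a `C¹` defining function of `Ω` near the boundary point `X`. -/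
def IsC1DefiningAt (Ω : Set E) (X : E) (ρ : E → ℝ) : Prop :=
  ContDiffAt ℝ 1 ρ X ∧ ρ X = 0 ∧ gradient ρ X ≠ 0 ∧ ∀ᶠ y in 𝓝 X, (y ∈ Ω ↔ ρ y < 0)

/-- A bounded convex domain in `ℝ³` with `C¹` boundary. -/
structure IsC1ConvexDomain (Ω : Set E) : Prop where
  isOpen : IsOpen Ω
  nonempty : Ω.Nonempty
  convex : Convex ℝ Ω
  bounded : Bornology.IsBounded Ω
  boundary : ∀ X ∈ frontier Ω, ∃ ρ : E → ℝ, IsC1DefiningAt Ω X ρ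

/-- `n` is the outer unit normal of `Ω` at `X`. -/
def IsOuterNormal (Ω : Set E) (X n : E) : Prop :=
  ∃ ρ : E → ℝ, IsC1DefiningAt Ω X ρ ∧ n = ‖gradient ρ X‖⁻¹ • gradient ρ X

/-- The incoming part `Γ₋` of the phase boundary. -/
def incoming (Ω : Set E) : Set (E × E) :=
  {z | z.1 ∈ frontier Ω ∧ ∃ n : E, IsOuterNormal Ω z.1 n ∧ ⟪z.2, n⟫_ℝ < 0}

/-- The time `τ₋(x, ζ)` after which the backward trajectory from `x` with velocity `ζ` leaves `Ω`
(for `x ∈ Ω`, `ζ ≠ 0`). -/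
def backTime (Ω : Set E) (x ζ : E) : ℝ := sInf {s : ℝ | 0 < s ∧ x - s • ζ ∉ Ω}

/-- The boundary point `p(x, ζ)` at which the backward trajectory leaves `Ω`. -/
def backPoint (Ω : Set E) (x ζ : E) : E := x - backTime Ω x ζ • ζ

/-! ### Function spaces and solutions -/

/-- The measure `ν(|ζ|) dζ` on velocity space. -/
def nuMeasure (γ : ℝ) (β : ℝ → ℝ) : Measure E :=
  volume.withDensity fun ζ => ENNReal.ofReal (nu γ β ζ)

/-- `g ∈ L^*_ζ`, that is, `∫ |g(ζ)|² ν(|ζ|) dζ < ∞`. -/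
def MemLStarV (γ : ℝ) (β : ℝ → ℝ) (g : E → ℝ) : Prop :=
  MemLp g 2 (nuMeasure γ β)

/-- `f ∈ L^*_{x,ζ}`, that is, `∫_Ω ∫ |f(x, ζ)|² ν(|ζ|) dζ dx < ∞`. -/
def MemLStarXV (γ : ℝ) (β : ℝ → ℝ) (Ω : Set E) (f : E → E → ℝ) : Prop :=
  MemLp (Function.uncurry f) 2 ((volume.restrict Ω).prod (nuMeasure γ β))

/-- `f ∈ L^∞_x L^*_ζ`: the `L^*_ζ` norm of `f(x, ·)` is essentially bounded for `x ∈ Ω`. -/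
def MemLInfLStar (γ : ℝ) (β : ℝ → ℝ) (Ω : Set E) (f : E → E → ℝ) : Prop :=
  AEStronglyMeasurable (Function.uncurry f) ((volume.restrict Ω).prod (nuMeasure γ β)) ∧
    essSup (fun x => eLpNorm (f x) 2 (nuMeasure γ β)) (volume.restrict Ω) < ∞

/-- `f ∈ L^∞_{x,ζ}`. -/
def MemLInfXV (Ω : Set E) (f : E → E → ℝ) : Prop :=
  MemLp (Function.uncurry f) ∞ ((volume.restrict Ω).prod (volume : Measure E))

/-- `f` solves `ζ · ∇f = L f` in `Ω`: for almost every `(x, ζ) ∈ Ω × ℝ³`,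
`f(x, ζ) = f(p(x, ζ), ζ) e^{-ν τ₋} + ∫₀^{τ₋} e^{-ν s} K(f)(x - ζ s, ζ) ds`. -/
def IsSolution (γ : ℝ) (β : ℝ → ℝ) (Ω : Set E) (f : E → E → ℝ) : Prop :=
  ∀ᵐ z : E × E ∂((volume.restrict Ω).prod (volume : Measure E)),
    f z.1 z.2 =
      f (backPoint Ω z.1 z.2) z.2 * Real.exp (-(nu γ β z.2 * backTime Ω z.1 z.2)) +
        ∫ s in (0 : ℝ)..(backTime Ω z.1 z.2),
          Real.exp (-(nu γ β z.2 * s)) * collK γ β (f (z.1 - s • z.2)) z.2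

end LinBoltzmann

end

/-!
A solution `f` gains integrability because `K` regularizes in velocity and the transport along
characteristics turns this into regularization in space.

*The operator `K`* (`exists_collK_sq_le`). For `g ∈ L^*_ζ`,
`|K g(ζ)|² ≤ C (1 + |ζ|) ^ (γ - 3) ‖g‖²`. The cutoff assumption bounds the cross section, as a
density on the sphere, by `|V| ^ γ |cos θ|`, and the conservation of energy removes the growing
factor `M(ζ) ^ (-1/2)`. The two gain terms have the same bound, since `ω` may be exchanged with the
direction orthogonal to it in the plane of `V` and `ω` (`lintegral_sphere_swap`). In the gain term
one decomposes the relative velocity `V` into its components along `ω` and orthogonal to `ω`. The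
integral over the orthogonal component converges and gains `(1 + |ζ|) ^ (γ - 1)`
(`exists_lintegral_gain_direction_le`). What is left is an integral in polar coordinates around
`ζ`, to which the Cauchy–Schwarz inequality applies; the average over `ω` of the remaining Gaussian
in `ζ · ω` gains another `1 + |ζ|` (`exists_lintegral_gainExp_sq_le`). No kernel of `K` is computed.

*The inequality for the masses* (`exists_mass_le_potential`). Let `u(x) = ∫ |f(x, ζ)|² ν dζ`. By
the Duhamel formula and the Cauchy–Schwarz inequality in time, in which the decay
`exp (-ν s)` costs a factor `1 / ν` that the weight `ν` cancels,
`u(x) ≤ 2 ‖φ‖² + C ∫ (1 + |ζ|) ^ (γ - 3) ∫₀^∞ u(x - s ζ) ds dζ`, where `u = 0` outside `Ω`. In polar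
coordinates for `ζ` the last integral is a multiple of the Riesz potential `∫ |x - y|⁻² u(y) dy`
(`exists_lintegral_rays_le`); here `γ < 1` is used.

*Bootstrap* (`exists_ae_le_of_le_potential`). As `Ω` has finite measure, composition with
`|x - y|⁻²` improves the singularity of a kernel by half a power. Since `u` is integrable, four
steps show that the Riesz potential of `u`, and hence `u`, is bounded. This is the first assertion.

*Bounded data.* A large value of `|f(X, η)|` on the incoming boundary forces `φ` to be large on a
ball of velocities of radius `1/2`, whence `f` is bounded on the incoming boundary
(`exists_enorm_incoming_le`). As `u` is bounded, so is `K f`, and the Duhamel formula bounds `f`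
(`memLInfXV_of_ae_mass_le`). That the characteristics end in the incoming part of the boundary is
due to convexity (`backPoint_mem_incoming`).
-/

open MeasureTheory Metric Set Filter Topology
open scoped ENNReal InnerProductSpace

noncomputable section

namespace LinBoltzmann

/-! ### Integration over `ℝ³` and over the sphere -/

/-- Integration over `ℝ³` in the coordinates of an orthonormal basis. -/
theorem lintegral_eq_lintegral_coords (b : OrthonormalBasis (Fin 3) ℝ E) {H : E → ℝ≥0∞}
    (hH : Measurable H) :
    ∫⁻ x, H x = ∫⁻ t : ℝ, ∫⁻ p : ℝ × ℝ, H (t • b 0 + (p.1 • b 1 + p.2 • b 2)) := by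
  have h1 := ((b.measurePreserving_repr_symm).comp (PiLp.volume_preserving_toLp (Fin 3))).comp
    ((volume_preserving_piFinSuccAbove (fun _ : Fin 3 => ℝ) 0).symm)
  have h2 : MeasurePreserving (fun z : ℝ × ℝ × ℝ => (z.1, (MeasurableEquiv.piFinTwo
      (fun _ : Fin 2 => ℝ)).symm z.2)) :=
    (MeasurePreserving.id (volume : Measure ℝ)).prod
      ((volume_preserving_piFinTwo (fun _ : Fin 2 => ℝ)).symm)
  have h3 := h1.comp h2
  rw [← h3.lintegral_comp hH, Measure.volume_eq_prod, lintegral_prod]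
  · refine lintegral_congr fun t => lintegral_congr fun p => ?_
    congr 1
    simp only [Function.comp_apply]
    rw [← b.sum_repr_symm]
    simp [Fin.sum_univ_three, MeasurableEquiv.piFinSuccAbove, Fin.insertNthEquiv, add_assoc]
  · exact (hH.comp h3.measurable).aemeasurable

theorem lintegral_volumeIoiPow_coe (n : ℕ) (F : ℝ → ℝ≥0∞) (hF : Measurable F) :
    ∫⁻ r : Ioi (0 : ℝ), F r ∂(Measure.volumeIoiPow n) =
      ∫⁻ r in Ioi (0 : ℝ), ENNReal.ofReal (r ^ n) * F r := by
  rw [Measure.volumeIoiPow, lintegral_withDensity_eq_lintegral_mul]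
  · rw [← lintegral_subtype_comap measurableSet_Ioi]
    rfl
  · fun_prop
  · fun_prop

/-- Integration over `ℝ³` in polar coordinates. -/
theorem lintegral_eq_lintegral_polar {H : E → ℝ≥0∞} (hH : Measurable H) :
    ∫⁻ x, H x = ∫⁻ ω : S2, (∫⁻ r in Ioi (0 : ℝ), ENNReal.ofReal (r ^ 2) * H (r • (ω : E)))
      ∂((volume : Measure E).toSphere) := by
  have h := (volume : Measure E).measurePreserving_homeomorphUnitSphereProd
  have hm : Measurable fun z : S2 × Ioi (0 : ℝ) => H ((z.2 : ℝ) • (z.1 : E)) :=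
    hH.comp (by fun_prop)
  have h1 := h.lintegral_comp hm
  rw [lintegral_prod _ hm.aemeasurable] at h1
  have hd : Module.finrank ℝ E - 1 = 2 := by simp
  rw [hd] at h1
  calc ∫⁻ x, H x = ∫⁻ x in ({0}ᶜ : Set E), H x := by rw [restrict_compl_singleton]
    _ = ∫⁻ x : ({0}ᶜ : Set E), H x ∂((volume : Measure E).comap Subtype.val) :=
      (lintegral_subtype_comap (measurableSet_singleton _).compl _).symm
    _ = _ := by
      refine Eq.trans ?_ (h1.trans (lintegral_congr fun ω : S2 =>
        lintegral_volumeIoiPow_coe 2 (fun r => H (r • (ω : E))) (hH.comp (by fun_prop))))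
      refine lintegral_congr fun x => ?_
      congr 1
      have hx : ‖(x : E)‖ ≠ 0 := norm_ne_zero_iff.2 x.2
      simp [smul_smul, hx]

theorem norm_coords (b : OrthonormalBasis (Fin 3) ℝ E) (t p q : ℝ) :
    ‖t • b 0 + (p • b 1 + q • b 2)‖ ^ 2 = t ^ 2 + p ^ 2 + q ^ 2 := by
  have h := b.orthonormal
  rw [orthonormal_iff_ite] at h
  rw [← real_inner_self_eq_norm_sq]
  simp only [inner_add_left, inner_add_right, inner_smul_left, inner_smul_right, h]
  simp
  ring

/-- The point of the unit sphere with polar angle `θ` and azimuth `ε` in the orthonormal basis `b`,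
whose first vector is the polar axis. -/
def sphPoint (b : OrthonormalBasis (Fin 3) ℝ E) (θ ε : ℝ) : E :=
  Real.cos θ • b 0 + ((Real.sin θ * Real.cos ε) • b 1 + (Real.sin θ * Real.sin ε) • b 2)

theorem norm_sphPoint (b : OrthonormalBasis (Fin 3) ℝ E) (θ ε : ℝ) : ‖sphPoint b θ ε‖ = 1 := by
  have h := norm_coords b (Real.cos θ) (Real.sin θ * Real.cos ε) (Real.sin θ * Real.sin ε)
  have : ‖sphPoint b θ ε‖ ^ 2 = 1 := by
    rw [sphPoint, h]
    nlinarith [Real.sin_sq_add_cos_sq θ, Real.sin_sq_add_cos_sq ε]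
  nlinarith [norm_nonneg (sphPoint b θ ε)]

theorem measurable_sin_mul_comp_sphPoint (b : OrthonormalBasis (Fin 3) ℝ E) {Ψ : E → ℝ≥0∞}
    (hΨ : Measurable Ψ) :
    Measurable fun z : ℝ × ℝ => ENNReal.ofReal (Real.sin z.2) * Ψ (sphPoint b z.2 z.1) := by
  have h1 : Measurable fun z : ℝ × ℝ => sphPoint b z.2 z.1 := by unfold sphPoint; fun_prop
  have h2 : Measurable fun z : ℝ × ℝ => Ψ (sphPoint b z.2 z.1) := hΨ.comp h1
  have h3 : Measurable fun z : ℝ × ℝ => ENNReal.ofReal (Real.sin z.2) := by fun_prop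
  exact h3.mul h2

theorem lintegral_lintegral_mul_const {μ ν : Measure ℝ} [SFinite ν] {G : ℝ × ℝ → ℝ≥0∞}
    (hG : Measurable G) (c : ℝ≥0∞) :
    ∫⁻ x, ∫⁻ y, G (x, y) * c ∂ν ∂μ = (∫⁻ x, ∫⁻ y, G (x, y) ∂ν ∂μ) * c := by
  rw [← lintegral_mul_const _ hG.lintegral_prod_right']
  refine lintegral_congr fun x => ?_
  exact lintegral_mul_const _ (hG.comp measurable_prodMk_left)

theorem lintegral_polarCoord {H : ℝ × ℝ → ℝ≥0∞} (hH : Measurable H) :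
    ∫⁻ p, H p = ∫⁻ θ in Ioo (-Real.pi) Real.pi, ∫⁻ r in Ioi (0 : ℝ),
      ENNReal.ofReal r * H (r * Real.cos θ, r * Real.sin θ) := by
  rw [← lintegral_comp_polarCoord_symm, polarCoord_target, Measure.volume_eq_prod,
    ← Measure.prod_restrict, lintegral_prod_symm]
  · rfl
  · have : Measurable fun p : ℝ × ℝ =>
      ENNReal.ofReal p.1 • H (p.1 * Real.cos p.2, p.1 * Real.sin p.2) := by fun_prop
    exact this.aemeasurable

/-- Polar coordinates in the upper half plane. -/
theorem lintegral_halfPlane {H : ℝ × ℝ → ℝ≥0∞} (hH : Measurable H) :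
    ∫⁻ t : ℝ, ∫⁻ ρ in Ioi (0 : ℝ), H (t, ρ) = ∫⁻ θ in Ioo 0 Real.pi, ∫⁻ r in Ioi (0 : ℝ),
      ENNReal.ofReal r * H (r * Real.cos θ, r * Real.sin θ) := by
  have hs : MeasurableSet {p : ℝ × ℝ | 0 < p.2} := measurableSet_lt measurable_const measurable_snd
  have h := lintegral_polarCoord (hH.indicator hs)
  rw [Measure.volume_eq_prod, lintegral_prod _ (hH.indicator hs).aemeasurable] at h
  have e1 : ∀ t : ℝ, ∫⁻ ρ in Ioi (0 : ℝ), H (t, ρ) =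
      ∫⁻ ρ, {p : ℝ × ℝ | 0 < p.2}.indicator H (t, ρ) := by
    intro t
    rw [← lintegral_indicator measurableSet_Ioi]
    rfl
  simp_rw [e1, h]
  have hsub : Ioo 0 Real.pi ⊆ Ioo (-Real.pi) Real.pi :=
    Ioo_subset_Ioo_left (by linarith [Real.pi_pos])
  rw [← lintegral_indicator measurableSet_Ioo, ← lintegral_indicator measurableSet_Ioo]
  refine lintegral_congr fun θ => ?_
  by_cases h0 : θ ∈ Ioo 0 Real.pi
  · rw [indicator_of_mem (hsub h0), indicator_of_mem h0]
    refine setLIntegral_congr_fun measurableSet_Ioi fun r hr => ?_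
    have : (r * Real.cos θ, r * Real.sin θ) ∈ {p : ℝ × ℝ | 0 < p.2} :=
      mul_pos hr (Real.sin_pos_of_mem_Ioo h0)
    simp only [indicator_of_mem this]
  · rw [indicator_of_notMem h0]
    by_cases h1 : θ ∈ Ioo (-Real.pi) Real.pi
    · rw [indicator_of_mem h1]
      have hle : Real.sin θ ≤ 0 := by
        refine Real.sin_nonpos_of_nonpos_of_neg_pi_le ?_ h1.1.le
        by_contra hc
        exact h0 ⟨not_le.1 hc, h1.2⟩
      rw [setLIntegral_congr_fun measurableSet_Ioi (g := fun _ => 0), lintegral_zero]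
      intro r hr
      have : (r * Real.cos θ, r * Real.sin θ) ∉ {p : ℝ × ℝ | 0 < p.2} :=
        not_lt.2 (mul_nonpos_of_nonneg_of_nonpos (le_of_lt hr) hle)
      simp [indicator_of_notMem this]
    · rw [indicator_of_notMem h1]

/-- Integration over `ℝ³` in spherical coordinates. -/
theorem lintegral_eq_lintegral_spherical (b : OrthonormalBasis (Fin 3) ℝ E) {H : E → ℝ≥0∞}
    (hH : Measurable H) :
    ∫⁻ x, H x = ∫⁻ ε in Ioo (-Real.pi) Real.pi, ∫⁻ θ in Ioo 0 Real.pi, ∫⁻ r in Ioi (0 : ℝ),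
      ENNReal.ofReal (r ^ 2) * (ENNReal.ofReal (Real.sin θ) * H (r • sphPoint b θ ε)) := by
  rw [lintegral_eq_lintegral_coords b hH]
  have e1 : ∀ t : ℝ, ∫⁻ p : ℝ × ℝ, H (t • b 0 + (p.1 • b 1 + p.2 • b 2)) =
      ∫⁻ ε in Ioo (-Real.pi) Real.pi, ∫⁻ ρ in Ioi (0 : ℝ), ENNReal.ofReal ρ *
        H (t • b 0 + ((ρ * Real.cos ε) • b 1 + (ρ * Real.sin ε) • b 2)) := by
    intro t
    exact lintegral_polarCoord (H := fun p => H (t • b 0 + (p.1 • b 1 + p.2 • b 2)))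
      (hH.comp (by fun_prop))
  simp_rw [e1]
  rw [lintegral_lintegral_swap]
  · refine lintegral_congr fun ε => ?_
    rw [lintegral_halfPlane (H := fun p => ENNReal.ofReal p.2 *
        H (p.1 • b 0 + ((p.2 * Real.cos ε) • b 1 + (p.2 * Real.sin ε) • b 2)))]
    · refine setLIntegral_congr_fun measurableSet_Ioo fun θ hθ => ?_
      refine setLIntegral_congr_fun measurableSet_Ioi fun r hr => ?_
      have hr' : 0 ≤ r := le_of_lt hr
      beta_reduce
      rw [← mul_assoc, ← mul_assoc, ← ENNReal.ofReal_mul hr', ← ENNReal.ofReal_mul (by positivity)]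
      congr 2
      · ring
      · simp only [sphPoint, smul_add, smul_smul, mul_assoc]
    · exact Measurable.mul (by fun_prop) (hH.comp (by fun_prop))
  · apply Measurable.aemeasurable
    have : Measurable fun z : (ℝ × ℝ) × ℝ => ENNReal.ofReal z.2 *
        H (z.1.1 • b 0 + ((z.2 * Real.cos z.1.2) • b 1 + (z.2 * Real.sin z.1.2) • b 2)) :=
      Measurable.mul (by fun_prop) (hH.comp (by fun_prop))
    exact this.lintegral_prod_right'

/-- The surface measure of the unit sphere in spherical coordinates. -/
theorem lintegral_sphere (b : OrthonormalBasis (Fin 3) ℝ E) {Ψ : E → ℝ≥0∞} (hΨ : Measurable Ψ) :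
    ∫⁻ ω : S2, Ψ ω ∂((volume : Measure E).toSphere) =
      ∫⁻ ε in Ioo (-Real.pi) Real.pi, ∫⁻ θ in Ioo 0 Real.pi,
        ENNReal.ofReal (Real.sin θ) * Ψ (sphPoint b θ ε) := by
  -- Compare polar and spherical coordinates for a function homogeneous of degree zero,
  -- cut off to the unit ball.
  set H : E → ℝ≥0∞ := fun x => (Iio (1 : ℝ)).indicator 1 ‖x‖ * Ψ (‖x‖⁻¹ • x) with hHdef
  have hH : Measurable H :=
    ((measurable_one.indicator measurableSet_Iio).comp measurable_norm).mul
      (hΨ.comp (by fun_prop))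
  set c : ℝ≥0∞ := ∫⁻ r in Ioi (0 : ℝ), ENNReal.ofReal (r ^ 2) * (Iio (1 : ℝ)).indicator 1 r with hc
  have hval : ∀ (r : ℝ) (y : E), 0 < r → ‖y‖ = 1 →
      H (r • y) = (Iio (1 : ℝ)).indicator 1 r * Ψ y := by
    intro r y hr hy
    simp only [hHdef, norm_smul, hy, Real.norm_eq_abs, abs_of_pos hr, mul_one, smul_smul,
      inv_mul_cancel₀ hr.ne', one_smul]
  have hm2 : Measurable fun r : ℝ =>
      ENNReal.ofReal (r ^ 2) * (Iio (1 : ℝ)).indicator (1 : ℝ → ℝ≥0∞) r :=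
    Measurable.mul (by fun_prop) (measurable_one.indicator measurableSet_Iio)
  have hΨ' : Measurable fun ω : S2 => Ψ ω := hΨ.comp measurable_subtype_coe
  have h1 : ∫⁻ x, H x = (∫⁻ ω : S2, Ψ ω ∂((volume : Measure E).toSphere)) * c := by
    rw [lintegral_eq_lintegral_polar hH, ← lintegral_mul_const _ hΨ']
    refine lintegral_congr fun ω => ?_
    rw [mul_comm, ← lintegral_mul_const _ hm2]
    refine setLIntegral_congr_fun measurableSet_Ioi fun r hr => ?_
    rw [hval r ω hr (by simp), mul_assoc]
  have h2 : ∫⁻ x, H x = (∫⁻ ε in Ioo (-Real.pi) Real.pi, ∫⁻ θ in Ioo 0 Real.pi,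
        ENNReal.ofReal (Real.sin θ) * Ψ (sphPoint b θ ε)) * c := by
    rw [lintegral_eq_lintegral_spherical b hH,
      ← lintegral_lintegral_mul_const (measurable_sin_mul_comp_sphPoint b hΨ)]
    refine lintegral_congr fun ε => ?_
    refine lintegral_congr fun θ => ?_
    rw [mul_comm, ← lintegral_mul_const _ hm2]
    refine setLIntegral_congr_fun measurableSet_Ioi fun r hr => ?_
    rw [hval r _ hr (norm_sphPoint b θ ε)]
    ring
  have hc0 : c ≠ 0 := by
    rw [hc, ← lintegral_indicator measurableSet_Ioi]
    intro h0
    rw [lintegral_eq_zero_iff (hm2.indicator measurableSet_Ioi)] at h0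
    have : volume (Ioo (0 : ℝ) 1) = 0 := by
      refine measure_mono_null ?_ h0
      intro r hr
      have : r ≠ 0 := hr.1.ne'
      simp [indicator, hr.1, hr.2, this]
    simp at this
  have hct : c ≠ ⊤ := by
    refine ne_top_of_le_ne_top (b := ∫⁻ r in Ioo (0 : ℝ) 1, 1) (by simp) ?_
    rw [hc, ← lintegral_indicator measurableSet_Ioi, ← lintegral_indicator measurableSet_Ioo]
    refine lintegral_mono fun r => ?_
    by_cases h0 : 0 < r <;> by_cases h1 : r < 1 <;> simp [indicator, h0, h1]
    exact abs_le.2 ⟨by linarith, h1.le⟩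
  exact (ENNReal.mul_left_inj hc0 hct).1 (h1.symm.trans h2)

/-- Every nonzero vector is a positive multiple of the first vector of an orthonormal basis. -/
theorem exists_orthonormalBasis_eq_smul (v : E) (hv : v ≠ 0) :
    ∃ b : OrthonormalBasis (Fin 3) ℝ E, v = ‖v‖ • b 0 := by
  have hn : ‖v‖ ≠ 0 := norm_ne_zero_iff.2 hv
  have ho : Orthonormal ℝ (({0} : Set (Fin 3)).domRestrict fun _ => ‖v‖⁻¹ • v) := by
    refine ⟨fun i => ?_, fun i j hij => (hij (Subsingleton.elim i j)).elim⟩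
    change ‖‖v‖⁻¹ • v‖ = 1
    rw [norm_smul, norm_inv, norm_norm, inv_mul_cancel₀ hn]
  obtain ⟨b, hb⟩ := ho.exists_orthonormalBasis_extension_of_card_eq (by simp)
  refine ⟨b, ?_⟩
  rw [hb 0 rfl, smul_smul, mul_inv_cancel₀ hn, one_smul]

theorem inner_coords_zero (b : OrthonormalBasis (Fin 3) ℝ E) (t p q : ℝ) :
    ⟪b 0, t • b 0 + (p • b 1 + q • b 2)⟫_ℝ = t := by
  have h := b.orthonormal
  rw [orthonormal_iff_ite] at h
  simp only [inner_add_right, inner_smul_right, h]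
  simp

theorem inner_sphPoint (b : OrthonormalBasis (Fin 3) ℝ E) (c θ ε : ℝ) :
    ⟪c • b 0, sphPoint b θ ε⟫_ℝ = c * Real.cos θ := by
  rw [real_inner_smul_left, sphPoint, inner_coords_zero]

theorem lintegral_gaussian_sq : ∫⁻ u : ℝ, ENNReal.ofReal (Real.exp (-u ^ 2)) =
    ENNReal.ofReal (Real.sqrt Real.pi) := by
  have h := integral_gaussian 1
  have hi := integrable_exp_neg_mul_sq (b := 1) one_pos
  simp only [div_one, neg_mul, one_mul] at h hi
  rw [← h, ofReal_integral_eq_lintegral_ofReal hi (ae_of_all _ fun x => (Real.exp_pos _).le)]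

/-- The integral over the polar angle of a Gaussian in `l cos θ + a`: substitute the argument of
the Gaussian. -/
theorem mul_lintegral_sin_mul_gaussian_le (l a : ℝ) (hl : 0 < l) :
    ENNReal.ofReal l * ∫⁻ θ in Ioo 0 Real.pi, ENNReal.ofReal (Real.sin θ) *
      ENNReal.ofReal (Real.exp (-(l * Real.cos θ + a) ^ 2)) ≤
      ENNReal.ofReal (Real.sqrt Real.pi) := by
  have hinj : InjOn (fun θ => l * Real.cos θ + a) (Ioo 0 Real.pi) := by
    intro x hx y hy hxy
    refine Real.injOn_cos (Ioo_subset_Icc_self hx) (Ioo_subset_Icc_self hy) ?_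
    have : l * Real.cos x + a = l * Real.cos y + a := hxy
    exact mul_left_cancel₀ hl.ne' (add_right_cancel this)
  have hd : ∀ θ ∈ Ioo 0 Real.pi, HasDerivWithinAt (fun θ => l * Real.cos θ + a)
      (l * -Real.sin θ) (Ioo 0 Real.pi) θ := fun θ _ =>
    (((Real.hasDerivAt_cos θ).const_mul l).add_const a).hasDerivWithinAt
  have h := lintegral_image_eq_lintegral_abs_deriv_mul measurableSet_Ioo hd hinj
    (fun u => ENNReal.ofReal (Real.exp (-u ^ 2)))
  rw [← lintegral_const_mul _ (by fun_prop), ← lintegral_gaussian_sq]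
  refine le_trans (le_of_eq ?_) (setLIntegral_le_lintegral ((fun θ => l * Real.cos θ + a) ''
    Ioo 0 Real.pi) _)
  rw [h]
  refine setLIntegral_congr_fun measurableSet_Ioo fun θ hθ => ?_
  have hs := Real.sin_pos_of_mem_Ioo hθ
  rw [← mul_assoc, ← ENNReal.ofReal_mul hl.le, abs_mul, abs_neg, abs_of_pos hl, abs_of_pos hs]

/-- Averaged over the sphere, a Gaussian in `⟪ζ, ω⟫ + a` decays like the inverse of `1 + ‖ζ‖`,
uniformly in `a`. -/
theorem exists_lintegral_sphere_gaussian_le : ∃ C : ℝ, 0 < C ∧ ∀ (ζ : E) (a : ℝ),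
    ∫⁻ ω : S2, ENNReal.ofReal (Real.exp (-(⟪ζ, (ω : E)⟫_ℝ + a) ^ 2))
      ∂((volume : Measure E).toSphere) ≤ ENNReal.ofReal (C * (1 + ‖ζ‖)⁻¹) := by
  set A : ℝ := ((volume : Measure E).toSphere univ).toReal with hA
  have hA0 : 0 ≤ A := ENNReal.toReal_nonneg
  set B : ℝ := 2 * Real.pi * Real.sqrt Real.pi with hB
  have hB0 : 0 < B := by positivity
  refine ⟨2 * (A + B), by positivity, fun ζ a => ?_⟩
  rcases le_or_gt ‖ζ‖ 1 with h1 | h1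
  · calc _ ≤ ∫⁻ ω : S2, 1 ∂((volume : Measure E).toSphere) := by
          refine lintegral_mono fun ω => ?_
          rw [← ENNReal.ofReal_one]
          exact ENNReal.ofReal_le_ofReal (Real.exp_le_one_iff.2 (neg_nonpos.2 (sq_nonneg _)))
      _ = ENNReal.ofReal A := by
          rw [lintegral_one, hA, ENNReal.ofReal_toReal (measure_ne_top _ _)]
      _ ≤ _ := by
          refine ENNReal.ofReal_le_ofReal ?_
          rw [← div_eq_mul_inv, le_div_iff₀ (by positivity)]
          nlinarith [norm_nonneg ζ]
  · have hz : ζ ≠ 0 := norm_pos_iff.1 (by linarith)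
    obtain ⟨b, hb⟩ := exists_orthonormalBasis_eq_smul ζ hz
    set l := ‖ζ‖ with hl
    have hl0 : 0 < l := by linarith
    rw [lintegral_sphere b (Ψ := fun y => ENNReal.ofReal (Real.exp (-(⟪ζ, y⟫_ℝ + a) ^ 2)))
      (by fun_prop)]
    have key : ∀ ε : ℝ, ∫⁻ θ in Ioo 0 Real.pi, ENNReal.ofReal (Real.sin θ) *
        ENNReal.ofReal (Real.exp (-(⟪ζ, sphPoint b θ ε⟫_ℝ + a) ^ 2)) ≤
        ENNReal.ofReal (Real.sqrt Real.pi / l) := by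
      intro ε
      rw [ENNReal.ofReal_div_of_pos hl0, ENNReal.le_div_iff_mul_le
        (Or.inl (by simpa using hl0)) (Or.inl ENNReal.ofReal_ne_top), mul_comm]
      rw [hb]
      simp only [inner_sphPoint]
      exact mul_lintegral_sin_mul_gaussian_le l a hl0
    calc _ ≤ ∫⁻ ε in Ioo (-Real.pi) Real.pi, ENNReal.ofReal (Real.sqrt Real.pi / l) :=
          lintegral_mono fun ε => key ε
      _ = ENNReal.ofReal (B / l) := by
          rw [setLIntegral_const, Real.volume_Ioo, ← ENNReal.ofReal_mul (by positivity), hB]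
          congr 1
          ring
      _ ≤ _ := by
          refine ENNReal.ofReal_le_ofReal ?_
          rw [← div_eq_mul_inv, div_le_div_iff₀ hl0 (by positivity)]
          nlinarith

theorem setLIntegral_Ioc_sub_left (a b : ℝ) (h : ℝ → ℝ≥0∞) :
    ∫⁻ θ in Ioc a b, h (a + b - θ) = ∫⁻ θ in Ioc a b, h θ := by
  have hp := (Measure.measurePreserving_sub_left (volume : Measure ℝ)
    (a + b)).setLIntegral_comp_preimage_emb (MeasurableEquiv.subLeft (a + b)).measurableEmbedding
    h (Ioo a b)
  have hpre : (fun x : ℝ => a + b - x) ⁻¹' Ioo a b = Ioo a b := by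
    ext x; simp only [mem_preimage, mem_Ioo]; constructor <;> rintro ⟨h1, h2⟩ <;>
      constructor <;> linarith
  rw [hpre] at hp
  rwa [Measure.restrict_congr_set Ioo_ae_eq_Ioc] at hp

/-- Exchange of the two orthogonal components of a fixed vector `V`. In spherical coordinates with
axis `V` the weight `|cos θ| sin θ` is invariant under the reflection of the polar angle in `π / 4`,
which exchanges the component `⟪V, ω⟫ ω` with the component orthogonal to `ω`. -/
theorem lintegral_sphere_swap (V : E) {Ψ : E × E → ℝ≥0∞} (hΨ : Measurable Ψ) :
    ∫⁻ ω : S2, ENNReal.ofReal |⟪V, (ω : E)⟫_ℝ| *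
        Ψ (⟪V, (ω : E)⟫_ℝ • (ω : E), V - ⟪V, (ω : E)⟫_ℝ • (ω : E))
        ∂((volume : Measure E).toSphere) =
      ∫⁻ ω : S2, ENNReal.ofReal |⟪V, (ω : E)⟫_ℝ| *
        Ψ (V - ⟪V, (ω : E)⟫_ℝ • (ω : E), ⟪V, (ω : E)⟫_ℝ • (ω : E))
        ∂((volume : Measure E).toSphere) := by
  rcases eq_or_ne V 0 with rfl | hV
  · simp
  obtain ⟨b, hb⟩ := exists_orthonormalBasis_eq_smul V hV
  set L := ‖V‖ with hL
  -- the basis `(b₀, -b₁, -b₂)` compensates for the shift of the azimuth by `π`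
  have ho : Orthonormal ℝ ![b 0, -b 1, -b 2] := by
    have h := b.orthonormal
    rw [orthonormal_iff_ite] at h ⊢
    intro i j
    fin_cases i <;> fin_cases j <;> simp [h]
  obtain ⟨b', hb'⟩ := (Orthonormal.exists_orthonormalBasis_extension_of_card_eq
    (ι := Fin 3) (𝕜 := ℝ) (E := E) (v := ![b 0, -b 1, -b 2]) (s := univ) (by simp)
    (ho.comp _ Subtype.val_injective))
  have hb0 : b' 0 = b 0 := hb' 0 (mem_univ _)
  have hb1 : b' 1 = -b 1 := hb' 1 (mem_univ _)
  have hb2 : b' 2 = -b 2 := hb' 2 (mem_univ _)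
  have hm : Measurable fun y : E => (⟪V, y⟫_ℝ • y, V - ⟪V, y⟫_ℝ • y) := by fun_prop
  have hm' : Measurable fun y : E => (V - ⟪V, y⟫_ℝ • y, ⟪V, y⟫_ℝ • y) := by fun_prop
  have hw : Measurable fun y : E => ENNReal.ofReal |⟪V, y⟫_ℝ| := by fun_prop
  rw [lintegral_sphere b (Ψ := fun y => ENNReal.ofReal |⟪V, y⟫_ℝ| *
      Ψ (⟪V, y⟫_ℝ • y, V - ⟪V, y⟫_ℝ • y)) (hw.mul (hΨ.comp hm)),
    lintegral_sphere b' (Ψ := fun y => ENNReal.ofReal |⟪V, y⟫_ℝ| *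
      Ψ (V - ⟪V, y⟫_ℝ • y, ⟪V, y⟫_ℝ • y)) (hw.mul (hΨ.comp hm'))]
  refine lintegral_congr fun ε => ?_
  have hi : ∀ θ, ⟪V, sphPoint b θ ε⟫_ℝ = L * Real.cos θ := fun θ => by rw [hb, inner_sphPoint]
  have hi' : ∀ θ, ⟪V, sphPoint b' θ ε⟫_ℝ = L * Real.cos θ := fun θ => by
    rw [hb, ← hb0, inner_sphPoint]
  simp only [hi, hi']
  set g : ℝ → ℝ≥0∞ := fun θ => ENNReal.ofReal (Real.sin θ) * (ENNReal.ofReal |L * Real.cos θ| *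
    Ψ ((L * Real.cos θ) • sphPoint b θ ε, V - (L * Real.cos θ) • sphPoint b θ ε)) with hg
  set h : ℝ → ℝ≥0∞ := fun θ => ENNReal.ofReal (Real.sin θ) * (ENNReal.ofReal |L * Real.cos θ| *
    Ψ (V - (L * Real.cos θ) • sphPoint b' θ ε, (L * Real.cos θ) • sphPoint b' θ ε)) with hh
  have hpi := Real.pi_pos
  -- if `(sin, cos)` are exchanged up to a common sign, the two components are exchanged
  have key : ∀ θ θ' : ℝ, ∀ s : ℝ, s ^ 2 = 1 → Real.sin θ' = s * Real.cos θ →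
      Real.cos θ' = s * Real.sin θ → 0 ≤ Real.sin θ → 0 ≤ Real.sin θ' → h θ' = g θ := by
    intro θ θ' s hs h1 h2 h3 h4
    have hP : (L * Real.cos θ') • sphPoint b' θ' ε = V - (L * Real.cos θ) • sphPoint b θ ε := by
      have hV' : V = (L * (Real.sin θ ^ 2 + Real.cos θ ^ 2)) • b 0 := by
        rw [Real.sin_sq_add_cos_sq, mul_one, ← hb]
      nth_rw 1 [hV']
      simp only [sphPoint, hb0, hb1, hb2, h1, h2]
      have e1 : L * (s * Real.sin θ) * (s * Real.sin θ) = L * Real.sin θ ^ 2 := by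
        linear_combination (L * Real.sin θ ^ 2) * hs
      have e2 : ∀ c : ℝ, L * (s * Real.sin θ) * (s * Real.cos θ * c) =
          L * Real.sin θ * Real.cos θ * c := fun c => by
        linear_combination (L * Real.sin θ * Real.cos θ * c) * hs
      simp only [smul_add, smul_smul, smul_neg, e1, e2]
      module
    have hP' : V - (L * Real.cos θ') • sphPoint b' θ' ε = (L * Real.cos θ) • sphPoint b θ ε := by
      rw [hP]; abel
    simp only [hg, hh]
    rw [hP', hP, ← mul_assoc, ← mul_assoc, ← ENNReal.ofReal_mul h3, ← ENNReal.ofReal_mul h4]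
    congr 2
    rw [abs_mul, abs_mul, h2, abs_mul, abs_of_nonneg h3]
    have hs1 : |s| = 1 := by rw [← sq_eq_sq₀ (abs_nonneg _) zero_le_one, sq_abs, hs, one_pow]
    have : Real.sin θ' = |Real.cos θ| := by
      rw [← abs_of_nonneg h4, h1, abs_mul, hs1, one_mul]
    rw [this, hs1]
    ring
  have hd : Disjoint (Ioc 0 (Real.pi / 2)) (Ioc (Real.pi / 2) Real.pi) :=
    Ioc_disjoint_Ioc_of_le le_rfl
  rw [Measure.restrict_congr_set Ioo_ae_eq_Ioc,
    ← Ioc_union_Ioc_eq_Ioc (b := Real.pi / 2) (by positivity) (by linarith),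
    lintegral_union measurableSet_Ioc hd, lintegral_union measurableSet_Ioc hd,
    ← setLIntegral_Ioc_sub_left 0 _ h, ← setLIntegral_Ioc_sub_left (Real.pi / 2) _ h]
  congr 1
  · refine setLIntegral_congr_fun measurableSet_Ioc fun θ hθ =>
      (key θ _ 1 (by simp) ?_ ?_ ?_ ?_).symm
    · rw [zero_add, Real.sin_pi_div_two_sub, one_mul]
    · rw [zero_add, Real.cos_pi_div_two_sub, one_mul]
    · exact Real.sin_nonneg_of_nonneg_of_le_pi hθ.1.le (by linarith [hθ.2])
    · exact Real.sin_nonneg_of_nonneg_of_le_pi (by linarith [hθ.2]) (by linarith [hθ.1])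
  · have e : ∀ θ : ℝ, Real.pi / 2 + Real.pi - θ = Real.pi / 2 - θ + Real.pi := fun θ => by ring
    refine setLIntegral_congr_fun measurableSet_Ioc fun θ hθ =>
      (key θ _ (-1) (by simp) ?_ ?_ ?_ ?_).symm
    · rw [e, Real.sin_add_pi, Real.sin_pi_div_two_sub, neg_one_mul]
    · rw [e, Real.cos_add_pi, Real.cos_pi_div_two_sub, neg_one_mul]
    · exact Real.sin_nonneg_of_nonneg_of_le_pi (by linarith [hθ.1]) hθ.2
    · exact Real.sin_nonneg_of_nonneg_of_le_pi (by linarith [hθ.2]) (by linarith [hθ.1])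

/-! ### Integral estimates -/

/-- The Cauchy–Schwarz inequality for extended nonnegative functions. -/
theorem lintegral_mul_sq_le {α : Type*} [MeasurableSpace α] (μ : Measure α) {f g : α → ℝ≥0∞}
    (hf : AEMeasurable f μ) (hg : AEMeasurable g μ) :
    (∫⁻ a, f a * g a ∂μ) ^ 2 ≤ (∫⁻ a, f a ^ 2 ∂μ) * ∫⁻ a, g a ^ 2 ∂μ := by
  have h := ENNReal.lintegral_mul_le_Lp_mul_Lq μ Real.HolderConjugate.two_two hf hg
  simp only [Pi.mul_apply, ENNReal.rpow_two] at h
  calc _ ≤ ((∫⁻ a, f a ^ 2 ∂μ) ^ (1 / 2 : ℝ) * (∫⁻ a, g a ^ 2 ∂μ) ^ (1 / 2 : ℝ)) ^ 2 := by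
        gcongr
    _ = _ := by
        rw [mul_pow, ← ENNReal.rpow_two, ← ENNReal.rpow_two, ← ENNReal.rpow_mul,
          ← ENNReal.rpow_mul]
        norm_num

theorem lintegral_gaussian_ne_top (c : ℝ) (hc : 0 < c) :
    ∫⁻ u : ℝ, ENNReal.ofReal (Real.exp (-(c * u ^ 2))) ≠ ⊤ := by
  have hi := integrable_exp_neg_mul_sq hc
  simp only [neg_mul] at hi
  exact hi.lintegral_lt_top.ne

theorem integrable_gaussian_norm (c : ℝ) (hc : 0 < c) :
    Integrable fun x : E => Real.exp (-(c * ‖x‖ ^ 2)) := by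
  have h := GaussianFourier.integrable_cexp_neg_mul_sq_norm_add (V := E) (b := (c : ℂ))
    (by simpa using hc) 0 0
  have h2 := h.re
  refine h2.congr (ae_of_all _ fun x => ?_)
  have : -(c : ℂ) * (‖x‖ : ℂ) ^ 2 + 0 * ((⟪(0 : E), x⟫_ℝ : ℝ) : ℂ) =
      ((-(c * ‖x‖ ^ 2) : ℝ) : ℂ) := by
    push_cast; ring
  simp only [this]
  exact Complex.exp_ofReal_re _

theorem one_add_le_two_mul_exp (r : ℝ) : 1 + r ≤ 2 * Real.exp (r ^ 2 / 8) := by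
  nlinarith [Real.add_one_le_exp (r ^ 2 / 8), sq_nonneg (r / 2 - 1)]

theorem lintegral_one_add_mul_gaussian_ne_top :
    ∫⁻ t : ℝ, ENNReal.ofReal ((1 + |t|) * Real.exp (-(t ^ 2 / 4))) ≠ ⊤ := by
  refine ne_top_of_le_ne_top (b := 2 * ∫⁻ u : ℝ, ENNReal.ofReal (Real.exp (-(1 / 8 * u ^ 2))))
    (ENNReal.mul_ne_top (by simp) (lintegral_gaussian_ne_top _ (by norm_num))) ?_
  rw [← lintegral_const_mul _ (by fun_prop)]
  refine lintegral_mono fun t => ?_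
  rw [show (2 : ℝ≥0∞) = ENNReal.ofReal 2 by simp, ← ENNReal.ofReal_mul (by norm_num)]
  refine ENNReal.ofReal_le_ofReal ?_
  have h := one_add_le_two_mul_exp |t|
  rw [sq_abs] at h
  calc _ ≤ 2 * Real.exp (t ^ 2 / 8) * Real.exp (-(t ^ 2 / 4)) := by gcongr
    _ = _ := by rw [mul_assoc, ← Real.exp_add]; ring_nf

/-- A locally integrable weight on the line. The product of two such weights dominates
`1 + ‖q‖⁻¹` in the plane. -/
def singWeight (q : ℝ) : ℝ≥0∞ := 1 + ENNReal.ofReal |q| ^ (-(1 / 2) : ℝ)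

@[fun_prop]
theorem measurable_singWeight : Measurable singWeight := by
  unfold singWeight; fun_prop

theorem exists_lintegral_singWeight_mul_gaussian_le : ∃ C : ℝ≥0∞, C ≠ ⊤ ∧ ∀ a : ℝ,
    ∫⁻ q : ℝ, singWeight q * ENNReal.ofReal (Real.exp (-((a + q) ^ 2 / 2))) ≤ C := by
  set C1 : ℝ≥0∞ := ∫⁻ u : ℝ, ENNReal.ofReal (Real.exp (-(1 / 2 * u ^ 2)))
  set C2 : ℝ≥0∞ := ∫⁻ q in Icc (-1 : ℝ) 1, singWeight q
  have hC1 : C1 ≠ ⊤ := lintegral_gaussian_ne_top _ (by norm_num)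
  have hC2 : C2 ≠ ⊤ := by
    have h1 : IntegrableOn (fun q : ℝ => |q| ^ (-(1 / 2) : ℝ)) (Icc (-1 : ℝ) 1) := by
      have h := (intervalIntegral.intervalIntegrable_rpow' (a := 0) (b := 1)
        (r := -(1 / 2)) (by norm_num))
      have h2 : IntegrableOn (fun q : ℝ => |q| ^ (-(1 / 2) : ℝ)) (Icc (0 : ℝ) 1) := by
        rw [intervalIntegrable_iff_integrableOn_Icc_of_le zero_le_one] at h
        exact h.congr_fun (fun x hx => by simp [abs_of_nonneg hx.1]) measurableSet_Icc
      have h3 : IntegrableOn (fun q : ℝ => |q| ^ (-(1 / 2) : ℝ)) (Icc (-1 : ℝ) 0) := by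
        have := h2.comp_neg
        simpa using this
      rw [← Icc_union_Icc_eq_Icc (b := (0 : ℝ)) (by norm_num) (by norm_num)]
      exact h3.union h2
    have h2 := (integrableOn_const (μ := volume) (s := Icc (-1 : ℝ) 1) (C := (1 : ℝ))
      (by simp)).add h1
    refine ne_of_lt (lt_of_le_of_lt (le_of_eq ?_) h2.lintegral_lt_top)
    refine lintegral_congr_ae ?_
    have h0 : ∀ᵐ q : ℝ ∂(volume.restrict (Icc (-1 : ℝ) 1)), q ≠ 0 :=
      ae_restrict_of_ae (by simp [ae_iff])
    filter_upwards [h0] with q hq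
    have hq' : 0 < |q| := abs_pos.2 hq
    simp only [singWeight, Pi.add_apply]
    rw [ENNReal.ofReal_add zero_le_one (by positivity), ENNReal.ofReal_one,
      ENNReal.ofReal_rpow_of_pos hq']
  refine ⟨2 * C1 + C2, by finiteness, fun a => ?_⟩
  have htr : ∫⁻ q : ℝ, ENNReal.ofReal (Real.exp (-((a + q) ^ 2 / 2))) = C1 := by
    refine Eq.trans ?_ (lintegral_add_left_eq_self
      (fun u : ℝ => ENNReal.ofReal (Real.exp (-(1 / 2 * u ^ 2)))) a)
    refine lintegral_congr fun q => ?_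
    congr 2; ring
  have h1 : ∫⁻ q : ℝ, (2 * ENNReal.ofReal (Real.exp (-((a + q) ^ 2 / 2))) +
      (Icc (-1 : ℝ) 1).indicator singWeight q) = 2 * C1 + C2 := by
    rw [lintegral_add_left (by fun_prop), lintegral_const_mul _ (by fun_prop), htr,
      lintegral_indicator measurableSet_Icc]
  rw [← h1]
  refine lintegral_mono fun q => ?_
  by_cases hq : q ∈ Icc (-1 : ℝ) 1
  · rw [indicator_of_mem hq]
    refine le_trans ?_ le_add_self
    refine mul_le_of_le_one_right' ?_
    rw [← ENNReal.ofReal_one]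
    exact ENNReal.ofReal_le_ofReal (Real.exp_le_one_iff.2 (by nlinarith [sq_nonneg (a + q)]))
  · rw [indicator_of_notMem hq, add_zero]
    gcongr
    have hq1 : 1 ≤ |q| := by
      by_contra hc
      exact hq (abs_le.1 (not_le.1 hc).le)
    have : ENNReal.ofReal |q| ^ (-(1 / 2) : ℝ) ≤ 1 :=
      ENNReal.rpow_le_one_of_one_le_of_neg (by simpa using hq1) (by norm_num)
    calc singWeight q ≤ 1 + 1 := by unfold singWeight; gcongr
      _ = 2 := by norm_num

theorem one_add_inv_le_singWeight_mul (r q₁ q₂ : ℝ) (hr : 0 ≤ r) (h : q₁ ^ 2 + q₂ ^ 2 ≤ r ^ 2) :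
    ENNReal.ofReal (1 + r⁻¹) ≤ singWeight q₁ * singWeight q₂ := by
  have hone : ∀ q, 1 ≤ singWeight q := fun q => le_self_add
  rcases eq_or_ne q₁ 0 with rfl | h1
  · have : singWeight 0 = ⊤ := by
      simp [singWeight, ENNReal.zero_rpow_of_neg]
    rw [this, ENNReal.top_mul (by have := hone q₂; positivity)]
    exact le_top
  rcases eq_or_ne q₂ 0 with rfl | h2
  · have : singWeight 0 = ⊤ := by
      simp [singWeight, ENNReal.zero_rpow_of_neg]
    rw [this, ENNReal.mul_top (by have := hone q₁; positivity)]
    exact le_top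
  have p1 : 0 < |q₁| := abs_pos.2 h1
  have p2 : 0 < |q₂| := abs_pos.2 h2
  have e : ∀ q : ℝ, 0 < |q| → singWeight q = ENNReal.ofReal (1 + |q| ^ (-(1 / 2) : ℝ)) := by
    intro q hq
    rw [singWeight, ENNReal.ofReal_add zero_le_one (by positivity), ENNReal.ofReal_one,
      ENNReal.ofReal_rpow_of_pos hq]
  rw [e _ p1, e _ p2, ← ENNReal.ofReal_mul (by positivity)]
  refine ENNReal.ofReal_le_ofReal ?_
  have hle : (|q₁| * |q₂|) ≤ r ^ 2 := by
    nlinarith [sq_abs q₁, sq_abs q₂, sq_nonneg (|q₁| - |q₂|), mul_pos p1 p2]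
  have hr0 : 0 < r := by
    rcases hr.eq_or_lt with h0 | h0
    · rw [← h0] at hle; nlinarith [mul_pos p1 p2]
    · exact h0
  have hinv : r⁻¹ ≤ |q₁| ^ (-(1 / 2) : ℝ) * |q₂| ^ (-(1 / 2) : ℝ) := by
    rw [← Real.mul_rpow p1.le p2.le]
    calc r⁻¹ = (r ^ 2) ^ (-(1 / 2) : ℝ) := by
          rw [← Real.rpow_natCast, ← Real.rpow_mul hr0.le, ← Real.rpow_neg_one]
          norm_num
      _ ≤ _ := Real.rpow_le_rpow_of_nonpos (mul_pos p1 p2) hle (by norm_num)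
  have : 0 ≤ |q₁| ^ (-(1 / 2) : ℝ) := by positivity
  have : 0 ≤ |q₂| ^ (-(1 / 2) : ℝ) := by positivity
  nlinarith

/-! ### The gain and loss parts of the collision operator -/

/-- The unnormalized square root `exp (-|x|² / 2)` of the Maxwellian. -/
def gauss (x : E) : ℝ := Real.exp (-(‖x‖ ^ 2 / 2))

@[fun_prop]
theorem continuous_gauss : Continuous gauss := by unfold gauss; fun_prop

theorem gauss_pos (x : E) : 0 < gauss x := Real.exp_pos _

/-- The bound `|V| ^ γ |cos θ|` for the cross section, up to a constant factor. -/
def crossBound (γ : ℝ) (V : E) (ω : E) : ℝ := ‖V‖ ^ γ * (|⟪V, ω⟫_ℝ| / ‖V‖)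

theorem crossBound_nonneg (γ : ℝ) (V ω : E) : 0 ≤ crossBound γ V ω := by
  unfold crossBound; positivity

/-- The gain part of the collision operator, with the cross section replaced by its bound. -/
def gainBound (γ : ℝ) (G : E → ℝ≥0∞) (ζ : E) : ℝ≥0∞ :=
  ∫⁻ V : E, ∫⁻ ω : S2, ENNReal.ofReal (crossBound γ V ω) *
    (ENNReal.ofReal (gauss (ζ + V) * gauss (ζ + (V - ⟪V, (ω : E)⟫_ℝ • (ω : E)))) *
      G (ζ + ⟪V, (ω : E)⟫_ℝ • (ω : E))) ∂((volume : Measure E).toSphere)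

/-- The loss part of the operator `K`, with the cross section replaced by its bound. -/
def lossBound (γ : ℝ) (G : E → ℝ≥0∞) (ζ : E) : ℝ≥0∞ :=
  ∫⁻ V : E, ∫⁻ ω : S2, ENNReal.ofReal (crossBound γ V ω) *
    (ENNReal.ofReal (gauss ζ * gauss (ζ + V)) * G (ζ + V)) ∂((volume : Measure E).toSphere)

theorem one_add_norm_le_mul (ζ V : E) : 1 + ‖ζ‖ ≤ (1 + ‖V‖) * (1 + ‖ζ + V‖) := by
  have : ‖ζ‖ ≤ ‖ζ + V‖ + ‖V‖ := by
    simpa using norm_sub_le (ζ + V) V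
  nlinarith [norm_nonneg V, norm_nonneg (ζ + V), mul_nonneg (norm_nonneg V) (norm_nonneg (ζ + V))]

/-- The factor `|V| ^ (γ - 1)` gains the decay `(1 + |ζ|) ^ (γ - 1)`, at the cost of a singularity
in `V` and part of the Gaussian. -/
theorem rpow_mul_crossBound_mul_gauss_le (γ : ℝ) (h0 : 0 ≤ γ) (h1 : γ < 1) (ζ V ω : E) :
    (1 + ‖ζ‖) ^ (1 - γ) * (crossBound γ V ω * (gauss (ζ + V) * gauss (ζ + (V - ⟪V, ω⟫_ℝ • ω)))) ≤
      2 * (1 + ‖V‖⁻¹) * |⟪V, ω⟫_ℝ| *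
        Real.exp (-((‖ζ + V‖ ^ 2 + ‖ζ + (V - ⟪V, ω⟫_ℝ • ω)‖ ^ 2) / 4)) := by
  rcases eq_or_ne V 0 with rfl | hV
  · simp [crossBound]
  have hV : 0 < ‖V‖ := norm_pos_iff.2 hV
  have e1 : (1 + ‖ζ‖) ^ (1 - γ) * (‖V‖ ^ γ * ‖V‖⁻¹) ≤ (1 + ‖V‖⁻¹) * (1 + ‖ζ + V‖) := by
    have hx : 1 ≤ (1 + ‖V‖⁻¹) * (1 + ‖ζ + V‖) := by
      have h2 : 0 ≤ ‖V‖⁻¹ := by positivity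
      nlinarith [norm_nonneg (ζ + V), mul_nonneg h2 (norm_nonneg (ζ + V))]
    calc (1 + ‖ζ‖) ^ (1 - γ) * (‖V‖ ^ γ * ‖V‖⁻¹)
        ≤ ((1 + ‖V‖) * (1 + ‖ζ + V‖)) ^ (1 - γ) * (‖V‖ ^ γ * ‖V‖⁻¹) := by
          gcongr
          · exact one_add_norm_le_mul ζ V
      _ = ((1 + ‖V‖⁻¹) * (1 + ‖ζ + V‖)) ^ (1 - γ) := by
          have e : (1 + ‖V‖⁻¹) * (1 + ‖ζ + V‖) = ‖V‖⁻¹ * ((1 + ‖V‖) * (1 + ‖ζ + V‖)) := by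
            field_simp
            ring
          rw [e, Real.mul_rpow (x := ‖V‖⁻¹) (by positivity) (by positivity), Real.inv_rpow hV.le,
            ← Real.rpow_neg hV.le, ← Real.rpow_neg_one ‖V‖, ← Real.rpow_add hV, mul_comm]
          congr 2
          ring
      _ ≤ ((1 + ‖V‖⁻¹) * (1 + ‖ζ + V‖)) ^ (1 : ℝ) :=
          Real.rpow_le_rpow_of_exponent_le hx (by linarith)
      _ = _ := Real.rpow_one _
  have e2 : (1 + ‖ζ + V‖) * gauss (ζ + V) ≤ 2 * Real.exp (-(‖ζ + V‖ ^ 2 / 4)) := by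
    calc _ ≤ 2 * Real.exp (‖ζ + V‖ ^ 2 / 8) * gauss (ζ + V) := by
          have := one_add_le_two_mul_exp ‖ζ + V‖
          have := (gauss_pos (ζ + V)).le
          gcongr
      _ = 2 * Real.exp (‖ζ + V‖ ^ 2 / 8 + -(‖ζ + V‖ ^ 2 / 2)) := by
          rw [gauss, mul_assoc, ← Real.exp_add]
      _ ≤ _ := by
          gcongr
          nlinarith [sq_nonneg ‖ζ + V‖]
  set W := ζ + (V - ⟪V, ω⟫_ℝ • ω)
  have e3 : gauss W ≤ Real.exp (-(‖W‖ ^ 2 / 4)) := by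
    unfold gauss
    gcongr
    nlinarith [sq_nonneg ‖W‖]
  calc _ = ((1 + ‖ζ‖) ^ (1 - γ) * (‖V‖ ^ γ * ‖V‖⁻¹)) * |⟪V, ω⟫_ℝ| *
        (gauss (ζ + V) * gauss W) := by unfold crossBound; ring
    _ ≤ ((1 + ‖V‖⁻¹) * (1 + ‖ζ + V‖)) * |⟪V, ω⟫_ℝ| *
        (gauss (ζ + V) * gauss W) := by
        have := gauss_pos (ζ + V); have := gauss_pos W
        gcongr
    _ = (1 + ‖V‖⁻¹) * |⟪V, ω⟫_ℝ| * (((1 + ‖ζ + V‖) * gauss (ζ + V)) * gauss W) := by ring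
    _ ≤ (1 + ‖V‖⁻¹) * |⟪V, ω⟫_ℝ| * ((2 * Real.exp (-(‖ζ + V‖ ^ 2 / 4))) *
        Real.exp (-(‖W‖ ^ 2 / 4))) := by
        have := gauss_pos W
        gcongr
    _ = _ := by
        have : Real.exp (-((‖ζ + V‖ ^ 2 + ‖W‖ ^ 2) / 4)) =
            Real.exp (-(‖ζ + V‖ ^ 2 / 4)) * Real.exp (-(‖W‖ ^ 2 / 4)) := by
          rw [← Real.exp_add]; ring_nf
        rw [this]; ring

/-- The Gaussian that remains of the gain kernel, after integration over the plane orthogonal to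
`ω`, as a function of `a = ⟪ζ, ω⟫` and of the displacement `t` in the direction `ω`. -/
def gainExp (a t : ℝ) : ℝ := Real.exp (-(((a + t) ^ 2 + a ^ 2) / 4))

/-- For a fixed direction `ω`, integrate out the components of `V` orthogonal to `ω`. -/
theorem exists_lintegral_gain_direction_le : ∃ C : ℝ≥0∞, C ≠ ⊤ ∧ ∀ γ : ℝ, 0 ≤ γ → γ < 1 →
    ∀ (G : E → ℝ≥0∞), Measurable G → ∀ (ζ : E) (ω : S2),
    ENNReal.ofReal ((1 + ‖ζ‖) ^ (1 - γ)) * ∫⁻ V : E, ENNReal.ofReal (crossBound γ V ω) *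
      (ENNReal.ofReal (gauss (ζ + V) * gauss (ζ + (V - ⟪V, (ω : E)⟫_ℝ • (ω : E)))) *
      G (ζ + ⟪V, (ω : E)⟫_ℝ • (ω : E))) ≤
    C * ∫⁻ t : ℝ, ENNReal.ofReal (|t| * gainExp ⟪ζ, (ω : E)⟫_ℝ t) * G (ζ + t • (ω : E)) := by
  obtain ⟨C, hC, hCle⟩ := exists_lintegral_singWeight_mul_gaussian_le
  refine ⟨2 * (C * C), by finiteness, fun γ h0 h1 G hG ζ ω => ?_⟩
  have hω : ‖(ω : E)‖ = 1 := by simp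
  obtain ⟨b, hb⟩ := exists_orthonormalBasis_eq_smul (ω : E) (by
    intro h; rw [h] at hω; simp at hω)
  rw [hω, one_smul] at hb
  have hmeas : Measurable fun V : E => ENNReal.ofReal (crossBound γ V ω) *
      (ENNReal.ofReal (gauss (ζ + V) * gauss (ζ + (V - ⟪V, (ω : E)⟫_ℝ • (ω : E)))) *
      G (ζ + ⟪V, (ω : E)⟫_ℝ • (ω : E))) := by
    have h2 : Measurable fun V : E => crossBound γ V ω := by unfold crossBound; fun_prop
    have h3 : Measurable fun V : E => G (ζ + ⟪V, (ω : E)⟫_ℝ • (ω : E)) := hG.comp (by fun_prop)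
    fun_prop
  rw [← lintegral_const_mul _ hmeas, lintegral_eq_lintegral_coords b (hmeas.const_mul _),
    ← lintegral_const_mul' _ _ (by finiteness)]
  refine lintegral_mono fun t => ?_
  obtain ⟨a₀, a₁, a₂, hζ⟩ : ∃ a₀ a₁ a₂ : ℝ, ζ = a₀ • b 0 + (a₁ • b 1 + a₂ • b 2) := by
    refine ⟨b.repr ζ 0, b.repr ζ 1, b.repr ζ 2, (b.sum_repr ζ).symm.trans ?_⟩
    rw [Fin.sum_univ_three, add_assoc]
  have ha₀ : ⟪ζ, (ω : E)⟫_ℝ = a₀ := by rw [hb, hζ, real_inner_comm, inner_coords_zero]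
  have hexp : ∀ q₁ q₂ : ℝ, Real.exp (-((‖ζ + (t • b 0 + (q₁ • b 1 + q₂ • b 2))‖ ^ 2 +
      ‖ζ + (t • b 0 + (q₁ • b 1 + q₂ • b 2) - t • (ω : E))‖ ^ 2) / 4)) =
      gainExp a₀ t * (Real.exp (-((a₁ + q₁) ^ 2 / 2)) * Real.exp (-((a₂ + q₂) ^ 2 / 2))) := by
    intro q₁ q₂
    have f1 : ζ + (t • b 0 + (q₁ • b 1 + q₂ • b 2)) =
        (a₀ + t) • b 0 + ((a₁ + q₁) • b 1 + (a₂ + q₂) • b 2) := by rw [hζ]; module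
    have f2 : ζ + (t • b 0 + (q₁ • b 1 + q₂ • b 2) - t • (ω : E)) =
        a₀ • b 0 + ((a₁ + q₁) • b 1 + (a₂ + q₂) • b 2) := by rw [hζ, hb]; module
    rw [f1, f2, norm_coords, norm_coords, gainExp, ← Real.exp_add, ← Real.exp_add]
    congr 1
    ring
  set w : ℝ → ℝ → ℝ≥0∞ := fun a q => singWeight q * ENNReal.ofReal (Real.exp (-((a + q) ^ 2 / 2)))
    with hw
  have hwm : ∀ a, Measurable (w a) := fun a => by simp only [hw]; fun_prop
  set c : ℝ≥0∞ := 2 * (ENNReal.ofReal (|t| * gainExp a₀ t) * G (ζ + t • (ω : E))) with hc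
  calc _ ≤ ∫⁻ p : ℝ × ℝ, c * (w a₁ p.1 * w a₂ p.2) := by
        refine lintegral_mono fun p => ?_
        have hin : ⟪t • b 0 + (p.1 • b 1 + p.2 • b 2), (ω : E)⟫_ℝ = t := by
          rw [hb, real_inner_comm, inner_coords_zero]
        have hle := rpow_mul_crossBound_mul_gauss_le γ h0 h1 ζ
          (t • b 0 + (p.1 • b 1 + p.2 • b 2)) ω
        rw [hin] at hle
        have hx := hexp p.1 p.2
        simp only [hin]
        set V := t • b 0 + (p.1 • b 1 + p.2 • b 2) with hVdef
        have hVn : ‖V‖ ^ 2 = t ^ 2 + p.1 ^ 2 + p.2 ^ 2 := norm_coords b t p.1 p.2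
        have hs := one_add_inv_le_singWeight_mul ‖V‖ p.1 p.2 (norm_nonneg _)
          (by rw [hVn]; nlinarith [sq_nonneg t])
        have hcb := crossBound_nonneg γ V ω
        rw [← mul_assoc, ← mul_assoc, ← ENNReal.ofReal_mul (by positivity),
          ← ENNReal.ofReal_mul (by positivity), mul_assoc ((1 + ‖ζ‖) ^ (1 - γ))]
        calc _ ≤ ENNReal.ofReal (2 * (1 + ‖V‖⁻¹) * |t| * Real.exp (-((‖ζ + V‖ ^ 2 +
              ‖ζ + (V - t • (ω : E))‖ ^ 2) / 4))) * G (ζ + t • (ω : E)) := by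
              gcongr
          _ = ENNReal.ofReal 2 * ENNReal.ofReal (1 + ‖V‖⁻¹) * ENNReal.ofReal (|t| * gainExp a₀ t) *
              ENNReal.ofReal (Real.exp (-((a₁ + p.1) ^ 2 / 2))) *
              ENNReal.ofReal (Real.exp (-((a₂ + p.2) ^ 2 / 2))) * G (ζ + t • (ω : E)) := by
              have hg : 0 ≤ gainExp a₀ t := (Real.exp_pos _).le
              rw [hx, ← ENNReal.ofReal_mul (by norm_num),
                ← ENNReal.ofReal_mul (by positivity), ← ENNReal.ofReal_mul (by positivity),
                ← ENNReal.ofReal_mul (by positivity)]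
              congr 2
              ring
          _ ≤ ENNReal.ofReal 2 * (singWeight p.1 * singWeight p.2) *
              ENNReal.ofReal (|t| * gainExp a₀ t) *
              ENNReal.ofReal (Real.exp (-((a₁ + p.1) ^ 2 / 2))) *
              ENNReal.ofReal (Real.exp (-((a₂ + p.2) ^ 2 / 2))) * G (ζ + t • (ω : E)) := by
              gcongr
          _ = _ := by
              simp only [hw, hc, ENNReal.ofReal_ofNat]
              ring
    _ = c * ((∫⁻ q, w a₁ q) * ∫⁻ q, w a₂ q) := by
        rw [lintegral_const_mul _ (by fun_prop), Measure.volume_eq_prod,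
          lintegral_prod_mul (hwm _).aemeasurable (hwm _).aemeasurable]
    _ ≤ c * (C * C) := by
        gcongr
        exacts [hCle a₁, hCle a₂]
    _ = _ := by
        rw [hc, ha₀]
        ring

/-- Polar coordinates in which every line through the origin is parametrized by the whole real
axis; each line then occurs twice. -/
theorem lintegral_sphere_line {H : E → ℝ≥0∞} (hH : Measurable H) :
    ∫⁻ ω : S2, (∫⁻ t : ℝ, ENNReal.ofReal (t ^ 2) * H (t • (ω : E)))
      ∂((volume : Measure E).toSphere) = 2 * ∫⁻ x, H x := by
  have hH' : Measurable fun x => H (-x) := hH.comp measurable_neg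
  have hsplit : ∀ ω : S2, ∫⁻ t : ℝ, ENNReal.ofReal (t ^ 2) * H (t • (ω : E)) =
      (∫⁻ t in Ioi (0 : ℝ), ENNReal.ofReal (t ^ 2) * H (t • (ω : E))) +
        ∫⁻ t in Ioi (0 : ℝ), ENNReal.ofReal (t ^ 2) * H (-(t • (ω : E))) := by
    intro ω
    rw [← lintegral_add_compl _ (measurableSet_Ioi (a := (0 : ℝ))), compl_Ioi]
    congr 1
    have hp := (Measure.measurePreserving_neg (volume : Measure ℝ)).setLIntegral_comp_preimage_emb
      (MeasurableEquiv.neg ℝ).measurableEmbedding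
      (fun t => ENNReal.ofReal (t ^ 2) * H (t • (ω : E))) (Iio 0)
    rw [Measure.restrict_congr_set (Iio_ae_eq_Iic (a := (0 : ℝ))).symm, ← hp]
    simp
  simp_rw [hsplit]
  rw [lintegral_add_left]
  · rw [← lintegral_eq_lintegral_polar hH, ← lintegral_eq_lintegral_polar hH', two_mul,
      lintegral_neg_eq_self]
  · have h : Measurable fun z : S2 × ℝ => ENNReal.ofReal (z.2 ^ 2) * H (z.2 • (z.1 : E)) := by
      have : Measurable fun z : S2 × ℝ => H (z.2 • (z.1 : E)) := hH.comp (by fun_prop)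
      fun_prop
    exact h.lintegral_prod_right'

theorem one_add_norm_rpow_neg_le (γ : ℝ) (h0 : 0 ≤ γ) (h1 : γ < 1) (ζ V : E) :
    (1 + ‖ζ + V‖) ^ (-γ) ≤ (1 + ‖ζ‖) ^ (-γ) * (1 + ‖V‖) := by
  rw [Real.rpow_neg (by positivity), Real.rpow_neg (by positivity), inv_mul_eq_div,
    inv_le_iff_one_le_mul₀ (by positivity), div_mul_eq_mul_div, one_le_div (by positivity)]
  calc (1 + ‖ζ‖) ^ γ ≤ ((1 + ‖V‖) * (1 + ‖ζ + V‖)) ^ γ := by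
        gcongr
        exact one_add_norm_le_mul ζ V
    _ = (1 + ‖V‖) ^ γ * (1 + ‖ζ + V‖) ^ γ := Real.mul_rpow (by positivity) (by positivity)
    _ ≤ (1 + ‖V‖) ^ (1 : ℝ) * (1 + ‖ζ + V‖) ^ γ := by
        gcongr
        linarith [norm_nonneg V]
    _ = _ := by rw [Real.rpow_one]

theorem gainExp_sq (a t : ℝ) :
    gainExp a t ^ 2 = Real.exp (-(t ^ 2 / 4)) * Real.exp (-(a + t / 2) ^ 2) := by
  rw [gainExp, sq, ← Real.exp_add, ← Real.exp_add]
  congr 1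
  ring

/-- The square integral of the gain kernel: the average over directions gains a factor
`(1 + |ζ|)⁻¹`. -/
theorem exists_lintegral_gainExp_sq_le (γ : ℝ) (h0 : 0 ≤ γ) (h1 : γ < 1) :
    ∃ C : ℝ≥0∞, C ≠ ⊤ ∧ ∀ ζ : E,
    ∫⁻ ω : S2, (∫⁻ t : ℝ, ENNReal.ofReal (gainExp ⟪ζ, (ω : E)⟫_ℝ t ^ 2 *
      (1 + ‖ζ + t • (ω : E)‖) ^ (-γ))) ∂((volume : Measure E).toSphere) ≤
      C * ENNReal.ofReal ((1 + ‖ζ‖) ^ (-γ - 1)) := by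
  obtain ⟨C₀, hC₀, hle⟩ := exists_lintegral_sphere_gaussian_le
  set C₁ : ℝ≥0∞ := ∫⁻ t : ℝ, ENNReal.ofReal ((1 + |t|) * Real.exp (-(t ^ 2 / 4))) with hC₁
  have hC₁t : C₁ ≠ ⊤ := lintegral_one_add_mul_gaussian_ne_top
  refine ⟨C₁ * ENNReal.ofReal C₀, by finiteness, fun ζ => ?_⟩
  have hmeas : Measurable fun z : S2 × ℝ =>
      ENNReal.ofReal ((1 + |z.2|) * Real.exp (-(z.2 ^ 2 / 4))) *
        ENNReal.ofReal (Real.exp (-(⟪ζ, (z.1 : E)⟫_ℝ + z.2 / 2) ^ 2)) := by fun_prop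
  calc _ ≤ ∫⁻ ω : S2, (∫⁻ t : ℝ, ENNReal.ofReal ((1 + ‖ζ‖) ^ (-γ)) *
        (ENNReal.ofReal ((1 + |t|) * Real.exp (-(t ^ 2 / 4))) *
          ENNReal.ofReal (Real.exp (-(⟪ζ, (ω : E)⟫_ℝ + t / 2) ^ 2))))
          ∂((volume : Measure E).toSphere) := by
        refine lintegral_mono fun ω => lintegral_mono fun t => ?_
        rw [← ENNReal.ofReal_mul (by positivity), ← ENNReal.ofReal_mul (by positivity)]
        refine ENNReal.ofReal_le_ofReal ?_
        rw [gainExp_sq]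
        have h := one_add_norm_rpow_neg_le γ h0 h1 ζ (t • (ω : E))
        have hn : ‖t • (ω : E)‖ = |t| := by simp [norm_smul]
        rw [hn] at h
        calc _ ≤ Real.exp (-(t ^ 2 / 4)) * Real.exp (-(⟪ζ, (ω : E)⟫_ℝ + t / 2) ^ 2) *
              ((1 + ‖ζ‖) ^ (-γ) * (1 + |t|)) := by gcongr
          _ = _ := by ring
    _ = ENNReal.ofReal ((1 + ‖ζ‖) ^ (-γ)) * ∫⁻ ω : S2, (∫⁻ t : ℝ,
        (ENNReal.ofReal ((1 + |t|) * Real.exp (-(t ^ 2 / 4))) *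
          ENNReal.ofReal (Real.exp (-(⟪ζ, (ω : E)⟫_ℝ + t / 2) ^ 2))))
          ∂((volume : Measure E).toSphere) := by
        rw [← lintegral_const_mul' _ _ (by finiteness)]
        refine lintegral_congr fun ω => ?_
        rw [lintegral_const_mul' _ _ (by finiteness)]
    _ = ENNReal.ofReal ((1 + ‖ζ‖) ^ (-γ)) * ∫⁻ t : ℝ,
        ENNReal.ofReal ((1 + |t|) * Real.exp (-(t ^ 2 / 4))) * (∫⁻ ω : S2,
          ENNReal.ofReal (Real.exp (-(⟪ζ, (ω : E)⟫_ℝ + t / 2) ^ 2))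
          ∂((volume : Measure E).toSphere)) := by
        rw [lintegral_lintegral_swap hmeas.aemeasurable]
        congr 1
        refine lintegral_congr fun t => ?_
        rw [lintegral_const_mul' _ _ (by finiteness)]
    _ ≤ ENNReal.ofReal ((1 + ‖ζ‖) ^ (-γ)) * ∫⁻ t : ℝ,
        ENNReal.ofReal ((1 + |t|) * Real.exp (-(t ^ 2 / 4))) *
          ENNReal.ofReal (C₀ * (1 + ‖ζ‖)⁻¹) := by
        gcongr with t
        exact hle ζ (t / 2)
    _ = _ := by
        rw [lintegral_mul_const _ (by fun_prop), ← hC₁, mul_comm, mul_assoc, mul_assoc,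
          ← ENNReal.ofReal_mul (by positivity), ← ENNReal.ofReal_mul (by positivity),
          Real.rpow_sub_one (by positivity)]
        congr 2
        field_simp

/-- The gain part maps the weighted `L²` space into bounded functions, with decay. -/
theorem exists_gainBound_sq_le (γ : ℝ) (h0 : 0 ≤ γ) (h1 : γ < 1) :
    ∃ C : ℝ≥0∞, C ≠ ⊤ ∧ ∀ (G : E → ℝ≥0∞), Measurable G → ∀ ζ : E,
    gainBound γ G ζ ^ 2 ≤ C * ENNReal.ofReal ((1 + ‖ζ‖) ^ (γ - 3)) *
      ∫⁻ ξ, G ξ ^ 2 * ENNReal.ofReal ((1 + ‖ξ‖) ^ γ) := by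
  obtain ⟨C₁, hC₁, hdir⟩ := exists_lintegral_gain_direction_le
  obtain ⟨C₂, hC₂, hker⟩ := exists_lintegral_gainExp_sq_le γ h0 h1
  refine ⟨C₁ ^ 2 * (C₂ * 2), by finiteness, fun G hG ζ => ?_⟩
  set N : ℝ≥0∞ := ∫⁻ ξ, G ξ ^ 2 * ENNReal.ofReal ((1 + ‖ξ‖) ^ γ) with hN
  set J : ℝ≥0∞ := ENNReal.ofReal ((1 + ‖ζ‖) ^ (1 - γ)) with hJ
  set μ : Measure (S2 × ℝ) := ((volume : Measure E).toSphere).prod volume with hμ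
  have hpos : 0 < 1 + ‖ζ‖ := by positivity
  -- integrate over `V` first
  have hs1 : J * gainBound γ G ζ ≤ C₁ * ∫⁻ ω : S2, (∫⁻ t : ℝ,
      ENNReal.ofReal (|t| * gainExp ⟪ζ, (ω : E)⟫_ℝ t) * G (ζ + t • (ω : E)))
      ∂((volume : Measure E).toSphere) := by
    have hm : Measurable fun z : E × S2 => ENNReal.ofReal (crossBound γ z.1 z.2) *
        (ENNReal.ofReal (gauss (ζ + z.1) *
          gauss (ζ + (z.1 - ⟪z.1, (z.2 : E)⟫_ℝ • (z.2 : E)))) *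
          G (ζ + ⟪z.1, (z.2 : E)⟫_ℝ • (z.2 : E))) := by
      have h2 : Measurable fun z : E × S2 => crossBound γ z.1 z.2 := by unfold crossBound; fun_prop
      have h3 : Measurable fun z : E × S2 => G (ζ + ⟪z.1, (z.2 : E)⟫_ℝ • (z.2 : E)) :=
        hG.comp (by fun_prop)
      have h4 : Measurable fun z : E × S2 => gauss (ζ + z.1) *
          gauss (ζ + (z.1 - ⟪z.1, (z.2 : E)⟫_ℝ • (z.2 : E))) := by
        unfold gauss; fun_prop
      fun_prop
    rw [gainBound, lintegral_lintegral_swap hm.aemeasurable,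
      ← lintegral_const_mul' _ _ (by finiteness), ← lintegral_const_mul' _ _ hC₁]
    exact lintegral_mono fun ω => hdir γ h0 h1 G hG ζ ω
  -- Cauchy–Schwarz in the polar coordinates around `ζ`
  set f : S2 × ℝ → ℝ≥0∞ := fun z => ENNReal.ofReal (gainExp ⟪ζ, (z.1 : E)⟫_ℝ z.2 *
    (1 + ‖ζ + z.2 • (z.1 : E)‖) ^ (-γ / 2)) with hf
  set g : S2 × ℝ → ℝ≥0∞ := fun z => ENNReal.ofReal (|z.2| *
    (1 + ‖ζ + z.2 • (z.1 : E)‖) ^ (γ / 2)) * G (ζ + z.2 • (z.1 : E)) with hg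
  have hfm : Measurable f := by simp only [hf, gainExp]; fun_prop
  have hGm : Measurable fun z : S2 × ℝ => G (ζ + z.2 • (z.1 : E)) := hG.comp (by fun_prop)
  have hgm : Measurable g := by simp only [hg]; fun_prop
  have hfg : ∫⁻ ω : S2, (∫⁻ t : ℝ,
      ENNReal.ofReal (|t| * gainExp ⟪ζ, (ω : E)⟫_ℝ t) * G (ζ + t • (ω : E)))
      ∂((volume : Measure E).toSphere) = ∫⁻ z, f z * g z ∂μ := by
    have hfgm : Measurable fun z => f z * g z := hfm.mul hgm
    rw [hμ, lintegral_prod _ hfgm.aemeasurable]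
    refine lintegral_congr fun ω => lintegral_congr fun t => ?_
    have hp : 0 < 1 + ‖ζ + t • (ω : E)‖ := by positivity
    have he : 0 ≤ gainExp ⟪ζ, (ω : E)⟫_ℝ t := (Real.exp_pos _).le
    simp only [hf, hg]
    rw [← mul_assoc, ← ENNReal.ofReal_mul (by positivity)]
    congr 2
    have : (1 + ‖ζ + t • (ω : E)‖) ^ (-γ / 2) * (1 + ‖ζ + t • (ω : E)‖) ^ (γ / 2) = 1 := by
      rw [← Real.rpow_add hp]
      ring_nf
      exact Real.rpow_zero _
    linear_combination (-(|t| * gainExp ⟪ζ, (ω : E)⟫_ℝ t)) * this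
  have hA : ∫⁻ z, g z ^ 2 ∂μ = 2 * N := by
    have hH : Measurable fun x : E => G (ζ + x) ^ 2 * ENNReal.ofReal ((1 + ‖ζ + x‖) ^ γ) := by
      have : Measurable fun x : E => G (ζ + x) := hG.comp (by fun_prop)
      fun_prop
    rw [hμ, lintegral_prod _ (hgm.pow_const 2).aemeasurable, hN,
      ← lintegral_add_left_eq_self _ ζ, ← lintegral_sphere_line hH]
    refine lintegral_congr fun ω => lintegral_congr fun t => ?_
    have hp : 0 < 1 + ‖ζ + t • (ω : E)‖ := by positivity
    simp only [hg]
    rw [mul_pow, ← ENNReal.ofReal_pow (by positivity), mul_pow, sq_abs,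
      ← Real.rpow_natCast (_ ^ (γ / 2)), ← Real.rpow_mul hp.le, ENNReal.ofReal_mul (sq_nonneg _)]
    push_cast
    rw [div_mul_cancel₀ _ (two_ne_zero)]
    ring
  have hB : ∫⁻ z, f z ^ 2 ∂μ ≤ C₂ * ENNReal.ofReal ((1 + ‖ζ‖) ^ (-γ - 1)) := by
    rw [hμ, lintegral_prod _ (hfm.pow_const 2).aemeasurable]
    refine le_trans (le_of_eq ?_) (hker ζ)
    refine lintegral_congr fun ω => lintegral_congr fun t => ?_
    have hp : 0 < 1 + ‖ζ + t • (ω : E)‖ := by positivity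
    have he : 0 ≤ gainExp ⟪ζ, (ω : E)⟫_ℝ t := (Real.exp_pos _).le
    simp only [hf]
    rw [← ENNReal.ofReal_pow (by positivity), mul_pow,
      ← Real.rpow_natCast (_ ^ (-γ / 2)), ← Real.rpow_mul hp.le]
    push_cast
    rw [div_mul_cancel₀ _ (two_ne_zero)]
  have hJ1 : ENNReal.ofReal ((1 + ‖ζ‖) ^ (γ - 1)) * J = 1 := by
    rw [hJ, ← ENNReal.ofReal_mul (by positivity), ← Real.rpow_add hpos]
    simp
  have hlast : ENNReal.ofReal ((1 + ‖ζ‖) ^ (γ - 1)) ^ 2 *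
      ENNReal.ofReal ((1 + ‖ζ‖) ^ (-γ - 1)) = ENNReal.ofReal ((1 + ‖ζ‖) ^ (γ - 3)) := by
    rw [← ENNReal.ofReal_pow (by positivity), ← ENNReal.ofReal_mul (by positivity),
      ← Real.rpow_natCast, ← Real.rpow_mul hpos.le, ← Real.rpow_add hpos]
    congr 2
    push_cast
    ring
  calc gainBound γ G ζ ^ 2
      = (ENNReal.ofReal ((1 + ‖ζ‖) ^ (γ - 1)) * (J * gainBound γ G ζ)) ^ 2 := by
        rw [← mul_assoc, hJ1, one_mul]
    _ ≤ (ENNReal.ofReal ((1 + ‖ζ‖) ^ (γ - 1)) * (C₁ * ∫⁻ z, f z * g z ∂μ)) ^ 2 := by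
        rw [← hfg]
        gcongr
    _ = ENNReal.ofReal ((1 + ‖ζ‖) ^ (γ - 1)) ^ 2 * C₁ ^ 2 * (∫⁻ z, f z * g z ∂μ) ^ 2 := by ring
    _ ≤ ENNReal.ofReal ((1 + ‖ζ‖) ^ (γ - 1)) ^ 2 * C₁ ^ 2 *
        ((C₂ * ENNReal.ofReal ((1 + ‖ζ‖) ^ (-γ - 1))) * (2 * N)) := by
        gcongr
        refine (lintegral_mul_sq_le μ hfm.aemeasurable hgm.aemeasurable).trans ?_
        rw [hA]
        gcongr
    _ = _ := by
        rw [← hlast]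
        ring

/-- The loss part maps the weighted `L²` space into bounded functions, with decay. -/
theorem exists_lossBound_sq_le (γ : ℝ) (h0 : 0 ≤ γ) (h1 : γ < 1) :
    ∃ C : ℝ≥0∞, C ≠ ⊤ ∧ ∀ (G : E → ℝ≥0∞), Measurable G → ∀ ζ : E,
    lossBound γ G ζ ^ 2 ≤ C * ENNReal.ofReal ((1 + ‖ζ‖) ^ (γ - 3)) *
      ∫⁻ ξ, G ξ ^ 2 * ENNReal.ofReal ((1 + ‖ξ‖) ^ γ) := by
  set S : ℝ≥0∞ := (volume : Measure E).toSphere univ with hS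
  have hSt : S ≠ ⊤ := measure_ne_top _ _
  set C₁ : ℝ≥0∞ := ∫⁻ x : E, ENNReal.ofReal (4 * Real.exp (-(1 / 2 * ‖x‖ ^ 2))) with hC₁
  have hC₁t : C₁ ≠ ⊤ := ((integrable_gaussian_norm _ (by norm_num)).const_mul 4).lintegral_lt_top.ne
  refine ⟨(8 * S) ^ 2 * C₁, by finiteness, fun G hG ζ => ?_⟩
  have hpos : 0 < 1 + ‖ζ‖ := by positivity
  have hgauss : (1 + ‖ζ‖) * gauss ζ ≤ 8 * ((1 + ‖ζ‖) ^ 2)⁻¹ := by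
    rw [← div_eq_mul_inv, le_div_iff₀ (by positivity)]
    calc (1 + ‖ζ‖) * gauss ζ * (1 + ‖ζ‖) ^ 2 = (1 + ‖ζ‖) ^ 3 * gauss ζ := by ring
      _ ≤ (2 * Real.exp (‖ζ‖ ^ 2 / 8)) ^ 3 * gauss ζ := by
          have := one_add_le_two_mul_exp ‖ζ‖
          have := gauss_pos ζ
          gcongr
      _ = 8 * Real.exp (3 * (‖ζ‖ ^ 2 / 8) + -(‖ζ‖ ^ 2 / 2)) := by
          rw [gauss, mul_pow, ← Real.exp_nat_mul, mul_assoc, ← Real.exp_add]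
          norm_num
      _ ≤ 8 * 1 := by
          gcongr
          exact Real.exp_le_one_iff.2 (by nlinarith [sq_nonneg ‖ζ‖])
      _ = 8 := mul_one _
  have hpt : ∀ (V : E) (ω : S2), crossBound γ V ω * (gauss ζ * gauss (ζ + V)) ≤
      8 * ((1 + ‖ζ‖) ^ 2)⁻¹ * ((1 + ‖ζ + V‖) * gauss (ζ + V)) := by
    intro V ω
    have hV : crossBound γ V ω ≤ 1 + ‖V‖ := by
      have hi : |⟪V, (ω : E)⟫_ℝ| / ‖V‖ ≤ 1 := by
        refine div_le_one_of_le₀ ?_ (norm_nonneg _)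
        simpa using abs_real_inner_le_norm V (ω : E)
      calc crossBound γ V ω ≤ ‖V‖ ^ γ * 1 := by unfold crossBound; gcongr
        _ ≤ (1 + ‖V‖) ^ γ := by rw [mul_one]; gcongr; linarith
        _ ≤ (1 + ‖V‖) ^ (1 : ℝ) :=
            Real.rpow_le_rpow_of_exponent_le (by linarith [norm_nonneg V]) h1.le
        _ = 1 + ‖V‖ := Real.rpow_one _
    have hV2 : 1 + ‖V‖ ≤ (1 + ‖ζ‖) * (1 + ‖ζ + V‖) := by
      have h := norm_sub_le (ζ + V) ζ
      rw [add_sub_cancel_left] at h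
      nlinarith [norm_nonneg ζ, norm_nonneg (ζ + V),
        mul_nonneg (norm_nonneg ζ) (norm_nonneg (ζ + V))]
    have hg1 := (gauss_pos ζ).le
    have hg2 := (gauss_pos (ζ + V)).le
    calc _ ≤ ((1 + ‖ζ‖) * (1 + ‖ζ + V‖)) * (gauss ζ * gauss (ζ + V)) := by
          gcongr
          exact hV.trans hV2
      _ = ((1 + ‖ζ‖) * gauss ζ) * ((1 + ‖ζ + V‖) * gauss (ζ + V)) := by ring
      _ ≤ _ := by gcongr
  have hGζ : Measurable fun V => G (ζ + V) := hG.comp (by fun_prop)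
  set c : ℝ≥0∞ := ENNReal.ofReal (8 * ((1 + ‖ζ‖) ^ 2)⁻¹) with hc
  have hwm : Measurable fun x : E => ENNReal.ofReal ((1 + ‖x‖) * gauss x) := by fun_prop
  have hb : lossBound γ G ζ ≤ c * S * ∫⁻ x, ENNReal.ofReal ((1 + ‖x‖) * gauss x) * G x := by
    calc lossBound γ G ζ ≤ ∫⁻ V : E, ∫⁻ _ω : S2, c * (ENNReal.ofReal ((1 + ‖ζ + V‖) *
          gauss (ζ + V)) * G (ζ + V)) ∂((volume : Measure E).toSphere) := by
          refine lintegral_mono fun V => lintegral_mono fun ω => ?_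
          rw [← mul_assoc, ← mul_assoc, ← ENNReal.ofReal_mul (crossBound_nonneg _ _ _), hc,
            ← ENNReal.ofReal_mul (by positivity)]
          exact mul_le_mul' (ENNReal.ofReal_le_ofReal (hpt V ω)) le_rfl
      _ = c * S * ∫⁻ V : E, ENNReal.ofReal ((1 + ‖ζ + V‖) * gauss (ζ + V)) * G (ζ + V) := by
          rw [← lintegral_const_mul' _ _ (by finiteness)]
          refine lintegral_congr fun V => ?_
          rw [lintegral_const, ← hS]
          ring
      _ = _ := by
          congr 1
          exact lintegral_add_left_eq_self (fun x => ENNReal.ofReal ((1 + ‖x‖) * gauss x) * G x) ζ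
  have hA : ∫⁻ x : E, ENNReal.ofReal ((1 + ‖x‖) * gauss x) ^ 2 ≤ C₁ := by
    refine lintegral_mono fun x => ?_
    have hg := (gauss_pos x).le
    rw [← ENNReal.ofReal_pow (by positivity)]
    refine ENNReal.ofReal_le_ofReal ?_
    calc ((1 + ‖x‖) * gauss x) ^ 2 ≤ (2 * Real.exp (‖x‖ ^ 2 / 8) * gauss x) ^ 2 := by
          have := one_add_le_two_mul_exp ‖x‖
          gcongr
      _ = 4 * Real.exp (2 * (‖x‖ ^ 2 / 8 + -(‖x‖ ^ 2 / 2))) := by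
          rw [gauss, mul_assoc, ← Real.exp_add, mul_pow, ← Real.exp_nat_mul]
          norm_num
      _ ≤ _ := by
          gcongr
          nlinarith [sq_nonneg ‖x‖]
  have hB : ∫⁻ x : E, G x ^ 2 ≤ ∫⁻ ξ, G ξ ^ 2 * ENNReal.ofReal ((1 + ‖ξ‖) ^ γ) := by
    refine lintegral_mono fun x => le_mul_of_one_le_right' ?_
    rw [ENNReal.one_le_ofReal]
    exact Real.one_le_rpow (by linarith [norm_nonneg x]) h0
  have hc2 : c ^ 2 ≤ 8 ^ 2 * ENNReal.ofReal ((1 + ‖ζ‖) ^ (γ - 3)) := by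
    rw [hc, show (8 : ℝ≥0∞) = ENNReal.ofReal 8 by simp, ← ENNReal.ofReal_pow (by positivity),
      ← ENNReal.ofReal_pow (by positivity), ← ENNReal.ofReal_mul (by positivity)]
    refine ENNReal.ofReal_le_ofReal ?_
    rw [mul_pow]
    gcongr
    rw [inv_pow, ← pow_mul, ← Real.rpow_natCast, ← Real.rpow_neg hpos.le]
    refine Real.rpow_le_rpow_of_exponent_le (by linarith [norm_nonneg ζ]) ?_
    push_cast
    linarith
  calc lossBound γ G ζ ^ 2
      ≤ (c * S * ∫⁻ x, ENNReal.ofReal ((1 + ‖x‖) * gauss x) * G x) ^ 2 := by gcongr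
    _ = c ^ 2 * S ^ 2 * (∫⁻ x, ENNReal.ofReal ((1 + ‖x‖) * gauss x) * G x) ^ 2 := by ring
    _ ≤ (8 ^ 2 * ENNReal.ofReal ((1 + ‖ζ‖) ^ (γ - 3))) * S ^ 2 *
        (C₁ * ∫⁻ ξ, G ξ ^ 2 * ENNReal.ofReal ((1 + ‖ξ‖) ^ γ)) := by
        gcongr
        refine (lintegral_mul_sq_le volume hwm.aemeasurable hG.aemeasurable).trans ?_
        gcongr
    _ = _ := by ring

/-! ### The collision frequency and the operator `K` -/

theorem maxwellian_nonneg (x : E) : 0 ≤ maxwellian x := by unfold maxwellian; positivity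

theorem sqrt_maxwellian (x : E) :
    Real.sqrt (maxwellian x) = Real.sqrt (Real.pi ^ (-(3 / 2) : ℝ)) * gauss x := by
  rw [maxwellian, Real.sqrt_mul (by positivity), gauss, ← Real.exp_half, neg_div]

theorem maxwellian_eq_sq (x : E) :
    maxwellian x = (Real.sqrt (Real.pi ^ (-(3 / 2) : ℝ)) * gauss x) ^ 2 := by
  rw [← sqrt_maxwellian, Real.sq_sqrt (maxwellian_nonneg x)]

@[fun_prop]
theorem continuous_maxwellian : Continuous maxwellian := by unfold maxwellian; fun_prop

theorem measurable_nu (γ : ℝ) (β : ℝ → ℝ) : Measurable (nu γ β) := by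
  have h : StronglyMeasurable fun z : E × E => maxwellian z.2 * ‖z.2 - z.1‖ ^ γ := by
    apply Measurable.stronglyMeasurable
    fun_prop
  exact (h.integral_prod_right).measurable.const_mul _

theorem integrable_maxwellian_mul (γ : ℝ) (h0 : 0 ≤ γ) (h1 : γ < 1) (ζ : E) :
    Integrable fun η : E => maxwellian η * ‖η - ζ‖ ^ γ := by
  have hi := (integrable_gaussian_norm (7 / 8) (by norm_num)).const_mul
    (Real.pi ^ (-(3 / 2) : ℝ) * (2 * (1 + ‖ζ‖)))
  refine hi.mono' (Measurable.aestronglyMeasurable (by fun_prop)) (ae_of_all _ fun η => ?_)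
  have hm := maxwellian_nonneg η
  rw [Real.norm_of_nonneg (by positivity)]
  have hle : ‖η - ζ‖ ^ γ ≤ (1 + ‖η‖) * (1 + ‖ζ‖) := by
    calc ‖η - ζ‖ ^ γ ≤ (1 + ‖η - ζ‖) ^ γ := by gcongr; linarith
      _ ≤ (1 + ‖η - ζ‖) ^ (1 : ℝ) :=
          Real.rpow_le_rpow_of_exponent_le (by linarith [norm_nonneg (η - ζ)]) h1.le
      _ ≤ _ := by
          rw [Real.rpow_one]
          nlinarith [norm_sub_le η ζ, mul_nonneg (norm_nonneg η) (norm_nonneg ζ)]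
  calc maxwellian η * ‖η - ζ‖ ^ γ
      ≤ maxwellian η * ((2 * Real.exp (‖η‖ ^ 2 / 8)) * (1 + ‖ζ‖)) := by
        have := one_add_le_two_mul_exp ‖η‖
        refine mul_le_mul_of_nonneg_left (hle.trans ?_) hm
        gcongr
    _ = Real.pi ^ (-(3 / 2) : ℝ) * (2 * (1 + ‖ζ‖)) *
        (Real.exp (-‖η‖ ^ 2) * Real.exp (‖η‖ ^ 2 / 8)) := by
        unfold maxwellian; ring
    _ = _ := by
        rw [← Real.exp_add]
        congr 2
        ring

/-- The collision frequency grows at least like `(1 + |ζ|) ^ γ`. The lower bound for the integral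
comes from its symmetrization under `η ↦ -η`, as `|η - ζ| + |η + ζ| ≥ 2 max (|η|, |ζ|)`. -/
theorem exists_le_nu {γ : ℝ} {β : ℝ → ℝ} (hB : IsCutoffCrossSection γ β) :
    ∃ c : ℝ, 0 < c ∧ ∀ ζ : E, c * (1 + ‖ζ‖) ^ γ ≤ nu γ β ζ := by
  have h0 := hB.gamma_nonneg
  have h1 := hB.gamma_lt_one
  set b : ℝ := ∫ θ in (0 : ℝ)..(Real.pi / 2), β θ with hb
  have hb0 : 0 < b := hB.nontrivial
  set m : ℝ := ∫ η : E, maxwellian η * min 1 ‖η‖ with hm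
  have hMi : Integrable fun η : E => maxwellian η := by
    simpa using integrable_maxwellian_mul 0 le_rfl one_pos 0
  have hmi : Integrable fun η : E => maxwellian η * min 1 ‖η‖ := by
    refine hMi.mono' (Measurable.aestronglyMeasurable (by fun_prop)) (ae_of_all _ fun η => ?_)
    have hM := maxwellian_nonneg η
    have hmin : 0 ≤ min 1 ‖η‖ := le_min zero_le_one (norm_nonneg _)
    rw [Real.norm_of_nonneg (by positivity)]
    exact mul_le_of_le_one_right hM (min_le_left _ _)
  have hm0 : 0 < m := by
    obtain ⟨v, hv⟩ := exists_ne (0 : E)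
    have hv0 : 0 < ‖v‖ := norm_pos_iff.2 hv
    refine integral_pos_of_integrable_nonneg_nonzero (x := v) (by fun_prop) hmi (fun η => ?_) ?_
    · exact mul_nonneg (maxwellian_nonneg η) (le_min zero_le_one (norm_nonneg _))
    · have : 0 < maxwellian v := by unfold maxwellian; positivity
      have : 0 < min 1 ‖v‖ := lt_min one_pos hv0
      positivity
  refine ⟨2 * Real.pi * b * (m / 4), by positivity, fun ζ => ?_⟩
  set I : ℝ := ∫ η : E, maxwellian η * ‖η - ζ‖ ^ γ with hI
  have hI1 := integrable_maxwellian_mul γ h0 h1 ζ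
  have hI2 := integrable_maxwellian_mul γ h0 h1 (-ζ)
  have hsym : ∫ η : E, maxwellian η * ‖η - -ζ‖ ^ γ = I := by
    rw [hI, ← integral_neg_eq_self]
    refine integral_congr_ae (ae_of_all _ fun η => ?_)
    simp only [maxwellian, norm_neg]
    rw [show -η - -ζ = -(η - ζ) by abel, norm_neg]
  have hpt : ∀ η : E, (1 + ‖ζ‖) ^ γ / 2 * (maxwellian η * min 1 ‖η‖) ≤
      maxwellian η * ‖η - ζ‖ ^ γ + maxwellian η * ‖η - -ζ‖ ^ γ := by
    intro η
    have hM := maxwellian_nonneg η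
    have hmin : 0 ≤ min 1 ‖η‖ := le_min zero_le_one (norm_nonneg _)
    have hmin1 : min 1 ‖η‖ ≤ 1 := min_le_left _ _
    have hmin2 : min 1 ‖η‖ ≤ ‖η‖ := min_le_right _ _
    have hx : 2 * ‖η‖ ≤ ‖η - ζ‖ + ‖η - -ζ‖ := by
      have h := norm_add_le (η - ζ) (η - -ζ)
      rw [show η - ζ + (η - -ζ) = (2 : ℝ) • η by module, norm_smul] at h
      simpa using h
    have hy : 2 * ‖ζ‖ ≤ ‖η - ζ‖ + ‖η - -ζ‖ := by
      have h := norm_sub_le (η - -ζ) (η - ζ)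
      rw [show η - -ζ - (η - ζ) = (2 : ℝ) • ζ by module, norm_smul, add_comm] at h
      simpa using h
    have hmax : (1 + ‖ζ‖) / 2 * min 1 ‖η‖ ≤ max ‖η - ζ‖ ‖η - -ζ‖ := by
      have h2 : ‖η - ζ‖ + ‖η - -ζ‖ ≤ 2 * max ‖η - ζ‖ ‖η - -ζ‖ := by
        linarith [le_max_left ‖η - ζ‖ ‖η - -ζ‖, le_max_right ‖η - ζ‖ ‖η - -ζ‖]
      rcases le_or_gt 1 ‖ζ‖ with h | h
      · nlinarith
      · nlinarith
    have hpow : (1 + ‖ζ‖) ^ γ / 2 * min 1 ‖η‖ ≤ ‖η - ζ‖ ^ γ + ‖η - -ζ‖ ^ γ := by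
      calc (1 + ‖ζ‖) ^ γ / 2 * min 1 ‖η‖ = (1 + ‖ζ‖) ^ γ * ((1 / 2) ^ (1 : ℝ)) *
            (min 1 ‖η‖) ^ (1 : ℝ) := by rw [Real.rpow_one, Real.rpow_one]; ring
        _ ≤ (1 + ‖ζ‖) ^ γ * ((1 / 2) ^ γ) * (min 1 ‖η‖) ^ γ := by
            gcongr ?_ * ?_ * ?_
            · exact Real.rpow_le_rpow_of_exponent_ge (by norm_num) (by norm_num) h1.le
            · rcases hmin.eq_or_lt with h | h
              · rw [← h, Real.zero_rpow one_ne_zero]; positivity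
              · exact Real.rpow_le_rpow_of_exponent_ge h hmin1 h1.le
        _ = ((1 + ‖ζ‖) / 2 * min 1 ‖η‖) ^ γ := by
            rw [← Real.mul_rpow (by positivity) (by positivity),
              ← Real.mul_rpow (by positivity) hmin]
            congr 1
            ring
        _ ≤ (max ‖η - ζ‖ ‖η - -ζ‖) ^ γ := by gcongr
        _ ≤ _ := by
            rcases max_choice ‖η - ζ‖ ‖η - -ζ‖ with h | h <;> rw [h]
            · exact le_add_of_nonneg_right (by positivity)
            · exact le_add_of_nonneg_left (by positivity)
    calc _ = maxwellian η * ((1 + ‖ζ‖) ^ γ / 2 * min 1 ‖η‖) := by ring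
      _ ≤ maxwellian η * (‖η - ζ‖ ^ γ + ‖η - -ζ‖ ^ γ) := by gcongr
      _ = _ := by ring
  have hint : (1 + ‖ζ‖) ^ γ / 2 * m ≤ 2 * I := by
    calc _ = ∫ η : E, (1 + ‖ζ‖) ^ γ / 2 * (maxwellian η * min 1 ‖η‖) := by
          rw [integral_const_mul]
      _ ≤ ∫ η : E, (maxwellian η * ‖η - ζ‖ ^ γ + maxwellian η * ‖η - -ζ‖ ^ γ) :=
          integral_mono (hmi.const_mul _) (hI1.add hI2) hpt
      _ = 2 * I := by rw [integral_add hI1 hI2, hsym, two_mul]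
  have hnu : nu γ β ζ = 2 * Real.pi * b * I := rfl
  rw [hnu]
  calc _ = 2 * Real.pi * b * ((1 + ‖ζ‖) ^ γ / 2 * m / 2) := by ring
    _ ≤ 2 * Real.pi * b * I := by
        gcongr
        linarith

/-- The cutoff assumption bounds the cross section, as a density on the sphere, by
`|V| ^ γ |cos θ|`. -/
theorem exists_abs_crossSection_le {γ : ℝ} {β : ℝ → ℝ} (hB : IsCutoffCrossSection γ β) :
    ∃ C : ℝ, 0 ≤ C ∧ ∀ (V : E) (ω : S2), |crossSection γ β V ω| ≤ C * crossBound γ V ω := by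
  obtain ⟨C, hC⟩ := hB.cutoff
  have hC0 : 0 ≤ C := by
    have h := hC (Real.pi / 4) ⟨by positivity, by linarith [Real.pi_pos]⟩
    rw [Real.cos_pi_div_four, Real.sin_pi_div_four] at h
    have h2 : Real.sqrt 2 / 2 * (Real.sqrt 2 / 2) = 1 / 2 := by
      nlinarith [Real.mul_self_sqrt (show (0 : ℝ) ≤ 2 by norm_num)]
    rw [h2] at h
    linarith
  refine ⟨C, hC0, fun V ω => ?_⟩
  set x : ℝ := |⟪V, (ω : E)⟫_ℝ| / ‖V‖ with hx
  have hx0 : 0 ≤ x := by positivity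
  have hx1 : x ≤ 1 := by
    refine div_le_one_of_le₀ ?_ (norm_nonneg _)
    simpa using abs_real_inner_le_norm V (ω : E)
  have hθ : collAngle V ω = Real.arccos x := rfl
  have hcos : Real.cos (collAngle V ω) = x := by
    rw [hθ, Real.cos_arccos (by linarith) hx1]
  have hmem : collAngle V ω ∈ Icc 0 (Real.pi / 2) :=
    ⟨Real.arccos_nonneg _, by rw [hθ]; exact Real.arccos_le_pi_div_two.2 hx0⟩
  obtain ⟨hb0, hb1⟩ := hC _ hmem
  have hs : 0 ≤ Real.sin (collAngle V ω) :=
    Real.sin_nonneg_of_nonneg_of_le_pi hmem.1 (by linarith [hmem.2, Real.pi_pos])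
  rw [hcos] at hb1
  have hq : β (collAngle V ω) / Real.sin (collAngle V ω) ≤ C * x := by
    rcases hs.eq_or_lt with h | h
    · rw [← h, div_zero]; positivity
    · rw [div_le_iff₀ h]; linarith
  have hq0 : 0 ≤ β (collAngle V ω) / Real.sin (collAngle V ω) := by positivity
  have hcs : 0 ≤ crossSection γ β V ω := by unfold crossSection; positivity
  rw [abs_of_nonneg hcs]
  calc crossSection γ β V ω
      = 1 / 2 * (‖V‖ ^ γ * (β (collAngle V ω) / Real.sin (collAngle V ω))) := rfl
    _ ≤ 1 * (‖V‖ ^ γ * (C * x)) := by gcongr; norm_num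
    _ = C * crossBound γ V ω := by rw [crossBound, ← hx]; ring

/-- The conservation of energy `|ζ'|² + |ζ_*'|² = |ζ|² + |ζ_*|²` in a collision. -/
theorem gauss_mul_gauss_post (ζ V : E) (ω : S2) :
    gauss (ζ + ⟪V, (ω : E)⟫_ℝ • (ω : E)) * gauss (ζ + (V - ⟪V, (ω : E)⟫_ℝ • (ω : E))) =
      gauss ζ * gauss (ζ + V) := by
  have hω : ‖(ω : E)‖ ^ 2 = 1 := by simp
  set p : ℝ := ⟪V, (ω : E)⟫_ℝ with hp
  have hp' : ⟪(ω : E), V⟫_ℝ = p := by rw [real_inner_comm]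
  simp only [gauss, ← Real.exp_add]
  congr 1
  simp only [← real_inner_self_eq_norm_sq, inner_add_left, inner_add_right, inner_sub_left,
    inner_sub_right, real_inner_smul_left, real_inner_smul_right, hp'] at hω ⊢
  simp only [← hp, hω, real_inner_comm ζ]
  ring

/-- The gain term with the arguments `ζ'` and `ζ_*'` exchanged has the same bound. -/
theorem lintegral_gain_swap (γ : ℝ) {G : E → ℝ≥0∞} (hG : Measurable G) (ζ : E) :
    ∫⁻ V : E, ∫⁻ ω : S2, ENNReal.ofReal (crossBound γ V ω) *
      (ENNReal.ofReal (gauss (ζ + V) * gauss (ζ + ⟪V, (ω : E)⟫_ℝ • (ω : E))) *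
      G (ζ + (V - ⟪V, (ω : E)⟫_ℝ • (ω : E)))) ∂((volume : Measure E).toSphere) =
    gainBound γ G ζ := by
  refine lintegral_congr fun V => ?_
  set Ψ : E × E → ℝ≥0∞ := fun z => ENNReal.ofReal (‖V‖ ^ γ / ‖V‖) *
    (ENNReal.ofReal (gauss (ζ + V) * gauss (ζ + z.2)) * G (ζ + z.1)) with hΨ
  have hm : Measurable Ψ := by
    have : Measurable fun z : E × E => G (ζ + z.1) := hG.comp (by fun_prop)
    simp only [hΨ]
    fun_prop
  have hcb : ∀ ω : S2, ENNReal.ofReal (crossBound γ V ω) =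
      ENNReal.ofReal |⟪V, (ω : E)⟫_ℝ| * ENNReal.ofReal (‖V‖ ^ γ / ‖V‖) := fun ω => by
    rw [← ENNReal.ofReal_mul (by positivity), crossBound]
    congr 1
    ring
  simp only [hcb, mul_assoc]
  exact (lintegral_sphere_swap V hm).symm

theorem lintegral_lintegral_const_mul_add_add {T₁ T₂ T₃ : E → S2 → ℝ≥0∞}
    (hm1 : Measurable (Function.uncurry T₁)) (hm2 : Measurable (Function.uncurry T₂))
    {c : ℝ≥0∞} (hc : c ≠ ⊤) :
    ∫⁻ V : E, ∫⁻ ω : S2, c * ((T₁ V ω + T₂ V ω) + T₃ V ω) ∂((volume : Measure E).toSphere) =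
      c * ((∫⁻ V : E, ∫⁻ ω : S2, T₁ V ω ∂((volume : Measure E).toSphere)) +
        (∫⁻ V : E, ∫⁻ ω : S2, T₂ V ω ∂((volume : Measure E).toSphere)) +
        ∫⁻ V : E, ∫⁻ ω : S2, T₃ V ω ∂((volume : Measure E).toSphere)) := by
  have hi1 : Measurable fun V => ∫⁻ ω : S2, T₁ V ω ∂((volume : Measure E).toSphere) :=
    hm1.lintegral_prod_right'
  have hi2 : Measurable fun V => ∫⁻ ω : S2, T₂ V ω ∂((volume : Measure E).toSphere) :=
    hm2.lintegral_prod_right'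
  have hi3 : Measurable fun V => (∫⁻ ω : S2, T₁ V ω ∂((volume : Measure E).toSphere)) +
      ∫⁻ ω : S2, T₂ V ω ∂((volume : Measure E).toSphere) := hi1.add hi2
  rw [← lintegral_add_left hi1, ← lintegral_add_left hi3, ← lintegral_const_mul' _ _ hc]
  refine lintegral_congr fun V => ?_
  have h1 : Measurable (T₁ V) := hm1.comp measurable_prodMk_left
  have h2 : Measurable (T₂ V) := hm2.comp measurable_prodMk_left
  have h3 : Measurable fun ω => T₁ V ω + T₂ V ω := h1.add h2
  rw [lintegral_const_mul' _ _ hc, lintegral_add_left h3, lintegral_add_left h1]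

/-- The integrand of `K`, divided by the square root of the Maxwellian. The conservation of energy
`M' M_*' = M M_*` removes the growing factor. -/
theorem collK_integrand_eq (g : E → ℝ) (ζ V : E) (ω : S2) (s : ℝ) :
    (Real.sqrt (maxwellian ζ))⁻¹ *
      ((maxwellian (postVel ζ (ζ + V) ω) * (Real.sqrt (maxwellian (postVelStar ζ (ζ + V) ω)) *
          g (postVelStar ζ (ζ + V) ω))
        + (Real.sqrt (maxwellian (postVel ζ (ζ + V) ω)) * g (postVel ζ (ζ + V) ω)) *
          maxwellian (postVelStar ζ (ζ + V) ω)
        - maxwellian ζ * (Real.sqrt (maxwellian (ζ + V)) * g (ζ + V))) * s) =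
      Real.sqrt (Real.pi ^ (-(3 / 2) : ℝ)) ^ 2 * s *
        (gauss (ζ + V) * gauss (ζ + ⟪V, (ω : E)⟫_ℝ • (ω : E)) *
            g (ζ + (V - ⟪V, (ω : E)⟫_ℝ • (ω : E)))
          + gauss (ζ + V) * gauss (ζ + (V - ⟪V, (ω : E)⟫_ℝ • (ω : E))) *
            g (ζ + ⟪V, (ω : E)⟫_ℝ • (ω : E))
          - gauss ζ * gauss (ζ + V) * g (ζ + V)) := by
  have hpv : postVel ζ (ζ + V) ω = ζ + ⟪V, (ω : E)⟫_ℝ • (ω : E) := by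
    rw [postVel, add_sub_cancel_left]
  have hps : postVelStar ζ (ζ + V) ω = ζ + (V - ⟪V, (ω : E)⟫_ℝ • (ω : E)) := by
    rw [postVelStar, add_sub_cancel_left, add_sub_assoc]
  have hgg := gauss_mul_gauss_post ζ V ω
  rw [hpv, hps]
  generalize ζ + ⟪V, (ω : E)⟫_ℝ • (ω : E) = A at hgg ⊢
  generalize ζ + (V - ⟪V, (ω : E)⟫_ℝ • (ω : E)) = B at hgg ⊢
  have hk0 : 0 < Real.sqrt (Real.pi ^ (-(3 / 2) : ℝ)) := Real.sqrt_pos.2 (by positivity)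
  simp only [sqrt_maxwellian]
  simp only [maxwellian_eq_sq]
  generalize Real.sqrt (Real.pi ^ (-(3 / 2) : ℝ)) = k at hk0 ⊢
  have := gauss_pos ζ
  rw [inv_mul_eq_iff_eq_mul₀ (by positivity)]
  linear_combination (k ^ 3 * s * (gauss A * g B + gauss B * g A)) * hgg

theorem enorm_gauss_combination_le {g : E → ℝ} {G : E → ℝ≥0∞} (hg : ∀ η, ‖g η‖ₑ ≤ G η)
    (a a₁ a₂ a₃ y₁ y₂ y₃ : E) :
    ‖gauss a * gauss a₁ * g y₁ + gauss a * gauss a₂ * g y₂ - gauss a₃ * gauss a * g y₃‖ₑ ≤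
      ENNReal.ofReal (gauss a * gauss a₁) * G y₁ + ENNReal.ofReal (gauss a * gauss a₂) * G y₂ +
        ENNReal.ofReal (gauss a₃ * gauss a) * G y₃ := by
  have hterm : ∀ (a b : E) (y : E), ‖gauss a * gauss b * g y‖ₑ ≤
      ENNReal.ofReal (gauss a * gauss b) * G y := by
    intro a b y
    have ha := gauss_pos a
    have hb := gauss_pos b
    rw [enorm_mul, Real.enorm_of_nonneg (by positivity)]
    gcongr
    exact hg y
  exact enorm_sub_le.trans (add_le_add ((enorm_add_le _ _).trans
    (add_le_add (hterm _ _ _) (hterm _ _ _))) (hterm _ _ _))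

/-- The two gain terms of `K` have the same bound, whence the factor `2`. -/
theorem exists_collK_le {γ : ℝ} {β : ℝ → ℝ} (hB : IsCutoffCrossSection γ β) :
    ∃ C : ℝ≥0∞, C ≠ ⊤ ∧ ∀ (g : E → ℝ) (G : E → ℝ≥0∞), Measurable G → (∀ η, ‖g η‖ₑ ≤ G η) →
      ∀ ζ, ‖collK γ β g ζ‖ₑ ≤ C * (2 * gainBound γ G ζ + lossBound γ G ζ) := by
  obtain ⟨C, hC0, hC⟩ := exists_abs_crossSection_le hB
  refine ⟨ENNReal.ofReal (Real.sqrt (Real.pi ^ (-(3 / 2) : ℝ)) ^ 2 * C), by finiteness,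
    fun g G hG hg ζ => ?_⟩
  have hct : ENNReal.ofReal (Real.sqrt (Real.pi ^ (-(3 / 2) : ℝ)) ^ 2 * C) ≠ ⊤ := by finiteness
  have hcs : ∀ (V : E) (ω : S2), ‖Real.sqrt (Real.pi ^ (-(3 / 2) : ℝ)) ^ 2 *
      crossSection γ β V ω‖ₑ ≤ ENNReal.ofReal (Real.sqrt (Real.pi ^ (-(3 / 2) : ℝ)) ^ 2 * C) *
        ENNReal.ofReal (crossBound γ V ω) := by
    intro V ω
    rw [← ENNReal.ofReal_mul (by positivity), ← ofReal_norm, norm_mul,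
      Real.norm_of_nonneg (by positivity), mul_assoc]
    gcongr
    exact hC V ω
  generalize ENNReal.ofReal (Real.sqrt (Real.pi ^ (-(3 / 2) : ℝ)) ^ 2 * C) = c at hct hcs ⊢
  have hcm : Measurable fun z : E × S2 => crossBound γ z.1 z.2 := by unfold crossBound; fun_prop
  have hG1 : Measurable fun z : E × S2 => G (ζ + (z.1 - ⟪z.1, (z.2 : E)⟫_ℝ • (z.2 : E))) :=
    hG.comp (by fun_prop)
  have hG2 : Measurable fun z : E × S2 => G (ζ + ⟪z.1, (z.2 : E)⟫_ℝ • (z.2 : E)) :=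
    hG.comp (by fun_prop)
  have hm1 : Measurable (Function.uncurry fun (V : E) (ω : S2) =>
      ENNReal.ofReal (crossBound γ V ω) *
      (ENNReal.ofReal (gauss (ζ + V) * gauss (ζ + ⟪V, (ω : E)⟫_ℝ • (ω : E))) *
      G (ζ + (V - ⟪V, (ω : E)⟫_ℝ • (ω : E))))) := by
    simp only [Function.uncurry_def, gauss]; fun_prop
  have hm2 : Measurable (Function.uncurry fun (V : E) (ω : S2) =>
      ENNReal.ofReal (crossBound γ V ω) *
      (ENNReal.ofReal (gauss (ζ + V) * gauss (ζ + (V - ⟪V, (ω : E)⟫_ℝ • (ω : E)))) *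
      G (ζ + ⟪V, (ω : E)⟫_ℝ • (ω : E)))) := by
    simp only [Function.uncurry_def, gauss]; fun_prop
  rw [two_mul, ← lintegral_gain_swap γ hG ζ]
  nth_rw 2 [lintegral_gain_swap γ hG ζ]
  rw [gainBound, lossBound, ← lintegral_lintegral_const_mul_add_add hm1 hm2 hct, collK,
    ← integral_const_mul]
  refine (enorm_integral_le_lintegral_enorm _).trans ?_
  rw [← lintegral_add_left_eq_self (μ := (volume : Measure E)) _ ζ]
  refine lintegral_mono fun V => ?_
  rw [← integral_const_mul]
  refine (enorm_integral_le_lintegral_enorm _).trans (lintegral_mono fun ω => ?_)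
  rw [collK_integrand_eq, add_sub_cancel_left, enorm_mul]
  refine (mul_le_mul' (hcs V ω) (enorm_gauss_combination_le hg _ _ _ _ _ _ _)).trans
    (le_of_eq ?_)
  ring

theorem ennreal_add_sq_le (a b : ℝ≥0∞) : (a + b) ^ 2 ≤ 2 * a ^ 2 + 2 * b ^ 2 := by
  have h := ENNReal.rpow_add_le_mul_rpow_add_rpow a b (p := 2) (by norm_num)
  norm_num at h
  rw [← mul_add]
  exact_mod_cast h

/-- `K` maps `L^*_ζ` into bounded functions, with decay `(1 + |ζ|) ^ ((γ - 3) / 2)`. -/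
theorem exists_collK_sq_le {γ : ℝ} {β : ℝ → ℝ} (hB : IsCutoffCrossSection γ β) :
    ∃ C : ℝ≥0∞, C ≠ ⊤ ∧ ∀ (g : E → ℝ) (G : E → ℝ≥0∞), Measurable G → (∀ η, ‖g η‖ₑ ≤ G η) →
      ∀ ζ, ‖collK γ β g ζ‖ₑ ^ 2 ≤ C * ENNReal.ofReal ((1 + ‖ζ‖) ^ (γ - 3)) *
        ∫⁻ ξ, G ξ ^ 2 ∂(nuMeasure γ β) := by
  obtain ⟨C₁, hC₁, hK⟩ := exists_collK_le hB
  obtain ⟨C₂, hC₂, hgain⟩ := exists_gainBound_sq_le γ hB.gamma_nonneg hB.gamma_lt_one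
  obtain ⟨C₃, hC₃, hloss⟩ := exists_lossBound_sq_le γ hB.gamma_nonneg hB.gamma_lt_one
  obtain ⟨c, hc, hnu⟩ := exists_le_nu hB
  have hci : (ENNReal.ofReal c)⁻¹ ≠ ⊤ := by simpa using hc
  refine ⟨C₁ ^ 2 * (8 * C₂ + 2 * C₃) * (ENNReal.ofReal c)⁻¹, by finiteness,
    fun g G hG hg ζ => ?_⟩
  set w := ENNReal.ofReal ((1 + ‖ζ‖) ^ (γ - 3))
  set N := ∫⁻ ξ, G ξ ^ 2 * ENNReal.ofReal ((1 + ‖ξ‖) ^ γ) with hN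
  have hN' : N ≤ (ENNReal.ofReal c)⁻¹ * ∫⁻ ξ, G ξ ^ 2 ∂(nuMeasure γ β) := by
    rw [nuMeasure, lintegral_withDensity_eq_lintegral_mul _ (measurable_nu γ β).ennreal_ofReal
      (by fun_prop), ← lintegral_const_mul' _ _ hci]
    refine lintegral_mono fun ξ => ?_
    simp only [Pi.mul_apply]
    rw [← mul_assoc, mul_comm (G ξ ^ 2)]
    gcongr
    rw [mul_comm, ← div_eq_mul_inv, ENNReal.le_div_iff_mul_le (Or.inl (by simpa using hc))
      (Or.inl ENNReal.ofReal_ne_top), ← ENNReal.ofReal_mul (by positivity)]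
    refine ENNReal.ofReal_le_ofReal ?_
    rw [mul_comm]
    exact hnu ξ
  calc ‖collK γ β g ζ‖ₑ ^ 2 ≤ (C₁ * (2 * gainBound γ G ζ + lossBound γ G ζ)) ^ 2 := by
        gcongr
        exact hK g G hG hg ζ
    _ ≤ C₁ ^ 2 * (2 * (2 * gainBound γ G ζ) ^ 2 + 2 * lossBound γ G ζ ^ 2) := by
        rw [mul_pow]
        gcongr
        exact ennreal_add_sq_le _ _
    _ = C₁ ^ 2 * (8 * gainBound γ G ζ ^ 2 + 2 * lossBound γ G ζ ^ 2) := by ring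
    _ ≤ C₁ ^ 2 * (8 * (C₂ * w * N) + 2 * (C₃ * w * N)) := by
        gcongr
        exacts [hgain G hG ζ, hloss G hG ζ]
    _ = C₁ ^ 2 * (8 * C₂ + 2 * C₃) * w * N := by ring
    _ ≤ C₁ ^ 2 * (8 * C₂ + 2 * C₃) * w *
        ((ENNReal.ofReal c)⁻¹ * ∫⁻ ξ, G ξ ^ 2 ∂(nuMeasure γ β)) := by gcongr
    _ = _ := by ring

/-! ### A weakly singular integral inequality -/

/-- If `A` and `B` are the distances of a point to two others at distance `D`, a product of negative
powers of `A` and `B` is bounded by the power `-e` of `D` and the power `-c` of the smaller one. -/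
theorem rpow_neg_mul_rpow_neg_le {A B D : ℝ≥0∞} (hA : A ≠ ⊤) (hB : B ≠ ⊤) (hD : D ≤ A + B)
    {p q e c : ℝ} (he : 0 ≤ e) (hp : e ≤ p) (hq : e ≤ q) (hc : 0 < c) (hsum : p + q = c + e) :
    A ^ (-p) * B ^ (-q) ≤ 2 ^ e * D ^ (-e) * (A ^ (-c) + B ^ (-c)) := by
  wlog hAB : A ≤ B generalizing A B p q
  · have h := this hB hA (by rwa [add_comm]) hq hp (by linarith) (le_of_not_ge hAB)
    rwa [mul_comm, add_comm (A ^ (-c))]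
  have hDt : D ≠ ⊤ := ne_top_of_le_ne_top (by finiteness) hD
  have h2D : D ^ (-e) ≠ 0 := by
    rw [ENNReal.rpow_neg]
    exact ENNReal.inv_ne_zero.2 (by finiteness)
  rcases eq_or_ne A 0 with rfl | hA0
  · rw [ENNReal.zero_rpow_of_neg (neg_lt_zero.2 hc), top_add, ENNReal.mul_top]
    · exact le_top
    · have : (2 : ℝ≥0∞) ^ e ≠ 0 := by
        simp [ENNReal.rpow_eq_zero_iff]
      exact mul_ne_zero this h2D
  have hB0 : B ≠ 0 := fun h => hA0 (le_antisymm (h ▸ hAB) bot_le)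
  have hD2 : D ≤ 2 * B := hD.trans (by rw [two_mul]; gcongr)
  have h1 : B ^ (-e) ≤ 2 ^ e * D ^ (-e) := by
    calc B ^ (-e) = 2 ^ e * (2 * B) ^ (-e) := by
          rw [ENNReal.mul_rpow_of_ne_top (by simp) hB, ← mul_assoc,
            ← ENNReal.rpow_add _ _ (by simp) (by simp)]
          simp
      _ ≤ _ := by
          gcongr 2 ^ e * ?_
          rw [ENNReal.rpow_neg, ENNReal.rpow_neg]
          gcongr
  calc A ^ (-p) * B ^ (-q) = A ^ (-p) * B ^ (-(q - e)) * B ^ (-e) := by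
        rw [mul_assoc, ← ENNReal.rpow_add _ _ hB0 hB]
        ring_nf
    _ ≤ A ^ (-p) * A ^ (-(q - e)) * (2 ^ e * D ^ (-e)) := by
        gcongr A ^ (-p) * ?_ * ?_
        rw [ENNReal.rpow_neg, ENNReal.rpow_neg]
        have : 0 ≤ q - e := by linarith
        gcongr
    _ = 2 ^ e * D ^ (-e) * A ^ (-c) := by
        rw [← ENNReal.rpow_add _ _ hA0 hA, mul_comm]
        congr 2
        linarith
    _ ≤ _ := by
        gcongr
        exact le_self_add

theorem lintegral_ball_norm_rpow_ne_top :
    ∫⁻ x in ball (0 : E) 1, ‖x‖ₑ ^ (-(5 / 2) : ℝ) ≠ ⊤ := by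
  have hm : Measurable fun x : E => ‖x‖ₑ ^ (-(5 / 2) : ℝ) := by fun_prop
  have h1 : IntegrableOn (fun r : ℝ => r ^ (-(1 / 2) : ℝ)) (Ioc (0 : ℝ) 1) := by
    have h := (intervalIntegral.intervalIntegrable_rpow' (a := 0) (b := 1)
      (r := -(1 / 2)) (by norm_num))
    rwa [intervalIntegrable_iff_integrableOn_Ioc_of_le zero_le_one] at h
  rw [← lintegral_indicator measurableSet_ball,
    lintegral_eq_lintegral_polar (hm.indicator measurableSet_ball)]
  refine ne_top_of_le_ne_top (b := ∫⁻ _ω : S2, (∫⁻ r in Ioc (0 : ℝ) 1,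
    ENNReal.ofReal (r ^ (-(1 / 2) : ℝ))) ∂((volume : Measure E).toSphere)) ?_ ?_
  · rw [lintegral_const]
    exact ENNReal.mul_ne_top h1.lintegral_lt_top.ne (measure_ne_top _ _)
  · refine lintegral_mono fun ω => ?_
    rw [← lintegral_indicator measurableSet_Ioi, ← lintegral_indicator measurableSet_Ioc]
    refine lintegral_mono fun r => ?_
    by_cases hr : 0 < r
    · have hn : ‖r • (ω : E)‖ = r := by simp [norm_smul, abs_of_pos hr]
      rw [indicator_of_mem (show r ∈ Ioi 0 from hr)]
      by_cases hr1 : r < 1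
      · rw [indicator_of_mem (by simpa [hn] using hr1),
          indicator_of_mem (show r ∈ Ioc 0 1 from ⟨hr, hr1.le⟩), ← ofReal_norm, hn,
          ENNReal.ofReal_rpow_of_pos hr, ← ENNReal.ofReal_mul (by positivity),
          ← Real.rpow_natCast, ← Real.rpow_add hr]
        norm_num
      · rw [indicator_of_notMem (by simpa [hn] using hr1), mul_zero]
        exact bot_le
    · rw [indicator_of_notMem (show r ∉ Ioi 0 from hr)]
      exact bot_le

/-- The kernel `|x - y| ^ (-5/2)` is integrable over a set of finite measure, uniformly in `x`. -/
theorem exists_setLIntegral_rpow_le {Ω : Set E} (hΩ : volume Ω ≠ ⊤) :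
    ∃ C : ℝ≥0∞, C ≠ ⊤ ∧ ∀ x : E, ∫⁻ y in Ω, (1 + ‖x - y‖ₑ ^ (-(5 / 2) : ℝ)) ≤ C := by
  refine ⟨2 * volume Ω + ∫⁻ x in ball (0 : E) 1, ‖x‖ₑ ^ (-(5 / 2) : ℝ), ?_, fun x => ?_⟩
  · have := lintegral_ball_norm_rpow_ne_top
    finiteness
  set F : E → ℝ≥0∞ := (ball (0 : E) 1).indicator fun x => ‖x‖ₑ ^ (-(5 / 2) : ℝ) with hF
  have hFm : Measurable F := Measurable.indicator (by fun_prop) measurableSet_ball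
  have hle : ∀ y : E, 1 + ‖x - y‖ₑ ^ (-(5 / 2) : ℝ) ≤ 2 + F (x - y) := by
    intro y
    by_cases h : x - y ∈ ball (0 : E) 1
    · rw [hF, indicator_of_mem h]
      gcongr
      norm_num
    · rw [hF, indicator_of_notMem h, add_zero]
      have h1 : (1 : ℝ≥0∞) ≤ ‖x - y‖ₑ := by
        rw [← ofReal_norm, ENNReal.one_le_ofReal]
        simpa using h
      calc _ ≤ (1 : ℝ≥0∞) + 1 := by
            gcongr
            exact ENNReal.rpow_le_one_of_one_le_of_neg h1 (by norm_num)
        _ = 2 := by norm_num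
  calc _ ≤ ∫⁻ y in Ω, (2 + F (x - y)) := lintegral_mono fun y => hle y
    _ = 2 * volume Ω + ∫⁻ y in Ω, F (x - y) := by
        rw [lintegral_add_left measurable_const, setLIntegral_const]
    _ ≤ 2 * volume Ω + ∫⁻ y, F (x - y) := by
        gcongr
        exact Measure.restrict_le_self
    _ = _ := by
        rw [lintegral_sub_left_eq_self F x, hF, lintegral_indicator measurableSet_ball]

/-- The composition of the kernels `|x - y| ^ (-b)` and `|y - z|⁻²` over a set of finite measure is
less singular than the first of them by half a power. -/
theorem exists_setLIntegral_kernel_comp_le {Ω : Set E} (hΩ : volume Ω ≠ ⊤) :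
    ∃ C : ℝ≥0∞, C ≠ ⊤ ∧ ∀ b : ℝ, 1 / 2 ≤ b → b ≤ 2 → ∀ x z : E,
      ∫⁻ y in Ω, ‖x - y‖ₑ ^ (-b) * ‖y - z‖ₑ ^ (-2 : ℝ) ≤ C * ‖x - z‖ₑ ^ (-(b - 1 / 2)) := by
  obtain ⟨C, hC, hCle⟩ := exists_setLIntegral_rpow_le hΩ
  refine ⟨4 * (2 * C), by finiteness, fun b hb1 hb2 x z => ?_⟩
  have hpt : ∀ y : E, ‖x - y‖ₑ ^ (-b) * ‖y - z‖ₑ ^ (-2 : ℝ) ≤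
      4 * ‖x - z‖ₑ ^ (-(b - 1 / 2)) *
        (‖x - y‖ₑ ^ (-(5 / 2) : ℝ) + ‖y - z‖ₑ ^ (-(5 / 2) : ℝ)) := by
    intro y
    have hD : ‖x - z‖ₑ ≤ ‖x - y‖ₑ + ‖y - z‖ₑ := by
      rw [← sub_add_sub_cancel x y z]
      exact enorm_add_le _ _
    refine (rpow_neg_mul_rpow_neg_le (p := b) (q := 2) (e := b - 1 / 2) (c := 5 / 2)
      (by finiteness) (by finiteness) hD (by linarith) (by linarith) (by linarith) (by norm_num)
      (by linarith)).trans ?_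
    gcongr
    calc (2 : ℝ≥0∞) ^ (b - 1 / 2) ≤ 2 ^ (2 : ℝ) :=
          ENNReal.rpow_le_rpow_of_exponent_le (by norm_num) (by linarith)
      _ = 4 := by norm_num
  have hm1 : Measurable fun y : E => ‖x - y‖ₑ ^ (-(5 / 2) : ℝ) := by fun_prop
  have hm2 : Measurable fun y : E => ‖y - z‖ₑ ^ (-(5 / 2) : ℝ) := by fun_prop
  calc _ ≤ ∫⁻ y in Ω, (4 * ‖x - z‖ₑ ^ (-(b - 1 / 2))) *
        (‖x - y‖ₑ ^ (-(5 / 2) : ℝ) + ‖y - z‖ₑ ^ (-(5 / 2) : ℝ)) :=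
        lintegral_mono fun y => hpt y
    _ = (4 * ‖x - z‖ₑ ^ (-(b - 1 / 2))) * ((∫⁻ y in Ω, ‖x - y‖ₑ ^ (-(5 / 2) : ℝ)) +
        ∫⁻ y in Ω, ‖y - z‖ₑ ^ (-(5 / 2) : ℝ)) := by
        have hm3 : Measurable fun y : E =>
            ‖x - y‖ₑ ^ (-(5 / 2) : ℝ) + ‖y - z‖ₑ ^ (-(5 / 2) : ℝ) := hm1.add hm2
        rw [lintegral_const_mul _ hm3, lintegral_add_left hm1]
    _ ≤ (4 * ‖x - z‖ₑ ^ (-(b - 1 / 2))) * (C + C) := by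
        gcongr
        · exact (lintegral_mono fun y => le_add_self).trans (hCle x)
        · refine le_trans (lintegral_mono fun y => ?_) (hCle z)
          rw [← enorm_neg, neg_sub]
          exact le_add_self
    _ = _ := by ring

/-- One step of the bootstrap: the potential of exponent `b` of a subsolution `u` is controlled by
the potential of exponent `b - 1/2`. -/
theorem exists_potential_le {Ω : Set E} (hΩ : volume Ω ≠ ⊤) {A B : ℝ≥0∞}
    (hA : A ≠ ⊤) (hB : B ≠ ⊤) : ∃ C : ℝ≥0∞, C ≠ ⊤ ∧ ∀ u : E → ℝ≥0∞, Measurable u →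
    (∀ x ∉ Ω, u x = 0) →
    (∀ᵐ x ∂(volume.restrict Ω), u x ≤ A + B * ∫⁻ y, ‖x - y‖ₑ ^ (-2 : ℝ) * u y) →
    ∀ b : ℝ, 1 / 2 ≤ b → b ≤ 2 → ∀ x : E,
      ∫⁻ y, ‖x - y‖ₑ ^ (-b) * u y ≤ C * (1 + ∫⁻ y, ‖x - y‖ₑ ^ (-(b - 1 / 2)) * u y) := by
  obtain ⟨C, hC, hCle⟩ := exists_setLIntegral_rpow_le hΩ
  obtain ⟨C', hC', hcomp⟩ := exists_setLIntegral_kernel_comp_le hΩ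
  refine ⟨A * C + B * C', by finiteness, fun u hu hu0 hle b hb1 hb2 x => ?_⟩
  have hrw : ∫⁻ y, ‖x - y‖ₑ ^ (-b) * u y = ∫⁻ y in Ω, ‖x - y‖ₑ ^ (-b) * u y := by
    symm
    refine setLIntegral_eq_of_support_subset fun y hy => ?_
    by_contra h
    exact hy (by simp [hu0 y h])
  have hpow : ∀ y : E, ‖x - y‖ₑ ^ (-b) ≤ 1 + ‖x - y‖ₑ ^ (-(5 / 2) : ℝ) := by
    intro y
    rcases le_or_gt 1 ‖x - y‖ₑ with h | h
    · exact (ENNReal.rpow_le_one_of_one_le_of_neg h (by linarith)).trans le_self_add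
    · exact (ENNReal.rpow_le_rpow_of_exponent_ge h.le (by linarith)).trans le_add_self
  have hm1 : Measurable fun z : E × E => ‖z.1 - z.2‖ₑ ^ (-2 : ℝ) := by fun_prop
  have hm2 : Measurable fun z : E × E => ‖z.1 - z.2‖ₑ ^ (-2 : ℝ) * u z.2 :=
    hm1.mul (hu.comp measurable_snd)
  have hml : ∀ y, Measurable fun z : E => ‖y - z‖ₑ ^ (-2 : ℝ) := fun y => by fun_prop
  have hmr : ∀ z, Measurable fun y : E => ‖y - z‖ₑ ^ (-2 : ℝ) := fun z => by fun_prop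
  have hmb : Measurable fun y : E => ‖x - y‖ₑ ^ (-b) := by fun_prop
  have hm3 : Measurable (Function.uncurry fun y z : E =>
      ‖x - y‖ₑ ^ (-b) * (‖y - z‖ₑ ^ (-2 : ℝ) * u z)) :=
    (hmb.comp measurable_fst).mul hm2
  have hswap : ∫⁻ y in Ω, ‖x - y‖ₑ ^ (-b) * ∫⁻ z, ‖y - z‖ₑ ^ (-2 : ℝ) * u z =
      ∫⁻ z, ∫⁻ y in Ω, ‖x - y‖ₑ ^ (-b) * (‖y - z‖ₑ ^ (-2 : ℝ) * u z) := by
    refine Eq.trans ?_ (lintegral_lintegral_swap (μ := volume.restrict Ω) hm3.aemeasurable)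
    refine lintegral_congr fun y => ?_
    have h : Measurable fun z : E => ‖y - z‖ₑ ^ (-2 : ℝ) * u z :=
      (hml y).mul hu
    rw [lintegral_const_mul _ h]
  have hin : ∀ z, ∫⁻ y in Ω, ‖x - y‖ₑ ^ (-b) * (‖y - z‖ₑ ^ (-2 : ℝ) * u z) ≤
      C' * (‖x - z‖ₑ ^ (-(b - 1 / 2)) * u z) := by
    intro z
    have h : Measurable fun y : E => ‖x - y‖ₑ ^ (-b) * ‖y - z‖ₑ ^ (-2 : ℝ) :=
      hmb.mul (hmr z)
    simp_rw [← mul_assoc]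
    rw [lintegral_mul_const _ h]
    gcongr
    exact hcomp b hb1 hb2 x z
  have hC1 : ∫⁻ y in Ω, ‖x - y‖ₑ ^ (-b) ≤ C := (lintegral_mono fun y => hpow y).trans (hCle x)
  calc _ = ∫⁻ y in Ω, ‖x - y‖ₑ ^ (-b) * u y := hrw
    _ ≤ ∫⁻ y in Ω, (‖x - y‖ₑ ^ (-b) * A +
        B * (‖x - y‖ₑ ^ (-b) * ∫⁻ z, ‖y - z‖ₑ ^ (-2 : ℝ) * u z)) := by
        refine lintegral_mono_ae ?_
        filter_upwards [hle] with y hy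
        calc _ ≤ ‖x - y‖ₑ ^ (-b) * (A + B * ∫⁻ z, ‖y - z‖ₑ ^ (-2 : ℝ) * u z) := by gcongr
          _ = _ := by ring
    _ = (∫⁻ y in Ω, ‖x - y‖ₑ ^ (-b)) * A +
        B * ∫⁻ y in Ω, ‖x - y‖ₑ ^ (-b) * ∫⁻ z, ‖y - z‖ₑ ^ (-2 : ℝ) * u z := by
        rw [lintegral_add_left (hmb.mul_const _), lintegral_mul_const _ hmb,
          lintegral_const_mul' _ _ hB]
    _ ≤ C * A + B * ∫⁻ z, C' * (‖x - z‖ₑ ^ (-(b - 1 / 2)) * u z) := by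
        rw [hswap]
        gcongr with z
        exact hin z
    _ = A * C + B * C' * ∫⁻ z, ‖x - z‖ₑ ^ (-(b - 1 / 2)) * u z := by
        rw [lintegral_const_mul' _ _ hC', mul_comm C, mul_assoc B]
    _ ≤ _ := by
        rw [mul_add, mul_one]
        gcongr
        · exact le_self_add
        · exact le_add_self

/-- An integrable function on a set of finite measure that is dominated by a constant and its
Riesz potential with kernel `|x - y|⁻²` is essentially bounded. Four steps of
`exists_potential_le` lead from the integral of `u` to the potential. -/
theorem exists_ae_le_of_le_potential {Ω : Set E} (hΩ : volume Ω ≠ ⊤) {A B : ℝ≥0∞}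
    (hA : A ≠ ⊤) (hB : B ≠ ⊤) {u : E → ℝ≥0∞} (hu : Measurable u) (hu0 : ∀ x ∉ Ω, u x = 0)
    (hint : ∫⁻ x, u x ≠ ⊤)
    (hle : ∀ᵐ x ∂(volume.restrict Ω), u x ≤ A + B * ∫⁻ y, ‖x - y‖ₑ ^ (-2 : ℝ) * u y) :
    ∃ C : ℝ≥0∞, C ≠ ⊤ ∧ ∀ᵐ x ∂(volume.restrict Ω), u x ≤ C := by
  obtain ⟨C, hC, hstep⟩ := exists_potential_le hΩ hA hB
  have hstep' := hstep u hu hu0 hle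
  have step : ∀ (b : ℝ) (N : ℝ≥0∞), 1 / 2 ≤ b → b ≤ 2 → N ≠ ⊤ →
      (∀ x, ∫⁻ y, ‖x - y‖ₑ ^ (-(b - 1 / 2)) * u y ≤ N) →
      ∃ N' : ℝ≥0∞, N' ≠ ⊤ ∧ ∀ x, ∫⁻ y, ‖x - y‖ₑ ^ (-b) * u y ≤ N' := by
    intro b N h1 h2 hN h
    refine ⟨C * (1 + N), by finiteness, fun x => (hstep' b h1 h2 x).trans ?_⟩
    gcongr
    exact h x
  obtain ⟨N₁, hN₁, h₁⟩ := step (1 / 2) (∫⁻ x, u x) le_rfl (by norm_num) hint (by simp)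
  obtain ⟨N₂, hN₂, h₂⟩ := step 1 N₁ (by norm_num) (by norm_num) hN₁ (by norm_num at h₁ ⊢; exact h₁)
  obtain ⟨N₃, hN₃, h₃⟩ := step (3 / 2) N₂ (by norm_num) (by norm_num) hN₂
    (by norm_num at h₂ ⊢; exact h₂)
  obtain ⟨N₄, hN₄, h₄⟩ := step 2 N₃ (by norm_num) (by norm_num) hN₃ (by norm_num at h₃ ⊢; exact h₃)
  refine ⟨A + B * N₄, by finiteness, ?_⟩
  filter_upwards [hle] with x hx
  refine hx.trans ?_
  gcongr
  exact h₄ x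

/-! ### Averages along straight lines -/

theorem lintegral_Ioi_comp_mul_right (h : ℝ → ℝ≥0∞) {r : ℝ} (hr : 0 < r) :
    ENNReal.ofReal r * ∫⁻ s in Ioi (0 : ℝ), h (s * r) = ∫⁻ s in Ioi (0 : ℝ), h s := by
  have himg : (fun s => s * r) '' Ioi (0 : ℝ) = Ioi 0 := by
    ext x
    simp only [mem_image, mem_Ioi]
    exact ⟨fun ⟨s, hs, hx⟩ => hx ▸ mul_pos hs hr, fun hx => ⟨x / r, div_pos hx hr, by field_simp⟩⟩
  have hinj : InjOn (fun s : ℝ => s * r) (Ioi 0) := fun a _ b _ hab => mul_right_cancel₀ hr.ne' hab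
  have hd : ∀ s ∈ Ioi (0 : ℝ), HasDerivWithinAt (fun s => s * r) r (Ioi 0) s := fun s _ => by
    simpa using ((hasDerivAt_id s).mul_const r).hasDerivWithinAt
  have h2 := lintegral_image_eq_lintegral_abs_deriv_mul measurableSet_Ioi hd hinj h
  rw [himg, abs_of_pos hr, lintegral_const_mul' _ _ ENNReal.ofReal_ne_top] at h2
  exact h2.symm

theorem lintegral_mul_rpow_ne_top (γ : ℝ) (h1 : γ < 1) :
    ∫⁻ r in Ioi (0 : ℝ), ENNReal.ofReal (r * (1 + r) ^ (γ - 3)) ≠ ⊤ := by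
  have hi : Integrable fun r : ℝ => (1 + ‖r‖) ^ (-(2 - γ)) :=
    integrable_one_add_norm (by simp; linarith)
  refine ne_top_of_le_ne_top hi.lintegral_lt_top.ne ?_
  rw [← lintegral_indicator measurableSet_Ioi]
  refine lintegral_mono fun r => ?_
  by_cases hr : 0 < r
  · rw [indicator_of_mem (show r ∈ Ioi 0 from hr)]
    refine ENNReal.ofReal_le_ofReal ?_
    have hp : 0 < 1 + r := by linarith
    rw [Real.norm_of_nonneg hr.le]
    calc r * (1 + r) ^ (γ - 3) ≤ (1 + r) * (1 + r) ^ (γ - 3) := by gcongr; linarith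
      _ = (1 + r) ^ (-(2 - γ)) := by
          rw [← Real.rpow_one_add' hp.le (by linarith)]
          congr 1
          ring
  · rw [indicator_of_notMem (show r ∉ Ioi 0 from hr)]
    exact bot_le

/-- Averaging the integrals of `u` along the rays from `x` over the velocities produces a Riesz
potential of `u`. The weight is integrable in the modulus of the velocity because `γ < 1`. -/
theorem exists_lintegral_rays_le (γ : ℝ) (h1 : γ < 1) : ∃ C : ℝ≥0∞, C ≠ ⊤ ∧
    ∀ u : E → ℝ≥0∞, Measurable u → ∀ x : E,
    ∫⁻ ζ : E, ENNReal.ofReal ((1 + ‖ζ‖) ^ (γ - 3)) * ∫⁻ s in Ioi (0 : ℝ), u (x - s • ζ) ≤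
      C * ∫⁻ y, ‖x - y‖ₑ ^ (-2 : ℝ) * u y := by
  set C : ℝ≥0∞ := ∫⁻ r in Ioi (0 : ℝ), ENNReal.ofReal (r * (1 + r) ^ (γ - 3)) with hC
  refine ⟨C, lintegral_mul_rpow_ne_top γ h1, fun u hu x => le_of_eq ?_⟩
  have hm1 : Measurable fun z : E × ℝ => u (x - z.2 • z.1) := hu.comp (by fun_prop)
  have hm2 : Measurable fun ζ : E => ∫⁻ s in Ioi (0 : ℝ), u (x - s • ζ) :=
    hm1.lintegral_prod_right'
  have hm3 : Measurable fun y : E => ‖y‖ₑ ^ (-2 : ℝ) * u (x - y) := by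
    have : Measurable fun y : E => u (x - y) := hu.comp (by fun_prop)
    fun_prop
  have hray : ∀ ω : S2, ∫⁻ r in Ioi (0 : ℝ), ENNReal.ofReal (r ^ 2) *
      (ENNReal.ofReal ((1 + ‖r • (ω : E)‖) ^ (γ - 3)) *
        ∫⁻ s in Ioi (0 : ℝ), u (x - s • r • (ω : E))) =
      C * ∫⁻ s in Ioi (0 : ℝ), u (x - s • (ω : E)) := by
    intro ω
    rw [hC, ← lintegral_mul_const _ (by fun_prop)]
    refine setLIntegral_congr_fun measurableSet_Ioi fun r hr => ?_
    have hr' : 0 < r := hr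
    have hn : ‖r • (ω : E)‖ = r := by simp [norm_smul, abs_of_pos hr']
    rw [← lintegral_Ioi_comp_mul_right (fun s => u (x - s • (ω : E))) hr']
    simp only [smul_smul, hn]
    rw [← mul_assoc, ← mul_assoc, ← ENNReal.ofReal_mul (by positivity),
      ← ENNReal.ofReal_mul (by positivity)]
    congr 2
    ring
  have hpot : ∀ ω : S2, ∫⁻ s in Ioi (0 : ℝ), u (x - s • (ω : E)) =
      ∫⁻ r in Ioi (0 : ℝ), ENNReal.ofReal (r ^ 2) *
        (‖r • (ω : E)‖ₑ ^ (-2 : ℝ) * u (x - r • (ω : E))) := by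
    intro ω
    refine setLIntegral_congr_fun measurableSet_Ioi fun r hr => ?_
    have hr' : 0 < r := hr
    have hn : ‖r • (ω : E)‖ = r := by simp [norm_smul, abs_of_pos hr']
    rw [← ofReal_norm, hn, ENNReal.ofReal_rpow_of_pos hr', ← mul_assoc,
      ← ENNReal.ofReal_mul (by positivity), ← Real.rpow_natCast, ← Real.rpow_add hr']
    norm_num
  rw [lintegral_eq_lintegral_polar (by fun_prop)]
  simp_rw [hray]
  rw [lintegral_const_mul' _ _ (lintegral_mul_rpow_ne_top γ h1)]
  simp_rw [hpot]
  rw [← lintegral_eq_lintegral_polar hm3,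
    ← lintegral_sub_left_eq_self (fun y => ‖x - y‖ₑ ^ (-2 : ℝ) * u y) x]
  simp [hC]

/-- Almost every line avoids a given null set up to a null set of parameters. -/
theorem ae_ae_line_notMem {N : Set E} (hN : MeasurableSet N) (h0 : volume N = 0) (Ω : Set E) :
    ∀ᵐ z : E × E ∂((volume.restrict Ω).prod volume),
      ∀ᵐ s : ℝ ∂(volume.restrict (Ioi 0)), z.1 - s • z.2 ∉ N := by
  have hm : MeasurableSet {q : (E × E) × ℝ | q.1.1 - q.2 • q.1.2 ∉ N} :=
    (hN.preimage (by fun_prop : Measurable fun q : (E × E) × ℝ => q.1.1 - q.2 • q.1.2)).compl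
  rw [Measure.ae_ae_comm hm]
  refine ae_of_all _ fun s => ?_
  have hm2 : MeasurableSet {z : E × E | z.1 - s • z.2 ∉ N} :=
    (hN.preimage (by fun_prop : Measurable fun z : E × E => z.1 - s • z.2)).compl
  rw [Measure.ae_prod_iff_ae_ae hm2, Measure.ae_ae_comm hm2]
  refine ae_of_all _ fun ζ => ae_restrict_of_ae ?_
  have h := (measurePreserving_sub_right (volume : Measure E) (s • ζ)).quasiMeasurePreserving
  exact h.ae (p := fun y => y ∉ N) (by rw [ae_iff]; simpa using h0)

/-! ### Backward trajectories -/

section Geometry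

variable {Ω : Set E}

theorem backTime_set_nonempty (hΩ : IsC1ConvexDomain Ω) (x : E) {ζ : E} (hζ : ζ ≠ 0) :
    {s : ℝ | 0 < s ∧ x - s • ζ ∉ Ω}.Nonempty := by
  obtain ⟨R, hR⟩ := hΩ.bounded.subset_closedBall x
  have hz : 0 < ‖ζ‖ := norm_pos_iff.2 hζ
  refine ⟨(|R| + 1) / ‖ζ‖, by positivity, fun h => ?_⟩
  have h2 := hR h
  rw [mem_closedBall, dist_eq_norm, sub_sub_cancel_left, norm_neg, norm_smul,
    Real.norm_of_nonneg (by positivity), div_mul_cancel₀ _ hz.ne'] at h2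
  linarith [le_abs_self R]

theorem mem_of_lt_backTime {x ζ : E} {s : ℝ} (hs : 0 < s) (hlt : s < backTime Ω x ζ) :
    x - s • ζ ∈ Ω := by
  by_contra h
  exact (not_le.2 hlt) (csInf_le ⟨0, fun t ht => ht.1.le⟩ ⟨hs, h⟩)

theorem backTime_nonneg (x ζ : E) : 0 ≤ backTime Ω x ζ :=
  Real.sInf_nonneg fun _ ht => ht.1.le

theorem backPoint_notMem (hΩ : IsC1ConvexDomain Ω) {x ζ : E} (hζ : ζ ≠ 0) :
    backPoint Ω x ζ ∉ Ω := by
  intro h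
  set τ := backTime Ω x ζ with hτ
  have hcont : Continuous fun s : ℝ => x - s • ζ := by fun_prop
  have hnhds : ∀ᶠ s in 𝓝 τ, x - s • ζ ∈ Ω := hcont.continuousAt (hΩ.isOpen.mem_nhds h)
  obtain ⟨δ, hδ, hball⟩ := Metric.eventually_nhds_iff.1 hnhds
  have hle : τ + δ ≤ τ := by
    refine le_csInf (backTime_set_nonempty hΩ x hζ) fun s hs => ?_
    by_contra hlt
    rcases lt_or_ge s τ with h1 | h1
    · exact hs.2 (mem_of_lt_backTime hs.1 h1)
    · refine hs.2 (hball ?_)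
      rw [Real.dist_eq, abs_of_nonneg (by linarith)]
      linarith
  linarith

theorem backTime_pos (hΩ : IsC1ConvexDomain Ω) {x ζ : E} (hx : x ∈ Ω) (hζ : ζ ≠ 0) :
    0 < backTime Ω x ζ := by
  refine (backTime_nonneg x ζ).lt_of_ne fun h => backPoint_notMem hΩ (x := x) hζ ?_
  rw [backPoint, ← h, zero_smul, sub_zero]
  exact hx

theorem backPoint_mem_frontier (hΩ : IsC1ConvexDomain Ω) {x ζ : E} (hx : x ∈ Ω) (hζ : ζ ≠ 0) :
    backPoint Ω x ζ ∈ frontier Ω := by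
  rw [frontier, hΩ.isOpen.interior_eq]
  refine ⟨?_, backPoint_notMem hΩ hζ⟩
  have hcont : Continuous fun s : ℝ => x - s • ζ := by fun_prop
  have ht : Tendsto (fun s : ℝ => x - s • ζ) (𝓝[<] (backTime Ω x ζ)) (𝓝 (backPoint Ω x ζ)) :=
    hcont.continuousAt.tendsto.mono_left nhdsWithin_le_nhds
  refine mem_closure_of_tendsto ht ?_
  filter_upwards [Ioo_mem_nhdsLT (backTime_pos hΩ hx hζ)] with s hs
  exact mem_of_lt_backTime hs.1 hs.2

/-- A convex domain lies on the inner side of its tangent planes. -/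
theorem inner_gradient_le_zero (hΩ : IsC1ConvexDomain Ω) {X : E} (hX : X ∈ frontier Ω) {ρ : E → ℝ}
    (hρ : IsC1DefiningAt Ω X ρ) {y : E} (hy : y ∈ Ω) : ⟪gradient ρ X, y - X⟫_ℝ ≤ 0 := by
  obtain ⟨hc, h0, -, hev⟩ := hρ
  have hg : HasFDerivAt ρ (InnerProductSpace.toDual ℝ E (gradient ρ X)) X :=
    (hc.differentiableAt (by simp)).hasGradientAt.hasFDerivAt
  have hline : HasDerivAt (fun t : ℝ => X + t • (y - X)) (y - X) 0 := by
    simpa using ((hasDerivAt_id (0 : ℝ)).smul_const (y - X)).const_add X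
  have hg' : HasFDerivAt ρ (InnerProductSpace.toDual ℝ E (gradient ρ X))
      (X + (0 : ℝ) • (y - X)) := by simpa using hg
  have hd : HasDerivAt (fun t : ℝ => ρ (X + t • (y - X))) ⟪gradient ρ X, y - X⟫_ℝ 0 := by
    have h := hg'.comp_hasDerivAt (0 : ℝ) hline
    rw [InnerProductSpace.toDual_apply_apply] at h
    exact h
  have hslope := (hasDerivAt_iff_tendsto_slope.1 hd).mono_left
    (nhdsWithin_mono (0 : ℝ) (show Ioi (0 : ℝ) ⊆ {0}ᶜ from fun t ht => ne_of_gt ht))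
  refine le_of_tendsto hslope ?_
  have hcont : Tendsto (fun t : ℝ => X + t • (y - X)) (𝓝[>] 0) (𝓝 X) := by
    have : Continuous fun t : ℝ => X + t • (y - X) := by fun_prop
    simpa using (this.tendsto 0).mono_left nhdsWithin_le_nhds
  filter_upwards [hcont.eventually hev, Ioo_mem_nhdsGT (zero_lt_one' ℝ)] with t ht ht01
  have hin : X + t • (y - X) ∈ Ω := by
    have h := hΩ.convex.openSegment_closure_interior_subset_interior
      (frontier_subset_closure hX) (hΩ.isOpen.interior_eq.symm ▸ hy : y ∈ interior Ω)
    refine interior_subset (h ⟨1 - t, t, by linarith [ht01.2], ht01.1, by ring, ?_⟩)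
    module
  rw [slope_def_field]
  simp only [zero_smul, add_zero, h0, sub_zero]
  exact div_nonpos_of_nonpos_of_nonneg (ht.1 hin).le ht01.1.le

/-- A backward trajectory from an interior point of a convex domain leaves it transversally. -/
theorem backPoint_mem_incoming (hΩ : IsC1ConvexDomain Ω) {x ζ : E} (hx : x ∈ Ω) (hζ : ζ ≠ 0) :
    (backPoint Ω x ζ, ζ) ∈ incoming Ω := by
  have hX := backPoint_mem_frontier hΩ hx hζ
  obtain ⟨ρ, hρ⟩ := hΩ.boundary _ hX
  refine ⟨hX, _, ⟨ρ, hρ, rfl⟩, ?_⟩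
  set X := backPoint Ω x ζ with hXdef
  set v := gradient ρ X with hv
  have hv0 : v ≠ 0 := hρ.2.2.1
  have hvp : 0 < ‖v‖ := norm_pos_iff.2 hv0
  have hτ := backTime_pos hΩ hx hζ
  -- the inequality of `inner_gradient_le_zero` at a point slightly displaced in the direction `v`
  have hev : ∀ᶠ t : ℝ in 𝓝[>] 0, x + t • v ∈ Ω := by
    have hcont : Continuous fun t : ℝ => x + t • v := by fun_prop
    have h : Tendsto (fun t : ℝ => x + t • v) (𝓝[>] 0) (𝓝 x) := by
      simpa using (hcont.tendsto 0).mono_left nhdsWithin_le_nhds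
    exact h.eventually (hΩ.isOpen.mem_nhds hx)
  obtain ⟨t, htΩ, ht0⟩ := (hev.and self_mem_nhdsWithin).exists
  have ht0' : 0 < t := ht0
  have hle := inner_gradient_le_zero hΩ hX hρ htΩ
  have hxX : x + t • v - X = backTime Ω x ζ • ζ + t • v := by
    rw [hXdef, backPoint]; abel
  rw [hxX, inner_add_right, real_inner_smul_right, real_inner_smul_right,
    real_inner_self_eq_norm_sq] at hle
  have hneg : ⟪v, ζ⟫_ℝ < 0 := by
    by_contra h
    have h1 : 0 ≤ backTime Ω x ζ * ⟪v, ζ⟫_ℝ := mul_nonneg hτ.le (not_lt.1 h)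
    have h2 : 0 < t * ‖v‖ ^ 2 := by positivity
    linarith
  change ⟪ζ, ‖v‖⁻¹ • v⟫_ℝ < 0
  rw [real_inner_smul_right, real_inner_comm]
  exact mul_neg_of_pos_of_neg (by positivity) hneg

end Geometry

/-! ### Boundary data -/

theorem eLpNorm_two_sq {α : Type*} [MeasurableSpace α] (μ : Measure α) (g : α → ℝ) :
    eLpNorm g 2 μ ^ 2 = ∫⁻ a, ‖g a‖ₑ ^ 2 ∂μ := by
  rw [eLpNorm_eq_lintegral_rpow_enorm_toReal (by norm_num) (by norm_num), ← ENNReal.rpow_natCast,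
    ← ENNReal.rpow_mul]
  simp

/-- The measure `ν dζ` dominates a multiple of Lebesgue measure. -/
theorem exists_smul_volume_le_nuMeasure {γ : ℝ} {β : ℝ → ℝ} (hB : IsCutoffCrossSection γ β) :
    ∃ c : ℝ≥0∞, c ≠ 0 ∧ c ≠ ⊤ ∧
      ∀ s, MeasurableSet s → c * volume s ≤ nuMeasure γ β s := by
  obtain ⟨c, hc, hle⟩ := exists_le_nu hB
  have hnu : ∀ ζ, ENNReal.ofReal c ≤ ENNReal.ofReal (nu γ β ζ) := by
    intro ζ
    refine ENNReal.ofReal_le_ofReal (le_trans ?_ (hle ζ))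
    exact le_mul_of_one_le_right hc.le
      (Real.one_le_rpow (by linarith [norm_nonneg ζ]) hB.gamma_nonneg)
  refine ⟨ENNReal.ofReal c, by simpa using hc, by finiteness, fun s hs => ?_⟩
  rw [nuMeasure, withDensity_apply _ hs, ← setLIntegral_const]
  exact lintegral_mono fun ζ => hnu ζ

theorem volume_absolutelyContinuous_nuMeasure {γ : ℝ} {β : ℝ → ℝ}
    (hB : IsCutoffCrossSection γ β) : (volume : Measure E) ≪ nuMeasure γ β := by
  obtain ⟨c, hc0, hct, hle⟩ := exists_smul_volume_le_nuMeasure hB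
  refine Measure.AbsolutelyContinuous.mk fun s hs h0 => ?_
  have h := hle s hs
  rw [h0] at h
  exact (mul_eq_zero.1 (le_antisymm h bot_le)).resolve_left hc0

/-- Incoming data that are dominated by a function in `L^*_ζ` and have a global modulus of
continuity are bounded: if `|f(X, η)|` is large, then so is the dominating function on a ball of
fixed radius consisting of incoming velocities near `η`. -/
theorem exists_enorm_incoming_le {γ : ℝ} {β : ℝ → ℝ} (hB : IsCutoffCrossSection γ β) {Ω : Set E}
    {f : E → E → ℝ} {φ : E → ℝ} (hφ : MemLStarV γ β φ)
    (hle : ∀ X η : E, (X, η) ∈ incoming Ω → |f X η| ≤ φ η) {σ M : ℝ} (hσ : 0 < σ) (hM : 0 < M)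
    (hcont : ∀ X η Y ω : E, (X, η) ∈ incoming Ω → (Y, ω) ∈ incoming Ω →
      |f X η - f Y ω| ≤ M * (‖η - ω‖ ^ 2 + ‖X - Y‖ ^ 2) ^ (σ / 2)) :
    ∃ C : ℝ≥0∞, C ≠ ⊤ ∧ ∀ X η : E, (X, η) ∈ incoming Ω → ‖f X η‖ₑ ≤ C := by
  obtain ⟨c, hc0, hct, hc⟩ := exists_smul_volume_le_nuMeasure hB
  set κ : ℝ≥0∞ := c * volume (ball (0 : E) (1 / 2)) with hκ
  have hκ0 : κ ≠ 0 := mul_ne_zero hc0 (measure_ball_pos _ _ (by norm_num)).ne'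
  have hκt : κ ≠ ⊤ := ENNReal.mul_ne_top hct measure_ball_lt_top.ne
  set N : ℝ≥0∞ := ∫⁻ ζ, ‖φ ζ‖ₑ ^ 2 ∂(nuMeasure γ β) with hN
  have hNt : N ≠ ⊤ := by
    rw [hN, ← eLpNorm_two_sq]
    have := hφ.eLpNorm_lt_top.ne
    finiteness
  refine ⟨ENNReal.ofReal M + (1 + N / κ), ?_, fun X η hXη => ?_⟩
  · have : N / κ ≠ ⊤ := ENNReal.div_ne_top hNt hκ0
    finiteness
  obtain ⟨hX, n, hn, hneg⟩ := hXη
  have hn1 : ‖n‖ = 1 := by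
    obtain ⟨ρ, hρ, rfl⟩ := hn
    have h0 : ‖gradient ρ X‖ ≠ 0 := norm_ne_zero_iff.2 hρ.2.2.1
    rw [norm_smul, norm_inv, norm_norm, inv_mul_cancel₀ h0]
  set t : ℝ := |f X η| - M with ht
  -- the ball of velocities `η - n / 2 + v`, `|v| < 1 / 2`, lies in the incoming half space
  have hball : ∀ η' ∈ ball (η - (1 / 2 : ℝ) • n) (1 / 2), ENNReal.ofReal t ≤ ‖φ η'‖ₑ := by
    intro η' hη'
    rw [mem_ball, dist_eq_norm] at hη'
    set v := η' - (η - (1 / 2 : ℝ) • n) with hv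
    have hη'eq : η' = η - (1 / 2 : ℝ) • n + v := by rw [hv]; abel
    have hvn : ⟪v, n⟫_ℝ ≤ ‖v‖ := by
      have := real_inner_le_norm v n
      rwa [hn1, mul_one] at this
    have hin : (X, η') ∈ incoming Ω := by
      refine ⟨hX, n, hn, ?_⟩
      change ⟪η', n⟫_ℝ < 0
      rw [hη'eq, inner_add_left, inner_sub_left, real_inner_smul_left, real_inner_self_eq_norm_sq,
        hn1]
      change ⟪η, n⟫_ℝ < 0 at hneg
      linarith
    have hdist : ‖η - η'‖ ≤ 1 := by
      have e : η - η' = (1 / 2 : ℝ) • n - v := by rw [hη'eq]; abel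
      rw [e]
      refine (norm_sub_le _ _).trans ?_
      rw [norm_smul, hn1]
      norm_num
      linarith
    have h1 := hcont X η X η' ⟨hX, n, hn, hneg⟩ hin
    have h2 : (‖η - η'‖ ^ 2 + ‖X - X‖ ^ 2) ^ (σ / 2) ≤ 1 := by
      rw [sub_self, norm_zero]
      refine Real.rpow_le_one (by positivity) ?_ (by positivity)
      nlinarith [norm_nonneg (η - η')]
    have h3 : M * (‖η - η'‖ ^ 2 + ‖X - X‖ ^ 2) ^ (σ / 2) ≤ M := mul_le_of_le_one_right hM.le h2
    have h4 := hle X η' hin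
    have h5 := abs_sub_abs_le_abs_sub (f X η) (f X η')
    rw [← ofReal_norm, Real.norm_eq_abs]
    refine ENNReal.ofReal_le_ofReal ?_
    linarith [le_abs_self (φ η')]
  have hsq : ENNReal.ofReal t ^ 2 * κ ≤ N := by
    calc _ = ENNReal.ofReal t ^ 2 * (c * volume (ball (η - (1 / 2 : ℝ) • n) (1 / 2))) := by
          rw [hκ]
          congr 2
          exact (Measure.addHaar_ball_center volume _ _).symm
      _ ≤ ENNReal.ofReal t ^ 2 * nuMeasure γ β (ball (η - (1 / 2 : ℝ) • n) (1 / 2)) := by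
          gcongr
          exact hc _ measurableSet_ball
      _ = ∫⁻ _ in ball (η - (1 / 2 : ℝ) • n) (1 / 2), ENNReal.ofReal t ^ 2 ∂(nuMeasure γ β) := by
          rw [setLIntegral_const]
      _ ≤ ∫⁻ η' in ball (η - (1 / 2 : ℝ) • n) (1 / 2), ‖φ η'‖ₑ ^ 2 ∂(nuMeasure γ β) := by
          refine setLIntegral_mono' measurableSet_ball fun η' hη' => ?_
          gcongr
          exact hball η' hη'
      _ ≤ N := setLIntegral_le_lintegral _ _
  have hsq' : ENNReal.ofReal t ^ 2 ≤ N / κ :=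
    (ENNReal.le_div_iff_mul_le (Or.inl hκ0) (Or.inl hκt)).2 hsq
  have ht1 : ENNReal.ofReal t ≤ 1 + N / κ := by
    rcases le_total (ENNReal.ofReal t) 1 with h | h
    · exact h.trans le_self_add
    · refine le_trans ?_ (hsq'.trans le_add_self)
      rw [sq]
      exact le_mul_of_one_le_right' h
  calc ‖f X η‖ₑ = ENNReal.ofReal (M + t) := by
        rw [← ofReal_norm, Real.norm_eq_abs, ht, add_sub_cancel]
    _ ≤ ENNReal.ofReal M + ENNReal.ofReal t := ENNReal.ofReal_add_le
    _ ≤ _ := by gcongr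

/-! ### The Duhamel formula -/

theorem lintegral_exp_neg_mul {a : ℝ} (ha : 0 < a) :
    ∫⁻ s in Ioi (0 : ℝ), ENNReal.ofReal (Real.exp (-(a * s))) = ENNReal.ofReal (1 / a) := by
  have hi : IntegrableOn (fun s : ℝ => Real.exp (-(a * s))) (Ioi 0) := by
    simpa [neg_mul] using integrableOn_exp_mul_Ioi (neg_lt_zero.2 ha) 0
  rw [← ofReal_integral_eq_lintegral_ofReal hi (ae_of_all _ fun s => (Real.exp_pos _).le)]
  have := integral_exp_mul_Ioi (neg_lt_zero.2 ha) 0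
  simp only [neg_mul, mul_zero, Real.exp_zero] at this
  rw [this]
  congr 1
  field_simp

theorem sq_lintegral_exp_mul_le {a : ℝ} (ha : 0 < a) {v : ℝ → ℝ≥0∞} (hv : Measurable v) :
    (∫⁻ s in Ioi (0 : ℝ), ENNReal.ofReal (Real.exp (-(a * s))) * v s) ^ 2 ≤
      ENNReal.ofReal (1 / a) * ∫⁻ s in Ioi (0 : ℝ), v s ^ 2 := by
  have hm : Measurable fun s : ℝ => ENNReal.ofReal (Real.exp (-(a * s))) := by fun_prop
  refine (lintegral_mul_sq_le _ hm.aemeasurable hv.aemeasurable).trans ?_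
  rw [← lintegral_exp_neg_mul ha]
  gcongr ?_ * _
  refine setLIntegral_mono' measurableSet_Ioi fun s hs => ?_
  rw [sq]
  refine mul_le_of_le_one_left' ?_
  rw [ENNReal.ofReal_le_one, Real.exp_le_one_iff]
  have : 0 ≤ a * s := mul_nonneg ha.le (le_of_lt hs)
  linarith

/-- A slice-wise version of `MemLStarXV`. As `f(y, ·)` need not be measurable for every `y`, its
mass `u` is that of a measurable majorant which equals `|f|` almost everywhere. -/
theorem exists_measurable_slice_mass {γ : ℝ} {β : ℝ → ℝ} {Ω : Set E} (hΩ : MeasurableSet Ω)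
    {f : E → E → ℝ} (hf : MemLStarXV γ β Ω f) :
    ∃ u : E → ℝ≥0∞, Measurable u ∧ (∀ x ∉ Ω, u x = 0) ∧ ∫⁻ x, u x ≠ ⊤ ∧
      (∀ᵐ y ∂(volume.restrict Ω), u y = ∫⁻ η, ‖f y η‖ₑ ^ 2 ∂(nuMeasure γ β)) ∧
      ∀ y ∈ Ω, ∃ G : E → ℝ≥0∞, Measurable G ∧ (∀ η, ‖f y η‖ₑ ≤ G η) ∧
        ∫⁻ η, G η ^ 2 ∂(nuMeasure γ β) = u y := by
  classical
  have : SFinite (nuMeasure γ β) := by unfold nuMeasure; infer_instance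
  set μ := nuMeasure γ β with hμ
  obtain ⟨hfm, hfn⟩ := hf
  set F := Function.uncurry f with hF
  -- off the measurable null set `N`, the function `f` agrees with its measurable representative
  set N := toMeasurable ((volume.restrict Ω).prod μ) {z | F z ≠ hfm.mk F z} with hN
  have hN0 : ((volume.restrict Ω).prod μ) N = 0 := by
    rw [hN, measure_toMeasurable]
    exact hfm.ae_eq_mk
  have hNm : MeasurableSet N := measurableSet_toMeasurable _ _
  set G : E × E → ℝ≥0∞ := fun z => if z ∈ N then ⊤ else ‖hfm.mk F z‖ₑ with hG
  have hGm : Measurable G :=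
    Measurable.ite hNm measurable_const hfm.stronglyMeasurable_mk.measurable.enorm
  have hGle : ∀ z, ‖F z‖ₑ ≤ G z := by
    intro z
    by_cases hz : z ∈ N
    · simp [hG, hz]
    · have : F z = hfm.mk F z := by
        by_contra hne
        exact hz (subset_toMeasurable _ _ hne)
      simp [hG, hz, this]
  have hGae : ∀ᵐ z ∂((volume.restrict Ω).prod μ), G z = ‖F z‖ₑ := by
    have h1 : ∀ᵐ z ∂((volume.restrict Ω).prod μ), z ∉ N := measure_eq_zero_iff_ae_notMem.1 hN0
    filter_upwards [h1, hfm.ae_eq_mk] with z hz hz'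
    simp [hG, hz, hz']
  have hG2 : Measurable fun z : E × E => G z ^ 2 := hGm.pow_const 2
  have hum : Measurable fun y : E => ∫⁻ η, G (y, η) ^ 2 ∂μ := hG2.lintegral_prod_right'
  have hind : ∫⁻ x, Ω.indicator (fun y : E => ∫⁻ η, G (y, η) ^ 2 ∂μ) x =
      eLpNorm F 2 ((volume.restrict Ω).prod μ) ^ 2 := by
    rw [lintegral_indicator hΩ, eLpNorm_two_sq, ← lintegral_prod _ hG2.aemeasurable]
    refine lintegral_congr_ae ?_
    filter_upwards [hGae] with z hz
    rw [hz]
  refine ⟨Ω.indicator fun y => ∫⁻ η, G (y, η) ^ 2 ∂μ, hum.indicator hΩ,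
    fun x hx => indicator_of_notMem hx _, ?_, ?_, fun y hy => ⟨fun η => G (y, η), ?_, ?_, ?_⟩⟩
  · rw [hind]
    exact ENNReal.pow_ne_top hfn.ne
  · filter_upwards [Measure.ae_ae_of_ae_prod hGae, ae_restrict_mem hΩ] with y hy hyΩ
    rw [indicator_of_mem hyΩ]
    refine lintegral_congr_ae ?_
    filter_upwards [hy] with η hη
    rw [hη]
    rfl
  · fun_prop
  · exact fun η => hGle (y, η)
  · rw [indicator_of_mem hy]

/-- The absolute value of a function given by the Duhamel formula with source term `k`. -/
theorem enorm_le_of_duhamel {Ω : Set E} {f : E → E → ℝ} {k : E → E → ℝ} {a : ℝ} (ha : 0 ≤ a)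
    {H : E → ℝ≥0∞} {x ζ : E} (hk : ∀ y ∈ Ω, ‖k y ζ‖ₑ ≤ H y)
    (hf : f x ζ = f (backPoint Ω x ζ) ζ * Real.exp (-(a * backTime Ω x ζ)) +
      ∫ s in (0 : ℝ)..(backTime Ω x ζ), Real.exp (-(a * s)) * k (x - s • ζ) ζ) :
    ‖f x ζ‖ₑ ≤ ‖f (backPoint Ω x ζ) ζ‖ₑ +
      ∫⁻ s in Ioi (0 : ℝ), ENNReal.ofReal (Real.exp (-(a * s))) * H (x - s • ζ) := by
  have hτ := backTime_nonneg (Ω := Ω) x ζ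
  rw [hf]
  refine (enorm_add_le _ _).trans (add_le_add ?_ ?_)
  · rw [enorm_mul]
    refine mul_le_of_le_one_right' ?_
    rw [Real.enorm_eq_ofReal (Real.exp_pos _).le, ENNReal.ofReal_le_one, Real.exp_le_one_iff]
    linarith [mul_nonneg ha hτ]
  · rw [intervalIntegral.integral_of_le hτ, integral_Ioc_eq_integral_Ioo]
    refine (enorm_integral_le_lintegral_enorm _).trans ?_
    refine (setLIntegral_mono' measurableSet_Ioo fun s hs => ?_).trans
      (lintegral_mono_set Ioo_subset_Ioi_self)
    rw [enorm_mul, Real.enorm_eq_ofReal (Real.exp_pos _).le]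
    gcongr
    exact hk _ (mem_of_lt_backTime hs.1 hs.2)

/-- The pointwise bound that the Duhamel formula gives for a solution `f` in `L^*_{x,ζ}`, in terms
of the masses `u(y) = ∫ |f(y, η)|² ν dη` of its slices. -/
theorem exists_ae_enorm_le {γ : ℝ} {β : ℝ → ℝ} (hB : IsCutoffCrossSection γ β) :
    ∃ C : ℝ≥0∞, C ≠ ⊤ ∧ ∀ (Ω : Set E) (f : E → E → ℝ) (u : E → ℝ≥0∞),
      IsC1ConvexDomain Ω → IsSolution γ β Ω f →
      (∀ y ∈ Ω, ∃ G : E → ℝ≥0∞, Measurable G ∧ (∀ η, ‖f y η‖ₑ ≤ G η) ∧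
        ∫⁻ η, G η ^ 2 ∂(nuMeasure γ β) = u y) →
      ∀ᵐ z : E × E ∂((volume.restrict Ω).prod volume),
        (backPoint Ω z.1 z.2, z.2) ∈ incoming Ω ∧
        ‖f z.1 z.2‖ₑ ≤ ‖f (backPoint Ω z.1 z.2) z.2‖ₑ +
          ∫⁻ s in Ioi (0 : ℝ), ENNReal.ofReal (Real.exp (-(nu γ β z.2 * s))) *
            (C * ENNReal.ofReal ((1 + ‖z.2‖) ^ (γ - 3)) * u (z.1 - s • z.2)) ^ (1 / 2 : ℝ) := by
  obtain ⟨c, hc, hν⟩ := exists_le_nu hB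
  obtain ⟨C, hC, hK⟩ := exists_collK_sq_le hB
  refine ⟨C, hC, fun Ω f u hΩ hsol hu => ?_⟩
  have h1 : ∀ᵐ z : E × E ∂((volume.restrict Ω).prod volume), z.1 ∈ Ω :=
    Measure.quasiMeasurePreserving_fst.ae (ae_restrict_mem hΩ.isOpen.measurableSet)
  have h2 : ∀ᵐ z : E × E ∂((volume.restrict Ω).prod volume), z.2 ≠ 0 :=
    Measure.quasiMeasurePreserving_snd.ae (measure_eq_zero_iff_ae_notMem.1 (measure_singleton 0))
  filter_upwards [h1, h2, hsol] with z hx hζ hz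
  refine ⟨backPoint_mem_incoming hΩ hx hζ, ?_⟩
  have hν0 : 0 ≤ nu γ β z.2 := le_trans (by positivity) (hν z.2)
  refine enorm_le_of_duhamel (k := fun y ζ => collK γ β (f y) ζ)
    (H := fun y => (C * ENNReal.ofReal ((1 + ‖z.2‖) ^ (γ - 3)) * u y) ^ (1 / 2 : ℝ))
    hν0 (fun y hy => ?_) hz
  obtain ⟨G, hGm, hGle, hGu⟩ := hu y hy
  have := hK (f y) G hGm hGle z.2
  rw [hGu] at this
  calc _ = (‖collK γ β (f y) z.2‖ₑ ^ 2) ^ (1 / 2 : ℝ) := by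
        rw [← ENNReal.rpow_natCast, ← ENNReal.rpow_mul]
        norm_num
    _ ≤ _ := by gcongr

/-! ### Boundedness -/

theorem ofReal_mul_ofReal_one_div {a : ℝ} (ha : 0 < a) :
    ENNReal.ofReal a * ENNReal.ofReal (1 / a) = 1 := by
  rw [← ENNReal.ofReal_mul ha.le, mul_one_div_cancel ha.ne', ENNReal.ofReal_one]

/-- The inequality that starts the bootstrap. The weight `ν` of the norm cancels the factor `1 / ν`
gained by integration along characteristics. -/
theorem exists_mass_le_potential {γ : ℝ} {β : ℝ → ℝ} (hB : IsCutoffCrossSection γ β) {Ω : Set E}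
    (hΩ : IsC1ConvexDomain Ω) {f : E → E → ℝ} (hsol : IsSolution γ β Ω f) {φ : E → ℝ}
    (hle : ∀ X η : E, (X, η) ∈ incoming Ω → |f X η| ≤ φ η)
    {u : E → ℝ≥0∞} (hum : Measurable u)
    (hueq : ∀ᵐ y ∂(volume.restrict Ω), u y = ∫⁻ η, ‖f y η‖ₑ ^ 2 ∂(nuMeasure γ β))
    (hu : ∀ y ∈ Ω, ∃ G : E → ℝ≥0∞, Measurable G ∧ (∀ η, ‖f y η‖ₑ ≤ G η) ∧
        ∫⁻ η, G η ^ 2 ∂(nuMeasure γ β) = u y) :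
    ∃ B : ℝ≥0∞, B ≠ ⊤ ∧ ∀ᵐ x ∂(volume.restrict Ω),
      u x ≤ 2 * ∫⁻ η, ‖φ η‖ₑ ^ 2 ∂(nuMeasure γ β) + B * ∫⁻ y, ‖x - y‖ₑ ^ (-2 : ℝ) * u y := by
  obtain ⟨c, hc, hν⟩ := exists_le_nu hB
  obtain ⟨C, hC, hD⟩ := exists_ae_enorm_le hB
  obtain ⟨R, hR, hray⟩ := exists_lintegral_rays_le γ hB.gamma_lt_one
  refine ⟨2 * (C * R), by finiteness, ?_⟩
  filter_upwards [hueq, Measure.ae_ae_of_ae_prod (hD Ω f u hΩ hsol hu)] with x hx hxζ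
  set w : E → ℝ≥0∞ := fun ζ => ENNReal.ofReal ((1 + ‖ζ‖) ^ (γ - 3)) with hw
  have hwm : Measurable w := by fun_prop
  have hνm : Measurable fun ζ => ENNReal.ofReal (nu γ β ζ) := (measurable_nu γ β).ennreal_ofReal
  set I : E → ℝ≥0∞ := fun ζ => ∫⁻ s in Ioi (0 : ℝ), u (x - s • ζ) with hI
  have hum2 : Measurable fun z : E × ℝ => u (x - z.2 • z.1) := by fun_prop
  have hIm : Measurable I := hum2.lintegral_prod_right'
  have hwI : Measurable fun ζ => w ζ * I ζ := hwm.mul hIm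
  have hpt : ∀ᵐ ζ ∂(volume : Measure E), ‖f x ζ‖ₑ ^ 2 ≤
      2 * ‖φ ζ‖ₑ ^ 2 + 2 * (ENNReal.ofReal (1 / nu γ β ζ) * (C * (w ζ * I ζ))) := by
    filter_upwards [hxζ] with ζ hζ
    have hν0 : 0 < nu γ β ζ := lt_of_lt_of_le (by positivity) (hν ζ)
    have hb : ‖f (backPoint Ω x ζ) ζ‖ₑ ≤ ‖φ ζ‖ₑ := by
      rw [enorm_le_iff_norm_le]
      exact (hle _ _ hζ.1).trans (le_abs_self _)
    have hv : Measurable fun s : ℝ => (C * w ζ * u (x - s • ζ)) ^ (1 / 2 : ℝ) := by fun_prop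
    have hvu : Measurable fun s : ℝ => u (x - s • ζ) := by fun_prop
    have hcs := sq_lintegral_exp_mul_le hν0 hv
    have hsq : ∫⁻ s in Ioi (0 : ℝ), ((C * w ζ * u (x - s • ζ)) ^ (1 / 2 : ℝ)) ^ 2 =
        C * (w ζ * I ζ) := by
      rw [hI, ← mul_assoc, ← lintegral_const_mul _ hvu]
      refine lintegral_congr fun s => ?_
      rw [← ENNReal.rpow_natCast, ← ENNReal.rpow_mul]
      norm_num
    rw [hsq] at hcs
    refine (pow_le_pow_left' (hζ.2.trans (add_le_add_left hb _)) 2).trans ?_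
    refine (ennreal_add_sq_le _ _).trans ?_
    gcongr
  have hac : nuMeasure γ β ≪ volume := withDensity_absolutelyContinuous _ _
  have hm1 : Measurable fun ζ => 2 * (ENNReal.ofReal (1 / nu γ β ζ) * (C * (w ζ * I ζ))) := by
    have := measurable_nu γ β
    fun_prop
  rw [hx]
  calc ∫⁻ ζ, ‖f x ζ‖ₑ ^ 2 ∂(nuMeasure γ β)
      ≤ ∫⁻ ζ, (2 * ‖φ ζ‖ₑ ^ 2 +
          2 * (ENNReal.ofReal (1 / nu γ β ζ) * (C * (w ζ * I ζ)))) ∂(nuMeasure γ β) :=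
        lintegral_mono_ae (hac.ae_le hpt)
    _ = 2 * ∫⁻ ζ, ‖φ ζ‖ₑ ^ 2 ∂(nuMeasure γ β) +
        ∫⁻ ζ, 2 * (ENNReal.ofReal (1 / nu γ β ζ) * (C * (w ζ * I ζ))) ∂(nuMeasure γ β) := by
        rw [lintegral_add_right _ hm1, lintegral_const_mul' _ _ (by simp)]
    _ = 2 * ∫⁻ ζ, ‖φ ζ‖ₑ ^ 2 ∂(nuMeasure γ β) + 2 * (C * ∫⁻ ζ, w ζ * I ζ) := by
        congr 1
        rw [nuMeasure, lintegral_withDensity_eq_lintegral_mul _ hνm hm1, ← mul_assoc,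
          ← lintegral_const_mul _ hwI]
        refine lintegral_congr fun ζ => ?_
        have hν0 : 0 < nu γ β ζ := lt_of_lt_of_le (by positivity) (hν ζ)
        calc ENNReal.ofReal (nu γ β ζ) * (2 * (ENNReal.ofReal (1 / nu γ β ζ) * (C * (w ζ * I ζ))))
            = (ENNReal.ofReal (nu γ β ζ) * ENNReal.ofReal (1 / nu γ β ζ)) *
              (2 * C * (w ζ * I ζ)) := by ring
          _ = _ := by rw [ofReal_mul_ofReal_one_div hν0, one_mul]
    _ ≤ 2 * ∫⁻ ζ, ‖φ ζ‖ₑ ^ 2 ∂(nuMeasure γ β) +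
        2 * (C * (R * ∫⁻ y, ‖x - y‖ₑ ^ (-2 : ℝ) * u y)) := by
        gcongr
        exact hray u hum x
    _ = _ := by ring

/-- The masses of the slices of a solution are essentially bounded if its incoming boundary values
are dominated by a function in `L^*_ζ`. -/
theorem exists_ae_mass_le {γ : ℝ} {β : ℝ → ℝ} (hB : IsCutoffCrossSection γ β) {Ω : Set E}
    (hΩ : IsC1ConvexDomain Ω) {f : E → E → ℝ} (hsol : IsSolution γ β Ω f) {φ : E → ℝ}
    (hφ : MemLStarV γ β φ) (hle : ∀ X η : E, (X, η) ∈ incoming Ω → |f X η| ≤ φ η)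
    {u : E → ℝ≥0∞} (hum : Measurable u) (hu0 : ∀ x ∉ Ω, u x = 0) (hint : ∫⁻ x, u x ≠ ⊤)
    (hueq : ∀ᵐ y ∂(volume.restrict Ω), u y = ∫⁻ η, ‖f y η‖ₑ ^ 2 ∂(nuMeasure γ β))
    (hu : ∀ y ∈ Ω, ∃ G : E → ℝ≥0∞, Measurable G ∧ (∀ η, ‖f y η‖ₑ ≤ G η) ∧
        ∫⁻ η, G η ^ 2 ∂(nuMeasure γ β) = u y) :
    ∃ C : ℝ≥0∞, C ≠ ⊤ ∧ ∀ᵐ x ∂(volume.restrict Ω), u x ≤ C := by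
  obtain ⟨B, hB', hpot⟩ := exists_mass_le_potential hB hΩ hsol hle hum hueq hu
  refine exists_ae_le_of_le_potential hΩ.bounded.measure_lt_top.ne ?_ hB' hum hu0 hint hpot
  rw [← eLpNorm_two_sq]
  exact ENNReal.mul_ne_top (by simp) (ENNReal.pow_ne_top hφ.2.ne)

theorem memLInfLStar_of_ae_mass_le {γ : ℝ} {β : ℝ → ℝ} {Ω : Set E} {f : E → E → ℝ}
    (hf : MemLStarXV γ β Ω f) {u : E → ℝ≥0∞}
    (hueq : ∀ᵐ y ∂(volume.restrict Ω), u y = ∫⁻ η, ‖f y η‖ₑ ^ 2 ∂(nuMeasure γ β))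
    {C : ℝ≥0∞} (hC : C ≠ ⊤) (huC : ∀ᵐ x ∂(volume.restrict Ω), u x ≤ C) :
    MemLInfLStar γ β Ω f := by
  refine ⟨hf.1, lt_of_le_of_lt (essSup_le_of_ae_le (1 + C) ?_) (by finiteness)⟩
  filter_upwards [hueq, huC] with x hx hxC
  have h : eLpNorm (f x) 2 (nuMeasure γ β) ^ 2 ≤ C := by rw [eLpNorm_two_sq, ← hx]; exact hxC
  rcases le_total (eLpNorm (f x) 2 (nuMeasure γ β)) 1 with h1 | h1
  · exact h1.trans le_self_add
  · refine le_trans ?_ (h.trans le_add_self)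
    rw [sq]
    exact le_mul_of_one_le_right' h1

/-- A solution is bounded if its incoming boundary values and the masses of its slices are: almost
every backward characteristic avoids the null set on which the mass is large. -/
theorem memLInfXV_of_ae_mass_le {γ : ℝ} {β : ℝ → ℝ} (hB : IsCutoffCrossSection γ β) {Ω : Set E}
    (hΩ : IsC1ConvexDomain Ω) {f : E → E → ℝ} (hf : MemLStarXV γ β Ω f)
    (hsol : IsSolution γ β Ω f) {u : E → ℝ≥0∞} (hum : Measurable u) (hu0 : ∀ x ∉ Ω, u x = 0)
    (hu : ∀ y ∈ Ω, ∃ G : E → ℝ≥0∞, Measurable G ∧ (∀ η, ‖f y η‖ₑ ≤ G η) ∧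
        ∫⁻ η, G η ^ 2 ∂(nuMeasure γ β) = u y)
    {C : ℝ≥0∞} (hC : C ≠ ⊤) (huC : ∀ᵐ x ∂(volume.restrict Ω), u x ≤ C)
    {A : ℝ≥0∞} (hA : A ≠ ⊤) (hbd : ∀ X η : E, (X, η) ∈ incoming Ω → ‖f X η‖ₑ ≤ A) :
    MemLInfXV Ω f := by
  have : SFinite (nuMeasure γ β) := by unfold nuMeasure; infer_instance
  obtain ⟨c, hc, hν⟩ := exists_le_nu hB
  obtain ⟨K, hK, hD⟩ := exists_ae_enorm_le hB
  have h0 := hB.gamma_nonneg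
  have h1 := hB.gamma_lt_one
  have hfm : AEStronglyMeasurable (Function.uncurry f) ((volume.restrict Ω).prod volume) :=
    hf.1.mono_ac (Measure.AbsolutelyContinuous.prod Measure.AbsolutelyContinuous.rfl
      (volume_absolutelyContinuous_nuMeasure hB))
  set N : Set E := {x | C < u x} with hN
  have hNm : MeasurableSet N := measurableSet_lt measurable_const hum
  have hN0 : volume N = 0 := by
    rw [ae_restrict_iff' hΩ.isOpen.measurableSet] at huC
    refine measure_mono_null (fun x hx => ?_) (ae_iff.1 huC)
    rw [mem_ofPred_eq, Classical.not_imp, not_le]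
    refine ⟨?_, hx⟩
    by_contra hxΩ
    rw [hN, mem_ofPred_eq, hu0 x hxΩ] at hx
    exact not_lt_bot hx
  set T : ℝ≥0∞ := A + ENNReal.ofReal (1 / c) * (K * C) ^ (1 / 2 : ℝ) with hT
  have hTt : T ≠ ⊤ := by
    have : (K * C) ^ (1 / 2 : ℝ) ≠ ⊤ := ENNReal.rpow_ne_top_of_nonneg (by norm_num) (by finiteness)
    finiteness
  refine memLp_top_of_bound hfm T.toReal ?_
  filter_upwards [hD Ω f u hΩ hsol hu, ae_ae_line_notMem hNm hN0 Ω] with z hz hzN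
  have hνc : c ≤ nu γ β z.2 := by
    refine le_trans (le_mul_of_one_le_right hc.le ?_) (hν z.2)
    exact Real.one_le_rpow (by linarith [norm_nonneg z.2]) h0
  have hν0 : 0 < nu γ β z.2 := hc.trans_le hνc
  have hw : ENNReal.ofReal ((1 + ‖z.2‖) ^ (γ - 3)) ≤ 1 := by
    rw [ENNReal.ofReal_le_one]
    exact Real.rpow_le_one_of_one_le_of_nonpos (by linarith [norm_nonneg z.2]) (by linarith)
  have hm : Measurable fun s : ℝ => ENNReal.ofReal (Real.exp (-(nu γ β z.2 * s))) := by fun_prop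
  have hfT : ‖f z.1 z.2‖ₑ ≤ T := by
    refine hz.2.trans (add_le_add (hbd _ _ hz.1) ?_)
    calc _ ≤ ∫⁻ s in Ioi (0 : ℝ), ENNReal.ofReal (Real.exp (-(nu γ β z.2 * s))) *
          (K * C) ^ (1 / 2 : ℝ) := by
          refine lintegral_mono_ae ?_
          filter_upwards [hzN] with s hs
          have hs' : u (z.1 - s • z.2) ≤ C := not_lt.1 hs
          have : K * ENNReal.ofReal ((1 + ‖z.2‖) ^ (γ - 3)) * u (z.1 - s • z.2) ≤ K * C :=
            mul_le_mul' (mul_le_of_le_one_right' hw) hs'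
          exact mul_le_mul' le_rfl (ENNReal.rpow_le_rpow this (by norm_num))
      _ = ENNReal.ofReal (1 / nu γ β z.2) * (K * C) ^ (1 / 2 : ℝ) := by
          rw [lintegral_mul_const _ hm, lintegral_exp_neg_mul hν0]
      _ ≤ _ := by
          refine mul_le_mul' (ENNReal.ofReal_le_ofReal ?_) le_rfl
          exact one_div_le_one_div_of_le hc hνc
  rw [← ENNReal.toReal_ofReal (norm_nonneg (Function.uncurry f z)), ofReal_norm]
  exact ENNReal.toReal_mono hTt hfT

end LinBoltzmann

end

theorem mainTheorem4 (γ : ℝ) (β : ℝ → ℝ) (hB : LinBoltzmann.IsCutoffCrossSection γ β)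
    (Ω : Set LinBoltzmann.E) (hΩ : LinBoltzmann.IsC1ConvexDomain Ω)
    (f : LinBoltzmann.E → LinBoltzmann.E → ℝ)
    (hf : LinBoltzmann.MemLStarXV γ β Ω f)
    (hsol : LinBoltzmann.IsSolution γ β Ω f)
    (hin : ∃ φ : LinBoltzmann.E → ℝ, LinBoltzmann.MemLStarV γ β φ ∧
      ∀ X η : LinBoltzmann.E, (X, η) ∈ LinBoltzmann.incoming Ω → |f X η| ≤ φ η) :
    LinBoltzmann.MemLInfLStar γ β Ω f ∧
      ∀ σ : ℝ, 0 < σ → σ < 1 / 2 →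
        (∃ M : ℝ, 0 < M ∧ ∀ X η Y ω : LinBoltzmann.E,
          (X, η) ∈ LinBoltzmann.incoming Ω → (Y, ω) ∈ LinBoltzmann.incoming Ω →
            |f X η - f Y ω| ≤ M * (‖η - ω‖ ^ 2 + ‖X - Y‖ ^ 2) ^ (σ / 2)) →
        LinBoltzmann.MemLInfXV Ω f := by
  obtain ⟨φ, hφ, hle⟩ := hin
  obtain ⟨u, hum, hu0, hint, hueq, hu⟩ :=
    LinBoltzmann.exists_measurable_slice_mass hΩ.isOpen.measurableSet hf
  obtain ⟨C, hC, huC⟩ :=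
    LinBoltzmann.exists_ae_mass_le hB hΩ hsol hφ hle hum hu0 hint hueq hu
  refine ⟨LinBoltzmann.memLInfLStar_of_ae_mass_le hf hueq hC huC, ?_⟩
  rintro σ hσ - ⟨M, hM, hcont⟩
  obtain ⟨A, hA, hbd⟩ := LinBoltzmann.exists_enorm_incoming_le hB hφ hle hσ hM hcont
  exact LinBoltzmann.memLInfXV_of_ae_mass_le hB hΩ hf hsol hum hu0 hu hC huC hA hbd
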